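/- Let $1\le k\le n$ be integers and $0\le\alpha\le\frac12$. For an integer $j\ge1$ let $h=h_j>0$ be defined by $h^{-2}=j(j+n-1)$. Let $S^n\subset\mathbb R^{n+1}$ be the unit sphere with its surface measure, with coordinates $x=(x_1,\dots,x_{n+1})$, and let $\Delta_{S^n}$ be the positive Laplace–Beltrami operator. Fix $\varepsilon>0$, $c>0$, $K\in\mathbb R$ and a sequence of constants $(A_r)_{r\ge0}$. Then there are $\delta\in(0,\varepsilon]$ and, for every $j\ge1$, with $$N_k=\lceil\delta\,h^{(\alpha-1/2)(k-1)}\rceil ,$$ real linear polynomials $P_{l,k}(x_2,\dots,x_{k+1})=\sum_{m=2}^{k+1}\alpha^m_{k,l}x_m$, $1\le l\le N_k$, such that the following holds. (a) For all $j\ge 1$ and $l$: $|1-\alpha^2_{k,l}|\le\varepsilon h^{2\alpha}$, where $\alpha^2_{k,l}$ is the coefficient of $x_2$, and $|\alpha^m_{k,l}|\le\varepsilon h^{\alpha}$ for $m\ne2$. (b) For all $j\ge1$ the function $$u_k(x)=h^{-\frac{n-1}{4}+\frac{(1/2-\alpha)(k-1)}{2}}\sum_{l=1}^{N_k}\bigl(ix_1+P_{l,k}(x_2,\dots,x_{k+1})\bigr)^j$$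 is smooth on $S^n$ and satisfies $\Delta_{S^n}u_k=j(j+n-1)u_k$. (c) Consider any function of the form $$v_k(x)=h^{-\frac{n-1}{4}+\frac{(1/2-\alpha)(k-1)}{2}}\sum_{l=1}^{N_k}\bigl(ix_1+P_{l,k}(x_2,\dots,x_{k+1})\bigr)^{\tilde\jmath}f_{l}(x),$$ where $j\ge1$, $\tilde\jmath\ge0$ is an integer with $|\tilde\jmath-j|\le K$, and the $f_{l}:S^n\to\mathbb C$ are smooth with $|f_{l}|>c$ and whose derivatives of every order $r\ge0$ are bounded on $S^n$ by $A_r h^{-r/2}$ (the derivatives being those, at points of $S^n$, of the extension of $f_l$ to $\mathbb R^{n+1}\setminus\{0\}$ that is constant along rays). If $k<n$, then for every $\beta\in\mathbb R$ there are constants $c_1,c_2>0$, independent of $j$, $\tilde\jmath$ and the $f_l$, such that for $t=h^{-1}$ and for $t=h$ $$c_1\le\bigl\|(1+t(x_{k+2}^2+\dots+x_{n+1}^2))^{\beta}v_k\bigr\|_{L^2(S^n)}\le c_2 .$$ If $k=n$, there are constants $c_1,c_2>0$, independent of $j$, $\tilde\jmath$ and the $f_l$, such that $c_1\le\|v_n\|_{L^2(S^n)}\le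 c_2$. -/

import Mathlib

open MeasureTheory Metric
open scoped Manifold ContDiff InnerProductSpace

noncomputable section

/-- The unit sphere `S^n` in `ℝ^{n+1}`. The coordinates `x_1, …, x_{n+1}` of a point are
`x 0, …, x n`. -/
abbrev UnitSphere (n : ℕ) : Type :=
  sphere (0 : EuclideanSpace ℝ (Fin (n + 1))) 1

/-- The extension of a function on `S^n` to `ℝ^{n+1} ∖ {0}` that is constant along rays
(with the value `0` at the origin, which plays no role). -/
def radialExt {n : ℕ} (f : UnitSphere n → ℂ) (y : EuclideanSpace ℝ (Fin (n + 1))) : ℂ :=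
  if hy : y = 0 then 0
  else f ⟨‖y‖⁻¹ • y, by
    rw [mem_sphere_zero_iff_norm, norm_smul, norm_inv, norm_norm,
      inv_mul_cancel₀ (norm_ne_zero_iff.mpr hy)]⟩

/-- The positive Laplace-Beltrami operator of the round sphere `S^n`: minus the Euclidean
Laplacian of the extension that is constant along rays, restricted to the sphere. -/
def sphereLaplacian {n : ℕ} (f : UnitSphere n → ℂ) (x : UnitSphere n) : ℂ :=
  -(Laplacian.laplacian (radialExt f) (x : EuclideanSpace ℝ (Fin (n + 1))))

/-- The surface measure on `S^n`. -/
def surfaceMeasure (n : ℕ) : Measure (UnitSphere n) :=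
  (volume : Measure (EuclideanSpace ℝ (Fin (n + 1)))).toSphere

/-- The semiclassical parameter: `h = (j (j + n - 1))^{-1/2}`, so that `h^{-2} = j (j + n - 1)`. -/
def semiclassicalH (n j : ℕ) : ℝ :=
  (Real.sqrt ((j : ℝ) * ((j : ℝ) + (n : ℝ) - 1)))⁻¹

theorem semiclassicalH_spec (n j : ℕ) (hn : 1 ≤ n) :
    (semiclassicalH n j ^ 2)⁻¹ = (j : ℝ) * ((j : ℝ) + (n : ℝ) - 1) := by
  have h1 : (1 : ℝ) ≤ n := by exact_mod_cast hn
  have h2 : (0 : ℝ) ≤ j := Nat.cast_nonneg j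
  have h3 : (0 : ℝ) ≤ (j : ℝ) * ((j : ℝ) + (n : ℝ) - 1) := mul_nonneg h2 (by linarith)
  rw [semiclassicalH, inv_pow, inv_inv, Real.sq_sqrt h3]

/-- The number of summands: `δ h^{(α - 1/2)(k - 1)}`, rounded up to an integer. -/
def termCount (n k : ℕ) (α δ : ℝ) (j : ℕ) : ℕ :=
  ⌈δ * semiclassicalH n j ^ ((α - 1 / 2) * ((k : ℝ) - 1))⌉₊

/-- The linear polynomial `P(x_2, …, x_{k+1}) = ∑_{m=2}^{k+1} a^m x_m`. The coefficient `a^m` of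
`x_m` is stored as `a (m - 2)`. -/
def linPoly {n k : ℕ} (hk : k ≤ n) (a : Fin k → ℝ) (x : UnitSphere n) : ℝ :=
  ∑ m : Fin k, a m * x.1 (Fin.castLE hk m).succ

/-- The weighted sum
`h^{-(n-1)/4 + (1/2-α)(k-1)/2} ∑_l (i x_1 + P_l(x_2, …, x_{k+1}))^{j'} f_l(x)` on `S^n`, where
`h` is the semiclassical parameter of `j`. -/
def harmonicSum {n k : ℕ} (hk : k ≤ n) (α : ℝ) (j : ℕ) {N : ℕ} (a : Fin N → Fin k → ℝ)
    (j' : ℕ) (f : Fin N → UnitSphere n → ℂ) (x : UnitSphere n) : ℂ :=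
  ((semiclassicalH n j ^
      (-((n : ℝ) - 1) / 4 + (1 / 2 - α) * ((k : ℝ) - 1) / 2) : ℝ) : ℂ) *
    ∑ l : Fin N,
      (Complex.I * ((x.1 0 : ℝ) : ℂ) + ((linPoly hk (a l) x : ℝ) : ℂ)) ^ j' * f l x

/-- The admissible weights: smooth functions `f` on `S^n` with `|f| > c` everywhere and
`|D^γ f| ≤ A_{|γ|} h^{-|γ|/2}` for all orders of differentiation. Derivatives on the sphere are
those of the extension that is constant along rays. -/
structure AdmissibleWeight {n : ℕ} (h c : ℝ) (A : ℕ → ℝ) (f : UnitSphere n → ℂ) : Prop where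
  smooth : ContMDiff (𝓡 n) 𝓘(ℝ, ℂ) ∞ f
  lower : ∀ x, c < ‖f x‖
  deriv_le : ∀ (r : ℕ) (x : UnitSphere n),
    ‖iteratedFDeriv ℝ r (radialExt f) (x : EuclideanSpace ℝ (Fin (n + 1)))‖
      ≤ A r * h ^ (-((r : ℝ) / 2))

/-- The polynomial weight `(1 + t (x_{k+2}^2 + ⋯ + x_{n+1}^2))^β`. -/
def polyWeight {n : ℕ} (k : ℕ) (t β : ℝ) (x : UnitSphere n) : ℝ :=
  (1 + t * ∑ i : Fin (n + 1) with k < i.val, x.1 i ^ 2) ^ β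

/-- The norm in `L^2(S^n)`. -/
def sphereL2Norm {n : ℕ} (v : UnitSphere n → ℂ) : ENNReal :=
  eLpNorm v 2 (surfaceMeasure n)

end

/-!
For a unit vector `a` orthogonal to the first basis vector `e`, the linear form
`φ = i⟨e, x⟩ + ⟨a, x⟩` has an isotropic coefficient vector. Hence `φ ^ j`, whose extension constant
along rays is `‖x‖ ^ (-j) * φ ^ j`, is an eigenfunction with eigenvalue `j (j + n - 1)`
(`laplacian_norm_rpow_mul_linForm_pow`); it is a beam of width `h ^ (1/2)` around the great circle
through `e` and `a`.

The norm estimates rest on the almost orthogonality of beams whose directions `a` are separated by a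
large multiple of `h ^ (1/2)`. An integral over the sphere becomes, by homogeneity, a Gaussian
integral over `ℝ^{n+1}`. Cauchy's formula on the circle of radius `√(J + 1)` writes `φ ^ J` as a
superposition of coherent states moving along the great circle (`pow_eq_integral_exp`), and the
product of two coherent states is a Gaussian damped by the distance of the positions and oscillating
with the difference of the momenta (`coherent_mul_conj`). Amplitudes whose derivatives of order `r`
grow like `h ^ (-r/2)` have bounded derivatives at this scale, so integration by parts gives
rapid decay in the phase space distance, which dominates both the distance `‖a - a'‖` and the
distance of the times. With Stirling's formula the cross terms on the sphere are
`O(h ^ ((n - 1)/2) (1 + ‖a - a'‖ h ^ (-1/2)) ^ (-r))` for every `r`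
(`exists_sphere_cross_term_bound`), while one beam has squared norm at least a multiple of
`h ^ ((n - 1)/2)` (`exists_le_integral_norm_beamForm_pow`, where the Gaussian norm of `φ ^ J` is
`J!` times that of `1`).

The ball of radius `ε' h ^ α` around the first direction contains a grid of spacing `M h ^ (1/2)`
with a multiple of `h ^ ((α - 1/2)(k - 1))` points, and the cross terms of one beam with all the
others sum to `O(M⁻¹)` (`exists_separated_directions`). For `M` large they are absorbed by the
diagonal, which gives the unweighted bounds from both sides. Monomials in the coordinates that
vanish on all the great circles gain a factor `h ^ (1/2)` per degree in the same estimate, because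
the centres of the Gaussians lie in the span of the circles; this gives the upper bound for weights
with any exponent and `t ≤ h⁻¹`. The lower bound for the exponent `β` follows from the unweighted
lower bound and the upper bound for `-β` (`sq_div_le_integral_polyWeight_mul`).
-/

open scoped SchwartzMap FourierTransform

/-! ### The powers are spherical harmonics -/

/-- The second derivative on the diagonal is the second derivative along a line, so that Laplacians
can be computed with calculus in one variable. -/
theorem iteratedFDeriv_two_apply_self_of_hasDerivAt {E F : Type*} [NormedAddCommGroup E]
    [NormedSpace ℝ E] [NormedAddCommGroup F] [NormedSpace ℝ F] {g : E → F} {x v : E}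
    (hg : ContDiffAt ℝ 2 g x) {g₁ : ℝ → F} {g₂ : F}
    (h₁ : ∀ᶠ s in nhds (0 : ℝ), HasDerivAt (fun s : ℝ => g (x + s • v)) (g₁ s) s)
    (h₂ : HasDerivAt g₁ g₂ 0) : iteratedFDeriv ℝ 2 g x ![v, v] = g₂ := by
  rw [iteratedFDeriv_two_apply]
  have hline : ∀ s : ℝ, HasDerivAt (fun s : ℝ => x + s • v) v s := by
    intro s
    simpa using ((hasDerivAt_id s).smul_const v).const_add x
  have hcont : Filter.Tendsto (fun s : ℝ => x + s • v) (nhds 0) (nhds x) := by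
    have := (hline 0).continuousAt.tendsto
    simpa using this
  have hd : ∀ᶠ y in nhds x, DifferentiableAt ℝ g y := by
    have := (hg.eventually (by simp)).mono fun y hy => hy.differentiableAt (by simp)
    exact this
  have hfd : DifferentiableAt ℝ (fderiv ℝ g) x :=
    (hg.fderiv_right (m := 1) (by norm_num)).differentiableAt (by simp)
  have heq : ∀ᶠ s in nhds (0 : ℝ), g₁ s = fderiv ℝ g (x + s • v) v := by
    filter_upwards [h₁, hcont.eventually hd] with s hs hs'
    exact hs.unique (hs'.hasFDerivAt.comp_hasDerivAt s (hline s))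
  have hfd' : HasFDerivAt (fderiv ℝ g) (fderiv ℝ (fderiv ℝ g) x) (x + (0 : ℝ) • v) := by
    simpa using hfd.hasFDerivAt
  have h3 : HasDerivAt (fun s : ℝ => fderiv ℝ g (x + s • v) v)
      (fderiv ℝ (fderiv ℝ g) x v v) 0 := by
    have := hfd'.comp_hasDerivAt 0 (hline 0)
    exact ((ContinuousLinearMap.apply ℝ F v).hasFDerivAt.comp_hasDerivAt 0 this)
  exact h3.unique (h₂.congr_of_eventuallyEq (heq.mono fun _ h => h.symm))

/-- The complex linear form `y ↦ ∑ᵢ zᵢ yᵢ` on Euclidean space. -/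
noncomputable def linForm {d : ℕ} (z : Fin d → ℂ) (y : EuclideanSpace ℝ (Fin d)) : ℂ :=
  ∑ i, z i * (y i : ℂ)

theorem contDiff_linForm {d : ℕ} (z : Fin d → ℂ) : ContDiff ℝ ∞ (linForm z) := by
  unfold linForm
  refine ContDiff.sum fun i _ => contDiff_const.mul ?_
  exact Complex.ofRealCLM.contDiff.comp (contDiff_piLp_apply (p := 2))

theorem linForm_add_smul_single {d : ℕ} (z : Fin d → ℂ) (x : EuclideanSpace ℝ (Fin d))
    (s : ℝ) (i : Fin d) :
    linForm z (x + s • EuclideanSpace.single i 1) = linForm z x + s * z i := by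
  unfold linForm
  simp only [PiLp.add_apply, PiLp.smul_apply, PiLp.single_apply, smul_eq_mul,
    Complex.ofReal_add, Complex.ofReal_mul, mul_add, Finset.sum_add_distrib]
  congr 1
  rw [Finset.sum_eq_single i]
  · simp [mul_comm]
  · intro b _ hb; simp [hb]
  · simp

theorem norm_sq_add_smul_single {d : ℕ} (x : EuclideanSpace ℝ (Fin d)) (s : ℝ) (i : Fin d) :
    ‖x + s • EuclideanSpace.single i (1 : ℝ)‖ ^ 2 = ‖x‖ ^ 2 + 2 * s * x i + s ^ 2 := by
  rw [norm_add_sq_real, norm_smul, inner_smul_right, EuclideanSpace.inner_single_right]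
  simp
  ring

/-- An isotropic power, made homogeneous of degree zero, is at unit vectors an eigenfunction of the
Euclidean Laplacian. -/
theorem laplacian_norm_rpow_mul_linForm_pow {n : ℕ} (j : ℕ) (z : Fin (n + 1) → ℂ)
    (hz : ∑ i, z i ^ 2 = 0) (x : EuclideanSpace ℝ (Fin (n + 1))) (hx : ‖x‖ = 1) :
    Laplacian.laplacian (fun y : EuclideanSpace ℝ (Fin (n + 1)) =>
      ((((‖y‖ ^ 2) ^ (-(j : ℝ) / 2) : ℝ)) : ℂ) * linForm z y ^ j) x
      = -((j : ℂ) * ((j : ℂ) + n - 1) * linForm z x ^ j) := by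
  set g := fun y : EuclideanSpace ℝ (Fin (n + 1)) =>
      ((((‖y‖ ^ 2) ^ (-(j : ℝ) / 2) : ℝ)) : ℂ) * linForm z y ^ j with hgdef
  have hx0 : ‖x‖ ^ 2 ≠ 0 := by rw [hx]; norm_num
  have hg : ContDiffAt ℝ 2 g x := by
    refine ContDiffAt.mul ?_ (((contDiff_linForm z).of_le (by norm_cast)).contDiffAt.pow j)
    refine Complex.ofRealCLM.contDiff.contDiffAt.comp x ?_
    exact (contDiff_norm_sq ℝ).contDiffAt.rpow_const_of_ne hx0
  rw [congrFun (InnerProductSpace.laplacian_eq_iteratedFDeriv_orthonormalBasis g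
    (EuclideanSpace.basisFun (Fin (n + 1)) ℝ)) x]
  have key : ∀ i, iteratedFDeriv ℝ 2 g x
      ![EuclideanSpace.basisFun (Fin (n + 1)) ℝ i, EuclideanSpace.basisFun (Fin (n + 1)) ℝ i]
      = ((-(j : ℂ)) + j * (j + 2) * (x i : ℂ) ^ 2) * linForm z x ^ j
        + 2 * (-(j : ℂ) * x i) * (j * linForm z x ^ (j - 1) * z i)
        + j * ((j - 1 : ℕ) * linForm z x ^ (j - 1 - 1) * z i) * z i := by
    intro i
    rw [EuclideanSpace.basisFun_apply]
    set w := linForm z x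
    set a : ℝ := -(j : ℝ) / 2 with ha
    have hpoly : ∀ s : ℝ, HasDerivAt (fun s : ℝ => 1 + 2 * s * x i + s ^ 2) (2 * x i + 2 * s) s := by
      intro s
      have := (((hasDerivAt_id s).const_mul 2).mul_const (x i)).const_add 1 |>.add
        (hasDerivAt_pow 2 s)
      refine this.congr_deriv ?_
      simp
    have hlin : ∀ s : ℝ, HasDerivAt (fun s : ℝ => w + s * z i) (z i) s := by
      intro s
      have := ((hasDerivAt_id s).ofReal_comp.mul_const (z i)).const_add w
      simpa using this
    have hgs : ∀ s : ℝ, g (x + s • EuclideanSpace.single i 1)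
        = (((1 + 2 * s * x i + s ^ 2) ^ a : ℝ) : ℂ) * (w + s * z i) ^ j := by
      intro s
      rw [hgdef]
      simp only
      rw [norm_sq_add_smul_single, linForm_add_smul_single, hx, one_pow]
    have hpos : ∀ᶠ s in nhds (0 : ℝ), (1 + 2 * s * x i + s ^ 2) ≠ 0 := by
      have hc : ContinuousAt (fun s : ℝ => 1 + 2 * s * x i + s ^ 2) 0 := (hpoly 0).continuousAt
      exact hc.eventually_ne (by simp)
    have hr : ∀ (b s : ℝ), 1 + 2 * s * x i + s ^ 2 ≠ 0 →
        HasDerivAt (fun s : ℝ => (((1 + 2 * s * x i + s ^ 2) ^ b : ℝ) : ℂ))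
          (((2 * x i + 2 * s) * b * (1 + 2 * s * x i + s ^ 2) ^ (b - 1) : ℝ) : ℂ) s := by
      intro b s hs
      exact ((hpoly s).rpow_const (Or.inl hs)).ofReal_comp
    refine iteratedFDeriv_two_apply_self_of_hasDerivAt hg
      (g₁ := fun s : ℝ => (((2 * x i + 2 * s) * a * (1 + 2 * s * x i + s ^ 2) ^ (a - 1) : ℝ) : ℂ)
        * (w + s * z i) ^ j + (((1 + 2 * s * x i + s ^ 2) ^ a : ℝ) : ℂ)
          * (j * (w + s * z i) ^ (j - 1) * z i)) ?_ ?_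
    · filter_upwards [hpos] with s hs
      simp_rw [hgs]
      exact (hr a s hs).mul ((hlin s).pow j)
    · have h0 : 1 + 2 * (0 : ℝ) * x i + 0 ^ 2 ≠ 0 := by simp
      have e1 : HasDerivAt (fun s : ℝ => (((2 * x i + 2 * s) * a : ℝ) : ℂ)) ((2 * a : ℝ) : ℂ) 0 := by
        have := ((((hasDerivAt_id (0 : ℝ)).const_mul 2).const_add (2 * x i)).mul_const a).ofReal_comp
        simpa using this
      have e2 := (e1.mul (hr (a - 1) 0 h0)).mul ((hlin 0).pow j)
      have e3 := (hr a 0 h0).mul ((((hlin 0).pow (j - 1)).const_mul (j : ℂ)).mul_const (z i))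
      have e4 := e2.add e3
      have ha' : (a : ℂ) = -(j : ℂ) / 2 := by rw [ha]; push_cast; ring
      refine (e4.congr_of_eventuallyEq (Filter.Eventually.of_forall fun s => ?_)).congr_deriv ?_
      · simp only [Pi.add_apply, Pi.mul_apply, Pi.pow_apply]; push_cast; ring
      · simp [ha']
        ring
  rw [Finset.sum_congr rfl fun i _ => key i]
  have hxs : ∑ i, ((x i : ℝ) : ℂ) ^ 2 = 1 := by
    have := EuclideanSpace.real_norm_sq_eq x
    rw [hx] at this
    have h2 : ((∑ i, (x i) ^ 2 : ℝ) : ℂ) = 1 := by rw [← this]; norm_num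
    simpa using h2
  have hw : ∑ i, z i * ((x i : ℝ) : ℂ) = linForm z x := rfl
  have hjj : (j : ℂ) * (linForm z x ^ (j - 1) * linForm z x) = j * linForm z x ^ j := by
    rcases j with _ | j
    · simp
    · simp [pow_succ]
  calc _ = ((n + 1) * (-(j : ℂ)) + j * (j + 2) * ∑ i, ((x i : ℝ) : ℂ) ^ 2) * linForm z x ^ j
        + (-2 * (j : ℂ)) * (j * linForm z x ^ (j - 1)) * (∑ i, z i * ((x i : ℝ) : ℂ))
        + j * ((j - 1 : ℕ) * linForm z x ^ (j - 1 - 1)) * ∑ i, z i ^ 2 := by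
        simp only [Finset.sum_add_distrib, Finset.mul_sum, Finset.sum_mul, add_mul, mul_add,
          Finset.sum_const, Finset.card_univ, Fintype.card_fin, nsmul_eq_mul]
        push_cast
        congr 1
        · congr 1
          · congr 1
            · ring
          · exact Finset.sum_congr rfl fun i _ => by ring
        · exact Finset.sum_congr rfl fun i _ => by ring
    _ = _ := by
        rw [hxs, hz, hw]
        have : -2 * (j : ℂ) * (j * linForm z x ^ (j - 1)) * linForm z x
          = -2 * (j : ℂ) * (j * linForm z x ^ j) := by rw [← hjj]; ring
        rw [this]; ring

/-! ### The sums as sums of beams -/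

/-- The vector of `ℝ^{n+1}` with coordinates `a` at the places `x_2, …, x_{k+1}` and `0`
elsewhere. -/
noncomputable def coeffVec {n k : ℕ} (hk : k ≤ n) (a : Fin k → ℝ) :
    EuclideanSpace ℝ (Fin (n + 1)) :=
  ∑ m : Fin k, a m • EuclideanSpace.single (Fin.castLE hk m).succ (1 : ℝ)

theorem inner_coeffVec {n k : ℕ} (hk : k ≤ n) (a : Fin k → ℝ)
    (x : EuclideanSpace ℝ (Fin (n + 1))) :
    ⟪coeffVec hk a, x⟫_ℝ = ∑ m : Fin k, a m * x (Fin.castLE hk m).succ := by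
  simp [coeffVec, sum_inner, inner_smul_left, EuclideanSpace.inner_single_left]

theorem coeffVec_apply_succ {n k : ℕ} (hk : k ≤ n) (a : Fin k → ℝ) (m : Fin k) :
    coeffVec hk a (Fin.castLE hk m).succ = a m := by
  simp [coeffVec, Finset.sum_apply, Pi.single_apply, Fin.ext_iff]
  simp [← Fin.ext_iff]

theorem coeffVec_apply_zero {n k : ℕ} (hk : k ≤ n) (a : Fin k → ℝ) :
    coeffVec hk a 0 = 0 := by
  simp [coeffVec, Finset.sum_apply, Fin.ext_iff]

theorem coeffVec_apply_of_lt {n k : ℕ} (hk : k ≤ n) (a : Fin k → ℝ) {i : Fin (n + 1)}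
    (hi : k < i.val) : coeffVec hk a i = 0 := by
  simp only [coeffVec, WithLp.ofLp_sum, WithLp.ofLp_smul, Finset.sum_apply, Pi.smul_apply,
    PiLp.single_apply, smul_eq_mul]
  refine Finset.sum_eq_zero fun m _ => ?_
  rw [if_neg, mul_zero]
  intro h
  have := congrArg Fin.val h
  simp at this
  omega

theorem inner_coeffVec_coeffVec {n k : ℕ} (hk : k ≤ n) (a b : Fin k → ℝ) :
    ⟪coeffVec hk a, coeffVec hk b⟫_ℝ = ∑ m : Fin k, a m * b m := by
  simp [inner_coeffVec, coeffVec_apply_succ]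

theorem coeffVec_sub {n k : ℕ} (hk : k ≤ n) (a b : Fin k → ℝ) :
    coeffVec hk (a - b) = coeffVec hk a - coeffVec hk b := by
  simp [coeffVec, sub_smul, Finset.sum_sub_distrib]

theorem norm_sq_coeffVec {n k : ℕ} (hk : k ≤ n) (a : Fin k → ℝ) :
    ‖coeffVec hk a‖ ^ 2 = ∑ m : Fin k, a m ^ 2 := by
  rw [← real_inner_self_eq_norm_sq, inner_coeffVec_coeffVec]
  simp [sq]

/-- The linear form `i x_1 + ⟨a, x⟩` on `ℝ^{n+1}`. -/
noncomputable def beamForm {n : ℕ} (a x : EuclideanSpace ℝ (Fin (n + 1))) : ℂ :=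
  Complex.I * ((x 0 : ℝ) : ℂ) + ((⟪a, x⟫_ℝ : ℝ) : ℂ)

theorem linPoly_eq_inner {n k : ℕ} (hk : k ≤ n) (a : Fin k → ℝ) (x : UnitSphere n) :
    linPoly hk a x = ⟪coeffVec hk a, x.1⟫_ℝ := (inner_coeffVec hk a x.1).symm

theorem harmonicSum_eq {n k : ℕ} (hk : k ≤ n) (α : ℝ) (j : ℕ) {N : ℕ} (a : Fin N → Fin k → ℝ)
    (j' : ℕ) (f : Fin N → UnitSphere n → ℂ) (x : UnitSphere n) :
    harmonicSum hk α j a j' f x = ((semiclassicalH n j ^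
      (-((n : ℝ) - 1) / 4 + (1 / 2 - α) * ((k : ℝ) - 1) / 2) : ℝ) : ℂ) *
      ∑ l : Fin N, beamForm (coeffVec hk (a l)) x.1 ^ j' * f l x := by
  simp only [harmonicSum, beamForm, linPoly_eq_inner]

theorem beamForm_eq_linForm {n : ℕ} (a x : EuclideanSpace ℝ (Fin (n + 1))) (ha : a 0 = 0) :
    beamForm a x = linForm (Fin.cons Complex.I fun i => ((a i.succ : ℝ) : ℂ)) x := by
  simp only [beamForm, linForm, Fin.sum_univ_succ, Fin.cons_zero, Fin.cons_succ,
    PiLp.inner_apply, ha]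
  push_cast
  simp [mul_comm]

theorem beamForm_smul {n : ℕ} (a x : EuclideanSpace ℝ (Fin (n + 1))) (s : ℝ) :
    beamForm a (s • x) = s * beamForm a x := by
  simp only [beamForm, inner_smul_right, PiLp.smul_apply, smul_eq_mul]
  push_cast; ring

theorem contDiff_beamForm {n : ℕ} (a : EuclideanSpace ℝ (Fin (n + 1))) :
    ContDiff ℝ ∞ (beamForm a) := by
  unfold beamForm
  refine (contDiff_const.mul ?_).add ?_
  · exact Complex.ofRealCLM.contDiff.comp (contDiff_piLp_apply (p := 2))
  · exact Complex.ofRealCLM.contDiff.comp (contDiff_const.inner ℝ contDiff_id)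

theorem contMDiff_harmonicSum_one {n k : ℕ} (hk : k ≤ n) (α : ℝ) (j : ℕ) {N : ℕ}
    (a : Fin N → Fin k → ℝ) (j' : ℕ) :
    ContMDiff (𝓡 n) 𝓘(ℝ, ℂ) ∞ (harmonicSum hk α j a j' (fun _ _ => 1)) := by
  have h : ContDiff ℝ ∞ (fun x : EuclideanSpace ℝ (Fin (n + 1)) => ((semiclassicalH n j ^
      (-((n : ℝ) - 1) / 4 + (1 / 2 - α) * ((k : ℝ) - 1) / 2) : ℝ) : ℂ) *
      ∑ l : Fin N, beamForm (coeffVec hk (a l)) x ^ j' * 1) := by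
    refine contDiff_const.mul (ContDiff.sum fun l _ => ?_)
    exact ((contDiff_beamForm _).pow _).mul contDiff_const
  have := Fact.mk (@finrank_euclideanSpace_fin ℝ _ (n + 1))
  have h2 := h.contMDiff.comp (contMDiff_coe_sphere (n := n) (m := ∞)
    (E := EuclideanSpace ℝ (Fin (n + 1))))
  refine h2.congr fun x => ?_
  rw [harmonicSum_eq]
  rfl

/-- Dividing a form of degree `j` by `‖x‖ ^ j` makes it constant along rays; the power of `‖x‖ ^ 2`
is the shape that is visibly smooth. -/
theorem norm_rpow_neg_half {x : ℝ} (hx : 0 < x) (j : ℕ) :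
    (x ^ 2) ^ (-(j : ℝ) / 2) = x⁻¹ ^ j := by
  rw [← Real.rpow_natCast x 2, ← Real.rpow_mul hx.le]
  rw [show ((2 : ℕ) : ℝ) * (-(j : ℝ) / 2) = -(j : ℝ) by push_cast; ring,
    Real.rpow_neg hx.le, Real.rpow_natCast, inv_pow]

/-- Each summand is the power of a linear form whose coefficient vector `(i, a)` is isotropic
because `a` is a unit vector. -/
theorem sphereLaplacian_harmonicSum {n k : ℕ} (hk : k ≤ n) (α : ℝ) (j : ℕ) {N : ℕ}
    (a : Fin N → Fin k → ℝ) (ha : ∀ l, ∑ m, a l m ^ 2 = 1) (x : UnitSphere n) :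
    sphereLaplacian (harmonicSum hk α j a j (fun _ _ => 1)) x
      = (j : ℂ) * ((j : ℂ) + (n : ℂ) - 1) * harmonicSum hk α j a j (fun _ _ => 1) x := by
  have hx : ‖x.1‖ = 1 := by simp
  have hx0 : x.1 ≠ 0 := by intro h; rw [h] at hx; simp at hx
  set C : ℂ := ((semiclassicalH n j ^
      (-((n : ℝ) - 1) / 4 + (1 / 2 - α) * ((k : ℝ) - 1) / 2) : ℝ) : ℂ) with hC
  set z : Fin N → Fin (n + 1) → ℂ := fun l =>
    Fin.cons Complex.I fun i => ((coeffVec hk (a l) i.succ : ℝ) : ℂ) with hz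
  have hbz : ∀ l y, beamForm (coeffVec hk (a l)) y = linForm (z l) y := fun l y =>
    beamForm_eq_linForm _ _ (coeffVec_apply_zero hk _)
  have hzz : ∀ l, ∑ i, z l i ^ 2 = 0 := by
    intro l
    have h1 := norm_sq_coeffVec hk (a l)
    rw [ha l, EuclideanSpace.real_norm_sq_eq, Fin.sum_univ_succ, coeffVec_apply_zero] at h1
    rw [hz, Fin.sum_univ_succ]
    simp only [Fin.cons_zero, Fin.cons_succ, Complex.I_sq]
    have h2 : ((∑ i : Fin n, (coeffVec hk (a l) i.succ) ^ 2 : ℝ) : ℂ) = 1 := by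
      have h3 : (∑ i : Fin n, (coeffVec hk (a l) i.succ) ^ 2 : ℝ) = 1 := by
        rw [← h1]; ring
      rw [h3]; norm_num
    push_cast at h2
    rw [h2]; ring
  set g : Fin N → EuclideanSpace ℝ (Fin (n + 1)) → ℂ := fun l y =>
      ((((‖y‖ ^ 2) ^ (-(j : ℝ) / 2) : ℝ)) : ℂ) * linForm (z l) y ^ j with hg
  have hev : radialExt (harmonicSum hk α j a j (fun _ _ => 1)) =ᶠ[nhds x.1]
      fun y => ∑ l, C * g l y := by
    filter_upwards [isOpen_ne.mem_nhds hx0] with y hy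
    have hy : y ≠ 0 := hy
    have hyn : 0 < ‖y‖ := norm_pos_iff.mpr hy
    rw [radialExt, dif_neg hy, harmonicSum_eq, Finset.mul_sum]
    refine Finset.sum_congr rfl fun l _ => ?_
    rw [beamForm_smul, hbz, hg]
    simp only [mul_one]
    rw [norm_rpow_neg_half hyn, mul_pow]
    push_cast
    rfl
  have hgd : ∀ l, ContDiffAt ℝ 2 (g l) x.1 := by
    intro l
    refine ContDiffAt.mul ?_ (((contDiff_linForm _).of_le (by norm_cast)).contDiffAt.pow j)
    refine Complex.ofRealCLM.contDiff.contDiffAt.comp x.1 ?_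
    exact (contDiff_norm_sq ℝ).contDiffAt.rpow_const_of_ne (by rw [hx]; norm_num)
  have hsum : ∀ s : Finset (Fin N), Laplacian.laplacian (fun y => ∑ l ∈ s, C * g l y) x.1
      = ∑ l ∈ s, C * Laplacian.laplacian (g l) x.1 := by
    intro s
    induction s using Finset.induction_on with
    | empty =>
      simp only [Finset.sum_empty]
      exact congrFun InnerProductSpace.laplacian_const x.1
    | insert l s hl ih =>
      have hadd := ContDiffAt.laplacian_add (x := x.1) (f₁ := fun y => C * g l y)
        (f₂ := fun y => ∑ l ∈ s, C * g l y) (contDiffAt_const.mul (hgd l))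
        (ContDiffAt.sum fun l _ => contDiffAt_const.mul (hgd l))
      have hsm := InnerProductSpace.laplacian_smul (x := x.1) C (hgd l)
      have e1 : (fun y => ∑ l ∈ insert l s, C * g l y)
          = (fun y => C * g l y) + (fun y => ∑ l ∈ s, C * g l y) := by
        funext y; simp [Finset.sum_insert hl]
      rw [e1, hadd, ih, Finset.sum_insert hl]
      congr 1
  rw [sphereLaplacian, InnerProductSpace.laplacian_congr_nhds hev |>.self_of_nhds, hsum,
    harmonicSum_eq, Finset.mul_sum, Finset.mul_sum, ← Finset.sum_neg_distrib]
  refine Finset.sum_congr rfl fun l _ => ?_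
  rw [laplacian_norm_rpow_mul_linForm_pow j (z l) (hzz l) x.1 hx, hbz]
  ring

/-! ### Stirling's formula and radial Gaussian moments -/

/-- Stirling's upper bound, in the form in which it turns a Cauchy estimate on the circle of radius
`√(J + 1)` into a bound by `J!`. -/
theorem factorial_mul_exp_le (J : ℕ) :
    (J.factorial : ℝ) * Real.exp (J + 1) ≤
      Real.exp 1 * Real.sqrt (J + 1) * ((J : ℝ) + 1) ^ J := by
  have h := Stirling.stirlingSeq'_antitone (Nat.zero_le J)
  simp only [Function.comp_apply, Nat.succ_eq_add_one, zero_add, Stirling.stirlingSeq_one] at h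
  rw [Stirling.stirlingSeq] at h
  have hJ : (0 : ℝ) < J + 1 := by positivity
  rw [div_le_div_iff₀ (by positivity) (by positivity)] at h
  push_cast [Nat.factorial_succ] at h
  rw [Real.sqrt_mul (by norm_num), div_pow, ← Real.exp_nat_mul] at h
  push_cast at h
  rw [mul_one] at h
  have h2 : (0 : ℝ) < Real.sqrt 2 := by positivity
  have he : (0 : ℝ) < Real.exp (J + 1) := Real.exp_pos _
  have h3 : ((J : ℝ) + 1) * J.factorial * Real.sqrt 2 * Real.exp (J + 1) ≤
      Real.exp 1 * (Real.sqrt 2 * Real.sqrt (J + 1) * ((J : ℝ) + 1) ^ (J + 1)) := by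
    calc _ ≤ Real.exp 1 * (Real.sqrt 2 * Real.sqrt (J + 1) *
          (((J : ℝ) + 1) ^ (J + 1) / Real.exp (J + 1))) * Real.exp (J + 1) := by gcongr
      _ = _ := by field_simp
  have h4 : (((J : ℝ) + 1) * Real.sqrt 2) * (J.factorial * Real.exp (J + 1)) ≤
      (((J : ℝ) + 1) * Real.sqrt 2) * (Real.exp 1 * Real.sqrt (J + 1) * ((J : ℝ) + 1) ^ J) := by
    calc _ = _ := by ring
      _ ≤ _ := h3
      _ = _ := by ring
  exact le_of_mul_le_mul_left h4 (by positivity)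

/-- A consequence of the log-convexity of the Gamma function. -/
theorem Gamma_add_half_sq_le {x : ℝ} (hx : 0 < x) :
    Real.Gamma (x + 1 / 2) ^ 2 ≤ x * Real.Gamma x ^ 2 := by
  have h := Real.Gamma_mul_add_mul_le_rpow_Gamma_mul_rpow_Gamma hx (by linarith : 0 < x + 1)
    (by norm_num : (0 : ℝ) < 1 / 2) (by norm_num : (0 : ℝ) < 1 / 2) (by norm_num)
  rw [show (1 / 2 : ℝ) * x + 1 / 2 * (x + 1) = x + 1 / 2 by ring, ← Real.sqrt_eq_rpow,
    ← Real.sqrt_eq_rpow, Real.Gamma_add_one hx.ne'] at h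
  have hG : 0 < Real.Gamma x := Real.Gamma_pos_of_pos hx
  have hG' : 0 < Real.Gamma (x + 1 / 2) := Real.Gamma_pos_of_pos (by linarith)
  calc _ ≤ (Real.sqrt (Real.Gamma x) * Real.sqrt (x * Real.Gamma x)) ^ 2 := by gcongr
    _ = x * Real.Gamma x ^ 2 := by
      rw [mul_pow, Real.sq_sqrt hG.le, Real.sq_sqrt (by positivity)]; ring

theorem Gamma_add_half_le {x : ℝ} (hx : 0 < x) :
    Real.Gamma (x + 1 / 2) ≤ Real.sqrt x * Real.Gamma x := by
  have hG : 0 < Real.Gamma x := Real.Gamma_pos_of_pos hx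
  refine abs_le_of_sq_le_sq' ?_ (by positivity) |>.2
  rw [mul_pow, Real.sq_sqrt hx.le]
  exact Gamma_add_half_sq_le hx

theorem le_Gamma_add_half {x : ℝ} (hx : 1 ≤ x) :
    1 / 2 * Real.sqrt x * Real.Gamma x ≤ Real.Gamma (x + 1 / 2) := by
  have hx0 : 0 < x := by linarith
  have h := Gamma_add_half_sq_le (x := x + 1 / 2) (by linarith)
  rw [show x + 1 / 2 + 1 / 2 = x + 1 by ring, Real.Gamma_add_one hx0.ne'] at h
  have hG : 0 < Real.Gamma x := Real.Gamma_pos_of_pos hx0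
  have hG' : 0 < Real.Gamma (x + 1 / 2) := Real.Gamma_pos_of_pos (by linarith)
  refine abs_le_of_sq_le_sq' ?_ hG'.le |>.2
  rw [mul_pow, mul_pow, Real.sq_sqrt hx0.le]
  set G := Real.Gamma x ^ 2
  set H := Real.Gamma (x + 1 / 2) ^ 2
  have hGp : 0 < G := by positivity
  have hHp : 0 < H := by positivity
  have h1 : x * (x * G) ≤ (x + 1 / 2) * H := by calc _ = (x * Real.Gamma x) ^ 2 := by ring
                                                  _ ≤ _ := h
  have h2 : (x + 1 / 2) * H ≤ 2 * x * H := by gcongr; linarith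
  have h3 : x * (x * G) ≤ x * (2 * H) := by linarith
  have h4 := le_of_mul_le_mul_left h3 hx0
  nlinarith [mul_pos hx0 hGp]

/-- Half-integer shifts of the Gamma function have the expected growth. -/
theorem exists_Gamma_add_nat_half_bounds (m : ℕ) : ∃ c C : ℝ, 0 < c ∧ 0 < C ∧ ∀ x : ℝ, 1 ≤ x →
    c * Real.sqrt x ^ m * Real.Gamma x ≤ Real.Gamma (x + m / 2) ∧
    Real.Gamma (x + m / 2) ≤ C * Real.sqrt x ^ m * Real.Gamma x := by
  induction m with
  | zero => exact ⟨1, 1, one_pos, one_pos, fun x hx => by simp⟩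
  | succ m ih =>
    obtain ⟨c, C, hc, hC, h⟩ := ih
    refine ⟨1 / 2 * c, Real.sqrt (1 + m / 2) * C, by positivity, by positivity, fun x hx => ?_⟩
    have hx0 : 0 < x := by linarith
    obtain ⟨h1, h2⟩ := h x hx
    have hy : 1 ≤ x + m / 2 := by have : (0 : ℝ) ≤ m / 2 := by positivity
                                  linarith
    have hG : 0 < Real.Gamma x := Real.Gamma_pos_of_pos hx0
    have e : x + ((m + 1 : ℕ) : ℝ) / 2 = x + m / 2 + 1 / 2 := by push_cast; ring
    rw [e]
    constructor
    · refine le_trans ?_ (le_Gamma_add_half hy)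
      calc 1 / 2 * c * Real.sqrt x ^ (m + 1) * Real.Gamma x
          = 1 / 2 * Real.sqrt x * (c * Real.sqrt x ^ m * Real.Gamma x) := by ring
        _ ≤ _ := by
          gcongr
          have : (0 : ℝ) ≤ m / 2 := by positivity
          linarith
    · refine (Gamma_add_half_le (by linarith)).trans ?_
      calc Real.sqrt (x + m / 2) * Real.Gamma (x + m / 2)
          ≤ (Real.sqrt (1 + m / 2) * Real.sqrt x) * (C * Real.sqrt x ^ m * Real.Gamma x) := by
            refine mul_le_mul ?_ h2 (Real.Gamma_pos_of_pos (by linarith)).le (by positivity)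
            rw [← Real.sqrt_mul (by positivity)]
            apply Real.sqrt_le_sqrt
            have : (0 : ℝ) ≤ m / 2 := by positivity
            nlinarith
        _ = _ := by ring

theorem integral_pow_mul_exp_neg_sq (s : ℕ) :
    ∫ r in Set.Ioi (0 : ℝ), r ^ s * Real.exp (-r ^ 2) = 1 / 2 * Real.Gamma (((s : ℝ) + 1) / 2) := by
  have h := integral_rpow_mul_exp_neg_rpow (p := 2) (q := s) (by norm_num)
    (by have : (0 : ℝ) ≤ s := by positivity
        linarith)
  rw [← h]
  refine setIntegral_congr_fun measurableSet_Ioi fun x hx => ?_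
  simp only [Real.rpow_natCast, Real.rpow_two]

theorem integrableOn_pow_mul_exp_neg_sq (s : ℕ) :
    IntegrableOn (fun r : ℝ => r ^ s * Real.exp (-r ^ 2)) (Set.Ioi 0) := by
  by_contra h
  have h2 := integral_pow_mul_exp_neg_sq s
  rw [integral_undef h] at h2
  have : 0 < Real.Gamma (((s : ℝ) + 1) / 2) := Real.Gamma_pos_of_pos (by positivity)
  linarith

theorem monotoneOn_pow_mul_exp_neg_sq (s : ℕ) {b : ℝ} (hb : 2 * b ^ 2 ≤ s) :
    MonotoneOn (fun r : ℝ => r ^ s * Real.exp (-r ^ 2)) (Set.Icc 0 b) := by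
  have hd : ∀ r : ℝ, HasDerivAt (fun r : ℝ => r ^ s * Real.exp (-r ^ 2))
      (s * r ^ (s - 1) * Real.exp (-r ^ 2) + r ^ s * (Real.exp (-r ^ 2) * (-(2 * r)))) r := by
    intro r
    have h1 := (hasDerivAt_pow 2 r).neg.exp
    refine ((hasDerivAt_pow s r).mul h1).congr_deriv ?_
    simp
  refine monotoneOn_of_deriv_nonneg (convex_Icc 0 b)
    (fun x _ => (hd x).continuousAt.continuousWithinAt)
    (fun x _ => (hd x).differentiableAt.differentiableWithinAt) fun x hx => ?_
  rw [interior_Icc] at hx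
  rw [(hd x).deriv]
  have hx0 : 0 < x := hx.1
  rcases s with _ | s
  · have : 0 < b := hx0.trans hx.2
    simp at hb
    nlinarith
  · have hxb : x ^ 2 ≤ b ^ 2 := by gcongr; exact hx.2.le
    have e : ((s + 1 : ℕ) : ℝ) * x ^ (s + 1 - 1) * Real.exp (-x ^ 2)
        + x ^ (s + 1) * (Real.exp (-x ^ 2) * (-(2 * x)))
        = x ^ s * Real.exp (-x ^ 2) * (((s + 1 : ℕ) : ℝ) - 2 * x ^ 2) := by
      simp only [Nat.add_sub_cancel]; ring
    rw [e]
    have : 0 ≤ ((s + 1 : ℕ) : ℝ) - 2 * x ^ 2 := by linarith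
    positivity

/-- A cutoff away from the origin retains at least half of a radial Gaussian moment, when the
removed interval lies well before the maximum of the integrand. -/
theorem le_integral_pow_mul_exp_neg_sq_mul (s : ℕ) {b : ℝ} (hb0 : 0 ≤ b) (hb : 8 * b ^ 2 ≤ s)
    {ψ : ℝ → ℝ} (hψm : Measurable ψ) (hψ0 : ∀ r, 0 ≤ ψ r) (hψ1 : ∀ r, ψ r ≤ 1)
    (hψ : ∀ r, b ≤ r → ψ r = 1) :
    1 / 4 * Real.Gamma (((s : ℝ) + 1) / 2) ≤
      ∫ r in Set.Ioi (0 : ℝ), r ^ s * Real.exp (-r ^ 2) * ψ r := by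
  set g := fun r : ℝ => r ^ s * Real.exp (-r ^ 2) with hg
  have hgc : Continuous g := by rw [hg]; fun_prop
  have hint : IntegrableOn g (Set.Ioi 0) := integrableOn_pow_mul_exp_neg_sq s
  have hg0 : ∀ r, 0 ≤ r → 0 ≤ g r := fun r hr => by simp only [hg]; positivity
  have hintψ : IntegrableOn (fun r => g r * ψ r) (Set.Ioi 0) := by
    refine Integrable.mono hint ((hgc.measurable.mul hψm).aestronglyMeasurable) ?_
    filter_upwards [ae_restrict_mem measurableSet_Ioi] with r hr
    rw [norm_mul, Real.norm_of_nonneg (hψ0 r)]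
    exact mul_le_of_le_one_right (norm_nonneg _) (hψ1 r)
  have hIoi : Set.Ioi b ⊆ Set.Ioi (0 : ℝ) := Set.Ioi_subset_Ioi hb0
  have h1 : ∫ r in Set.Ioi b, g r ≤ ∫ r in Set.Ioi (0 : ℝ), g r * ψ r := by
    calc ∫ r in Set.Ioi b, g r = ∫ r in Set.Ioi b, g r * ψ r := by
          refine setIntegral_congr_fun measurableSet_Ioi fun r hr => ?_
          rw [hψ r (le_of_lt hr), mul_one]
      _ ≤ _ := by
          refine setIntegral_mono_set hintψ ?_ hIoi.eventuallyLE
          filter_upwards [ae_restrict_mem measurableSet_Ioi] with r hr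
          exact mul_nonneg (hg0 r (le_of_lt hr)) (hψ0 r)
  have h2 : ∫ r in (0 : ℝ)..b, g r ≤ ∫ r in b..(2 * b), g r := by
    have e : ∫ r in (0 : ℝ)..b, g (r + b) = ∫ r in b..(2 * b), g r := by
      rw [intervalIntegral.integral_comp_add_right]
      congr 1
      · ring
      · ring
    rw [← e]
    refine intervalIntegral.integral_mono_on hb0 (hgc.intervalIntegrable _ _)
      ((hgc.comp (continuous_add_const b)).intervalIntegrable _ _) fun r hr => ?_
    have hm := monotoneOn_pow_mul_exp_neg_sq s (b := 2 * b) (by nlinarith)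
    exact hm ⟨hr.1, by linarith [hr.2]⟩ ⟨by linarith [hr.1], by linarith [hr.2]⟩ (by linarith)
  have h3 : ∫ r in b..(2 * b), g r ≤ ∫ r in Set.Ioi b, g r := by
    rw [intervalIntegral.integral_of_le (by linarith)]
    refine setIntegral_mono_set (hint.mono_set hIoi) ?_
      (Set.Ioc_subset_Ioi_self.eventuallyLE)
    filter_upwards [ae_restrict_mem measurableSet_Ioi] with r hr
    exact hg0 r (le_of_lt (hIoi hr))
  have h4 : ∫ r in Set.Ioi (0 : ℝ), g r = (∫ r in (0 : ℝ)..b, g r) + ∫ r in Set.Ioi b, g r := by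
    rw [intervalIntegral.integral_of_le hb0,
      ← setIntegral_union (Set.Ioc_disjoint_Ioi le_rfl) measurableSet_Ioi
        (hint.mono_set Set.Ioc_subset_Ioi_self) (hint.mono_set hIoi), Set.Ioc_union_Ioi_eq_Ioi hb0]
  have h5 := integral_pow_mul_exp_neg_sq s
  change ∫ r in Set.Ioi (0 : ℝ), g r = _ at h5
  change _ ≤ ∫ r in Set.Ioi (0 : ℝ), g r * ψ r
  linarith

/-! ### Fourier decay with Gaussian densities -/

section Gaussian

variable {V : Type*} [NormedAddCommGroup V] [InnerProductSpace ℝ V]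

theorem contDiff_exp_neg_norm_sq : ContDiff ℝ ∞ (fun x : V => Real.exp (-‖x‖ ^ 2)) :=
  (contDiff_norm_sq ℝ).neg.exp

theorem fderiv_exp_neg_norm_sq (x : V) :
    fderiv ℝ (fun x : V => Real.exp (-‖x‖ ^ 2)) x
      = Real.exp (-‖x‖ ^ 2) • ((-2 : ℝ) • innerSL ℝ x) := by
  have h : HasFDerivAt (fun x : V => -‖x‖ ^ 2) (-(2 • (innerSL ℝ x))) x :=
    (hasStrictFDerivAt_norm_sq x).hasFDerivAt.neg
  rw [h.exp.fderiv]
  congr 1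
  ext y
  simp

/-- Every derivative of the Gaussian is bounded by a polynomial times the Gaussian. -/
theorem exists_norm_iteratedFDeriv_exp_neg_norm_sq_le (m : ℕ) : ∃ (C : ℝ) (N : ℕ), 0 ≤ C ∧
    ∀ x : V, ‖iteratedFDeriv ℝ m (fun x : V => Real.exp (-‖x‖ ^ 2)) x‖
      ≤ C * (1 + ‖x‖) ^ N * Real.exp (-‖x‖ ^ 2) := by
  induction m using Nat.strong_induction_on with
  | _ m ih =>
    rcases m with _ | m
    · refine ⟨1, 0, zero_le_one, fun x => ?_⟩
      simp
    · choose! C N hC h using ih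
      set L : V →L[ℝ] (V →L[ℝ] ℝ) := (-2 : ℝ) • innerSL ℝ with hL
      have hLg : Function.HasTemperateGrowth (fun x : V => L x) := L.hasTemperateGrowth
      have hLb : ∀ i, ∃ (k : ℕ) (B : ℝ), ∀ x,
          ‖iteratedFDeriv ℝ i (fun x => L x) x‖ ≤ B * (1 + ‖x‖) ^ k :=
        fun i => hLg.2 i
      choose K B hB using hLb
      refine ⟨∑ i ∈ Finset.range (m + 1), (m.choose i : ℝ) * C i * |B (m - i)|,
        ∑ i ∈ Finset.range (m + 1), (N i + K (m - i)), ?_, fun x => ?_⟩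
      · refine Finset.sum_nonneg fun i hi => ?_
        have := hC i (by simpa using hi)
        positivity
      · rw [← norm_iteratedFDeriv_fderiv]
        have e : fderiv ℝ (fun x : V => Real.exp (-‖x‖ ^ 2))
            = fun x => (fun x : V => Real.exp (-‖x‖ ^ 2)) x • L x := by
          funext x; rw [fderiv_exp_neg_norm_sq]; rfl
        rw [e]
        have hle := norm_iteratedFDeriv_smul_le (𝕜 := ℝ) (contDiff_exp_neg_norm_sq (V := V))
          hLg.1 x (n := m) (by exact_mod_cast le_top)
        refine hle.trans ?_
        rw [Finset.sum_mul, Finset.sum_mul]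
        refine Finset.sum_le_sum fun i hi => ?_
        have hi' : i < m + 1 := by simpa using hi
        have h1 := h i hi' x
        have h2 : ‖iteratedFDeriv ℝ (m - i) (fun x => L x) x‖
            ≤ |B (m - i)| * (1 + ‖x‖) ^ K (m - i) :=
          (hB (m - i) x).trans (by gcongr; exact le_abs_self _)
        have hCi := hC i hi'
        have hpow : (1 + ‖x‖) ^ (N i + K (m - i)) ≤
            (1 + ‖x‖) ^ (∑ i ∈ Finset.range (m + 1), (N i + K (m - i))) := by
          refine pow_le_pow_right₀ (by linarith [norm_nonneg x]) ?_
          exact Finset.single_le_sum (f := fun i => N i + K (m - i)) (fun i _ => Nat.zero_le _) hi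
        calc _ ≤ (m.choose i : ℝ) * (C i * (1 + ‖x‖) ^ N i * Real.exp (-‖x‖ ^ 2))
              * (|B (m - i)| * (1 + ‖x‖) ^ K (m - i)) := by gcongr
          _ = (m.choose i : ℝ) * C i * |B (m - i)| * (1 + ‖x‖) ^ (N i + K (m - i))
              * Real.exp (-‖x‖ ^ 2) := by rw [pow_add]; ring
          _ ≤ _ := by gcongr

theorem exists_pow_mul_exp_neg_sq_le (N : ℕ) : ∃ C : ℝ, ∀ t : ℝ, 0 ≤ t →
    (1 + t) ^ N * Real.exp (-t ^ 2) ≤ C := by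
  refine ⟨(N.factorial : ℝ) * Real.exp 2, fun t ht => ?_⟩
  have h1 : (1 + t) ^ N / N.factorial ≤ Real.exp (1 + t) :=
    Real.pow_div_factorial_le_exp (1 + t) (by linarith) N
  rw [div_le_iff₀ (by positivity)] at h1
  calc (1 + t) ^ N * Real.exp (-t ^ 2)
      ≤ (Real.exp (1 + t) * N.factorial) * Real.exp (-t ^ 2) := by gcongr
    _ = N.factorial * Real.exp (1 + t - t ^ 2) := by
        rw [sub_eq_add_neg, Real.exp_add (1 + t)]; ring
    _ ≤ _ := by
      gcongr
      nlinarith [sq_nonneg (t - 1)]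

variable (V) in
/-- The Gaussian `x ↦ exp (-‖x‖²)` as a complex-valued Schwartz function. -/
noncomputable def gaussianSchwartz : 𝓢(V, ℂ) where
  toFun x := (Real.exp (-‖x‖ ^ 2) : ℂ)
  smooth' := Complex.ofRealCLM.contDiff.comp contDiff_exp_neg_norm_sq
  decay' k m := by
    obtain ⟨C, N, hC, h⟩ := exists_norm_iteratedFDeriv_exp_neg_norm_sq_le (V := V) m
    obtain ⟨D, hD⟩ := exists_pow_mul_exp_neg_sq_le (k + N)
    refine ⟨C * D, fun x => ?_⟩
    have e : ‖iteratedFDeriv ℝ m (fun x : V => ((Real.exp (-‖x‖ ^ 2) : ℝ) : ℂ)) x‖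
        = ‖iteratedFDeriv ℝ m (fun x : V => Real.exp (-‖x‖ ^ 2)) x‖ :=
      Complex.ofRealLI.norm_iteratedFDeriv_comp_left
        (contDiff_exp_neg_norm_sq (V := V)).contDiffAt (by exact_mod_cast le_top)
    rw [e]
    have hx := norm_nonneg x
    calc ‖x‖ ^ k * _ ≤ (1 + ‖x‖) ^ k * (C * (1 + ‖x‖) ^ N * Real.exp (-‖x‖ ^ 2)) := by
          gcongr
          · linarith
          · exact h x
      _ = C * ((1 + ‖x‖) ^ (k + N) * Real.exp (-‖x‖ ^ 2)) := by rw [pow_add]; ring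
      _ ≤ C * D := by
        gcongr
        exact hD _ hx

/-- The Schwartz function `x ↦ ⟨u, x⟩ ^ m * exp (-‖x‖²)`. -/
noncomputable def gaussianMoment (u : V) (m : ℕ) : 𝓢(V, ℂ) :=
  SchwartzMap.smulLeftCLM ℂ (fun x : V => ⟪u, x⟫_ℝ ^ m) (gaussianSchwartz V)

theorem gaussianMoment_apply (u : V) (m : ℕ) (x : V) :
    gaussianMoment u m x = ((⟪u, x⟫_ℝ ^ m : ℝ) : ℂ) * (Real.exp (-‖x‖ ^ 2) : ℂ) := by
  have h : Function.HasTemperateGrowth (fun x : V => ⟪u, x⟫_ℝ) := (innerSL ℝ u).hasTemperateGrowth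
  have h2 : Function.HasTemperateGrowth (fun x : V => ⟪u, x⟫_ℝ ^ m) := by fun_prop
  rw [gaussianMoment, SchwartzMap.smulLeftCLM_apply_apply h2]
  rw [Complex.real_smul]
  rfl

theorem norm_iteratedFDeriv_mul_le_of_bound {S G : V → ℂ} (hS : ContDiff ℝ ∞ S)
    (hG : ContDiff ℝ ∞ G) {D : ℕ → ℝ} (r : ℕ) (hD : ∀ i ≤ r, ∀ x, ‖iteratedFDeriv ℝ i G x‖ ≤ D i)
    {m : ℕ} (hm : m ≤ r) (x : V) :
    ‖iteratedFDeriv ℝ m (fun x => S x * G x) x‖ ≤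
      ∑ i ∈ Finset.range (m + 1), (m.choose i : ℝ) * ‖iteratedFDeriv ℝ i S x‖ * D (m - i) := by
  refine (norm_iteratedFDeriv_mul_le hS hG x (n := m) (by exact_mod_cast le_top)).trans ?_
  refine Finset.sum_le_sum fun i _ => ?_
  gcongr
  exact hD _ (by omega) x

end Gaussian

section Fourier

variable {V : Type*} [NormedAddCommGroup V] [InnerProductSpace ℝ V] [FiniteDimensional ℝ V]
  [MeasurableSpace V] [BorelSpace V]

/-- Integration by parts: a Schwartz function times a function with bounded derivatives has a
rapidly decaying Fourier transform, with constants that depend only on the bounds. -/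
theorem exists_fourier_decay (S : 𝓢(V, ℂ)) (r : ℕ) (D : ℕ → ℝ) : ∃ C : ℝ, 0 ≤ C ∧
    ∀ G : V → ℂ, ContDiff ℝ ∞ G → (∀ i ≤ r, ∀ x, ‖iteratedFDeriv ℝ i G x‖ ≤ D i) →
    ∀ w : V, ‖∫ x, Complex.exp (Complex.I * (⟪w, x⟫_ℝ : ℝ)) * (S x * G x)‖
      * (1 + ‖w‖) ^ r ≤ C := by
  set M : ℕ → ℝ := fun m => ∑ i ∈ Finset.range (m + 1),
    (m.choose i : ℝ) * (∫ x, ‖iteratedFDeriv ℝ i S x‖) * |D (m - i)| with hM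
  have hM0 : ∀ m, 0 ≤ M m := fun m => Finset.sum_nonneg fun i _ =>
    mul_nonneg (mul_nonneg (by positivity) (integral_nonneg fun x => norm_nonneg _)) (abs_nonneg _)
  refine ⟨2 ^ (r - 1) * (M 0 + (2 * Real.pi) ^ r * (2 ^ r * ∑ p ∈ Finset.range (r + 1), M p)),
    ?_, ?_⟩
  · have : 0 ≤ ∑ p ∈ Finset.range (r + 1), M p := Finset.sum_nonneg fun i _ => hM0 i
    have := hM0 0
    positivity
  intro G hG hD w
  set f : V → ℂ := fun x => S x * G x with hf
  have hfs : ContDiff ℝ ∞ f := (S.smooth ⊤).mul hG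
  have hSint : ∀ i, Integrable (fun x => ‖iteratedFDeriv ℝ i S x‖) := by
    intro i
    simpa using S.integrable_pow_mul_iteratedFDeriv volume 0 i
  have hbd : ∀ m ≤ r, ∀ x, ‖iteratedFDeriv ℝ m f x‖ ≤
      ∑ i ∈ Finset.range (m + 1), (m.choose i : ℝ) * ‖iteratedFDeriv ℝ i S x‖ * |D (m - i)| := by
    intro m hm x
    refine norm_iteratedFDeriv_mul_le_of_bound (D := fun i => |D i|) (S.smooth ⊤) hG r ?_ hm x
    exact fun i hi x => (hD i hi x).trans (le_abs_self _)
  have hbint : ∀ m, Integrable (fun x => ∑ i ∈ Finset.range (m + 1),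
      (m.choose i : ℝ) * ‖iteratedFDeriv ℝ i S x‖ * |D (m - i)|) := fun m =>
    integrable_finsetSum _ fun i _ => ((hSint i).const_mul _).mul_const _
  have hfint : ∀ m ≤ r, Integrable (fun x => ‖iteratedFDeriv ℝ m f x‖) := by
    intro m hm
    refine (hbint m).mono' ?_ ?_
    · exact ((hfs.continuous_iteratedFDeriv (by exact_mod_cast le_top)).norm).aestronglyMeasurable
    · exact Filter.Eventually.of_forall fun x => by rw [norm_norm]; exact hbd m hm x
  have hfle : ∀ m ≤ r, ∫ x, ‖iteratedFDeriv ℝ m f x‖ ≤ M m := by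
    intro m hm
    refine (integral_mono (hfint m hm) (hbint m) (hbd m hm)).trans_eq ?_
    rw [integral_finsetSum _ fun i _ => ((hSint i).const_mul _).mul_const _]
    refine Finset.sum_congr rfl fun i _ => ?_
    rw [integral_mul_const, integral_const_mul]
  have hfour : ∫ x, Complex.exp (Complex.I * (⟪w, x⟫_ℝ : ℝ)) * f x
      = 𝓕 f (-(2 * Real.pi)⁻¹ • w) := by
    rw [Real.fourier_eq']
    refine integral_congr_ae (Filter.Eventually.of_forall fun x => ?_)
    simp only [smul_eq_mul]
    congr 2
    rw [inner_smul_right, real_inner_comm]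
    push_cast
    field_simp
  rw [hfour]
  set w' : V := -(2 * Real.pi)⁻¹ • w with hw'
  have h0 : ‖𝓕 f w'‖ ≤ M 0 := by
    refine (VectorFourier.norm_fourierIntegral_le_integral_norm _ _ _ _ _).trans ?_
    have := hfle 0 (Nat.zero_le _)
    simpa using this
  have hr : ‖w'‖ ^ r * ‖𝓕 f w'‖ ≤ 2 ^ r * ∑ p ∈ Finset.range (r + 1), M p := by
    have h := Real.pow_mul_norm_iteratedFDeriv_fourier_le (K := 0) (N := r)
      (hfs.of_le (by exact_mod_cast le_top)) (k := 0) (n := r) ?_ le_rfl le_rfl w'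
    · rw [norm_iteratedFDeriv_zero] at h
      refine h.trans ?_
      simp only [pow_zero, zero_add, Nat.cast_zero, mul_zero, one_mul, Finset.range_one,
        Finset.sum_product, Finset.sum_singleton]
      gcongr with p hp
      exact hfle p (by simpa [Nat.lt_succ_iff] using hp)
    · intro k n hk hn
      have hk' : k = 0 := by simpa using hk
      subst hk'
      have hn' : n ≤ r := by exact_mod_cast hn
      simpa using hfint n hn'
  have hw : ‖w‖ = 2 * Real.pi * ‖w'‖ := by
    rw [hw', norm_smul, norm_neg, norm_inv, Real.norm_of_nonneg (by positivity)]
    field_simp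
  have hadd : (1 + ‖w‖) ^ r ≤ 2 ^ (r - 1) * (1 ^ r + ‖w‖ ^ r) :=
    add_pow_le zero_le_one (norm_nonneg w) r
  calc ‖𝓕 f w'‖ * (1 + ‖w‖) ^ r ≤ ‖𝓕 f w'‖ * (2 ^ (r - 1) * (1 ^ r + ‖w‖ ^ r)) := by gcongr
    _ = 2 ^ (r - 1) * (‖𝓕 f w'‖ + (2 * Real.pi) ^ r * (‖w'‖ ^ r * ‖𝓕 f w'‖)) := by
        rw [hw, mul_pow]; ring
    _ ≤ _ := by gcongr

end Fourier

/-! ### Coherent states along a great circle -/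

section WavePackets

/-- Cauchy's formula for the coefficients of the exponential series on a circle of radius `R`: a
power of a linear form is a superposition of coherent states along the orbit `t ↦ e^{it}`. -/
theorem pow_eq_integral_exp (J : ℕ) {R : ℝ} (hR : 0 < R) (φ : ℂ) :
    φ ^ J = ((J.factorial / (2 * Real.pi * R ^ J) : ℝ) : ℂ) *
      ∫ t in (0 : ℝ)..(2 * Real.pi), Complex.exp (-(J * t * Complex.I)) *
        Complex.exp (R * Complex.exp (t * Complex.I) * φ) := by
  have hd : DiffContOnCl ℂ (fun w : ℂ => Complex.exp (φ * w)) (ball 0 R) :=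
    (Complex.differentiable_exp.comp (differentiable_id.const_mul φ)).diffContOnCl
  have h := hd.circleIntegral_one_div_sub_center_pow_smul hR J
  have h2 : iteratedDeriv J (fun w : ℂ => Complex.exp (φ * w)) 0 = φ ^ J := by
    rw [iteratedDeriv_cexp_const_mul]; simp
  rw [h2, circleIntegral] at h
  have hRc : (R : ℂ) ≠ 0 := by exact_mod_cast hR.ne'
  have e : ∀ t : ℝ, deriv (circleMap 0 R) t • ((1 / (circleMap 0 R t - 0) ^ (J + 1)) •
      Complex.exp (φ * circleMap 0 R t))
      = (Complex.I / R ^ J) * (Complex.exp (-(J * t * Complex.I)) *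
        Complex.exp (R * Complex.exp (t * Complex.I) * φ)) := by
    intro t
    rw [deriv_circleMap, circleMap, smul_eq_mul, smul_eq_mul, zero_add, sub_zero]
    have hE : Complex.exp (t * Complex.I) ≠ 0 := Complex.exp_ne_zero _
    have h3 : Complex.exp (-(J * t * Complex.I)) = (Complex.exp (t * Complex.I) ^ J)⁻¹ := by
      rw [Complex.exp_neg, mul_assoc, Complex.exp_nat_mul]
    rw [h3, mul_comm φ, pow_succ, mul_pow]
    field_simp
  simp_rw [e] at h
  rw [intervalIntegral.integral_const_mul] at h
  set Y := ∫ t in (0 : ℝ)..(2 * Real.pi), Complex.exp (-(J * t * Complex.I)) *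
        Complex.exp (R * Complex.exp (t * Complex.I) * φ)
  have hf : (J.factorial : ℂ) ≠ 0 := by exact_mod_cast J.factorial_ne_zero
  have hpi : (Real.pi : ℂ) ≠ 0 := by exact_mod_cast Real.pi_ne_zero
  have hI := Complex.I_ne_zero
  rw [smul_eq_mul] at h
  push_cast
  field_simp at h ⊢
  rw [h]

variable {V : Type*} [NormedAddCommGroup V] [InnerProductSpace ℝ V]

/-- The complex linear form `x ↦ i⟨e, x⟩ + ⟨a, x⟩`. -/
noncomputable def cform (e a x : V) : ℂ := Complex.I * (⟪e, x⟫_ℝ : ℝ) + (⟪a, x⟫_ℝ : ℝ)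

/-- The position at time `t` on the great circle through `a` and `-e`. -/
noncomputable def orbitPos (e a : V) (t : ℝ) : V := Real.cos t • a - Real.sin t • e

/-- The momentum at time `t` along the great circle through `a` and `-e`. -/
noncomputable def orbitMom (e a : V) (t : ℝ) : V := Real.sin t • a + Real.cos t • e

theorem exp_mul_cform (e a x : V) (t : ℝ) :
    Complex.exp (t * Complex.I) * cform e a x =
      (⟪orbitPos e a t, x⟫_ℝ : ℝ) + (⟪orbitMom e a t, x⟫_ℝ : ℝ) * Complex.I := by
  rw [Complex.exp_mul_I, cform, orbitPos, orbitMom, inner_sub_left, inner_add_left]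
  simp only [real_inner_smul_left]
  push_cast
  linear_combination (-(Complex.sin t) * (⟪e, x⟫_ℝ : ℝ) : ℂ) * (-Complex.I_sq)

theorem norm_exp_mul_I_sub_sq (t t' : ℝ) :
    ‖Complex.exp (t * Complex.I) - Complex.exp (t' * Complex.I)‖ ^ 2
      = 2 - 2 * Real.cos (t - t') := by
  rw [← Complex.normSq_eq_norm_sq, Complex.normSq_apply]
  simp only [Complex.sub_re, Complex.sub_im, Complex.exp_ofReal_mul_I_re,
    Complex.exp_ofReal_mul_I_im, Real.cos_sub]
  nlinarith [Real.sin_sq_add_cos_sq t, Real.sin_sq_add_cos_sq t']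

variable {e a a' : V}

theorem norm_orbitPos (he : ‖e‖ = 1) (ha : ‖a‖ = 1) (hea : ⟪e, a⟫_ℝ = 0) (t : ℝ) :
    ‖orbitPos e a t‖ = 1 := by
  have h : ‖orbitPos e a t‖ ^ 2 = 1 := by
    rw [orbitPos, norm_sub_sq_real, norm_smul, norm_smul, he, ha, real_inner_smul_left,
      real_inner_smul_right, real_inner_comm, hea]
    simp
  nlinarith [norm_nonneg (orbitPos e a t)]

theorem norm_orbit_sub_sq (he : ‖e‖ = 1) (ha : ‖a‖ = 1) (ha' : ‖a'‖ = 1) (hea : ⟪e, a⟫_ℝ = 0)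
    (hea' : ⟪e, a'⟫_ℝ = 0) (t t' : ℝ) :
    ‖orbitPos e a t - orbitPos e a' t'‖ ^ 2 + ‖orbitMom e a t - orbitMom e a' t'‖ ^ 2
      = (2 - 2 * Real.cos (t - t') * ⟪a, a'⟫_ℝ) + (2 - 2 * Real.cos (t - t')) := by
  have hea2 : ⟪a, e⟫_ℝ = 0 := by rw [real_inner_comm]; exact hea
  have hea2' : ⟪a', e⟫_ℝ = 0 := by rw [real_inner_comm]; exact hea'
  have hc : ⟪a', a⟫_ℝ = ⟪a, a'⟫_ℝ := real_inner_comm _ _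
  simp only [orbitPos, orbitMom, ← real_inner_self_eq_norm_sq, inner_sub_left, inner_sub_right,
    inner_add_left, inner_add_right, real_inner_smul_left, real_inner_smul_right, hea, hea', hea2,
    hea2', hc]
  simp only [real_inner_self_eq_norm_sq, he, ha, ha', Real.cos_sub]
  linear_combination 2 * Real.sin_sq_add_cos_sq t + 2 * Real.sin_sq_add_cos_sq t'

/-- The distance of two great circles is at most the phase space distance of any two of their
points. -/
theorem norm_sub_sq_le_orbit (he : ‖e‖ = 1) (ha : ‖a‖ = 1) (ha' : ‖a'‖ = 1) (hea : ⟪e, a⟫_ℝ = 0)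
    (hea' : ⟪e, a'⟫_ℝ = 0) (t t' : ℝ) :
    ‖a - a'‖ ^ 2 ≤ ‖orbitPos e a t - orbitPos e a' t'‖ ^ 2
      + ‖orbitMom e a t - orbitMom e a' t'‖ ^ 2 := by
  rw [norm_orbit_sub_sq he ha ha' hea hea', norm_sub_sq_real, ha, ha']
  have h1 := Real.cos_le_one (t - t')
  have h2 : |⟪a, a'⟫_ℝ| ≤ 1 := by simpa [ha, ha'] using abs_real_inner_le_norm a a'
  nlinarith [(abs_le.mp h2).1]

/-- The phase space distance also controls the distance of the times. -/
theorem norm_exp_sub_sq_le_orbit (he : ‖e‖ = 1) (ha : ‖a‖ = 1) (ha' : ‖a'‖ = 1)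
    (hea : ⟪e, a⟫_ℝ = 0) (hea' : ⟪e, a'⟫_ℝ = 0) (t t' : ℝ) :
    ‖Complex.exp (t * Complex.I) - Complex.exp (t' * Complex.I)‖ ^ 2
      ≤ ‖orbitPos e a t - orbitPos e a' t'‖ ^ 2 + ‖orbitMom e a t - orbitMom e a' t'‖ ^ 2 := by
  rw [norm_orbit_sub_sq he ha ha' hea hea', norm_exp_mul_I_sub_sq]
  have h1 := Real.abs_cos_le_one (t - t')
  have h2 : |⟪a, a'⟫_ℝ| ≤ 1 := by simpa [ha, ha'] using abs_real_inner_le_norm a a'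
  have h3 : |Real.cos (t - t') * ⟪a, a'⟫_ℝ| ≤ 1 := by
    rw [abs_mul]; exact mul_le_one₀ h1 (abs_nonneg _) h2
  linarith [(abs_le.mp h3).2]

/-- A product of two coherent states is a Gaussian centred at the midpoint of the two positions,
damped by the distance of the positions and oscillating with the difference of the momenta. -/
theorem coherent_mul_conj (he : ‖e‖ = 1) (ha : ‖a‖ = 1) (ha' : ‖a'‖ = 1) (hea : ⟪e, a⟫_ℝ = 0)
    (hea' : ⟪e, a'⟫_ℝ = 0) (R t t' : ℝ) (y : V) :
    let c := (R / 2) • (orbitPos e a t + orbitPos e a' t')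
    let w := R • (orbitMom e a t - orbitMom e a' t')
    Complex.exp (R * Complex.exp (t * Complex.I) * cform e a (y + c)) *
      (starRingEnd ℂ) (Complex.exp (R * Complex.exp (t' * Complex.I) * cform e a' (y + c))) *
      ((Real.exp (-‖y + c‖ ^ 2) : ℝ) : ℂ)
    = ((Real.exp (R ^ 2) * Real.exp (-(R ^ 2 / 4 *
        ‖orbitPos e a t - orbitPos e a' t'‖ ^ 2)) : ℝ) : ℂ)
      * Complex.exp (Complex.I * (⟪w, c⟫_ℝ : ℝ)) *
        (Complex.exp (Complex.I * (⟪w, y⟫_ℝ : ℝ)) * ((Real.exp (-‖y‖ ^ 2) : ℝ) : ℂ)) := by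
  intro c w
  rw [← Complex.exp_conj]
  simp only [mul_assoc]
  rw [exp_mul_cform, exp_mul_cform]
  simp only [map_mul, map_add, Complex.conj_ofReal, Complex.conj_I]
  simp only [Complex.ofReal_exp, Complex.ofReal_mul]
  simp only [← Complex.exp_add]
  congr 1
  set q := orbitPos e a t with hq
  set q' := orbitPos e a' t' with hq'
  set ξ := orbitMom e a t
  set ξ' := orbitMom e a' t'
  have hqn : ‖q‖ = 1 := norm_orbitPos he ha hea t
  have hqn' : ‖q'‖ = 1 := norm_orbitPos he ha' hea' t'
  have hre : R * ⟪q, y + c⟫_ℝ + (R * ⟪q', y + c⟫_ℝ + -‖y + c‖ ^ 2)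
      = R ^ 2 - R ^ 2 / 4 * ‖q - q'‖ ^ 2 - ‖y‖ ^ 2 := by
    have hqq : ⟪q', q⟫_ℝ = ⟪q, q'⟫_ℝ := real_inner_comm _ _
    have hyq : ⟪y, q⟫_ℝ = ⟪q, y⟫_ℝ := real_inner_comm _ _
    have hyq' : ⟪y, q'⟫_ℝ = ⟪q', y⟫_ℝ := real_inner_comm _ _
    have h1 : ⟪q, q⟫_ℝ = 1 := by rw [real_inner_self_eq_norm_sq, hqn]; norm_num
    have h2 : ⟪q', q'⟫_ℝ = 1 := by rw [real_inner_self_eq_norm_sq, hqn']; norm_num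
    have hcd : c = (R / 2) • (q + q') := rfl
    simp only [hcd, ← real_inner_self_eq_norm_sq, inner_sub_left, inner_sub_right,
      inner_add_left, inner_add_right, real_inner_smul_left, real_inner_smul_right, hqq, hyq, hyq',
      h1, h2]
    ring
  have him : R * ⟪ξ, y + c⟫_ℝ - R * ⟪ξ', y + c⟫_ℝ = ⟪w, c⟫_ℝ + ⟪w, y⟫_ℝ := by
    simp only [w, real_inner_smul_left, inner_sub_left, inner_add_right]
    ring
  have hre' := congrArg (fun r : ℝ => (r : ℂ)) hre
  have him' := congrArg (fun r : ℝ => (r : ℂ)) him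
  push_cast at hre' him' ⊢
  linear_combination hre' + Complex.I * him'

variable [FiniteDimensional ℝ V] [MeasurableSpace V] [BorelSpace V]

/-- Inner products of coherent states with smooth weights decay rapidly in the phase space
distance. -/
theorem exists_coherent_inner_decay (u : V) (m r : ℕ) (D : ℕ → ℝ) : ∃ C : ℝ, 0 ≤ C ∧
    ∀ e a a' : V, ‖e‖ = 1 → ‖a‖ = 1 → ‖a'‖ = 1 → ⟪e, a⟫_ℝ = 0 → ⟪e, a'⟫_ℝ = 0 →
    (m = 0 ∨ (⟪u, e⟫_ℝ = 0 ∧ ⟪u, a⟫_ℝ = 0 ∧ ⟪u, a'⟫_ℝ = 0)) →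
    ∀ R : ℝ, 0 ≤ R →
    ∀ G : V → ℂ, ContDiff ℝ ∞ G → (∀ i ≤ r + 2, ∀ x, ‖iteratedFDeriv ℝ i G x‖ ≤ D i) →
    ∀ t t' : ℝ,
    ‖∫ x, Complex.exp (R * Complex.exp (t * Complex.I) * cform e a x) *
      (starRingEnd ℂ) (Complex.exp (R * Complex.exp (t' * Complex.I) * cform e a' x)) *
      (((⟪u, x⟫_ℝ ^ m : ℝ) : ℂ) * ((Real.exp (-‖x‖ ^ 2) : ℝ) : ℂ) * G x)‖
      * ((1 + R * ‖a - a'‖) ^ r *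
        (1 + R * ‖Complex.exp (t * Complex.I) - Complex.exp (t' * Complex.I)‖) ^ 2)
      ≤ C * Real.exp (R ^ 2) := by
  obtain ⟨C₁, hC₁, h₁⟩ := exists_fourier_decay (gaussianMoment u m) (r + 2) D
  obtain ⟨C₂, h₂⟩ := exists_pow_mul_exp_neg_sq_le (r + 2)
  have hC₂ : 0 ≤ C₂ := le_trans (by positivity) (h₂ 0 le_rfl)
  refine ⟨2 ^ (r + 2) * C₂ * C₁, by positivity, ?_⟩
  intro e a a' he ha ha' hea hea' hu R hR G hG hD t t'
  set q := orbitPos e a t with hq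
  set q' := orbitPos e a' t' with hq'
  set ξ := orbitMom e a t with hξ
  set ξ' := orbitMom e a' t' with hξ'
  set c := (R / 2) • (q + q') with hc
  set w := R • (ξ - ξ') with hw
  have huc : m = 0 ∨ ⟪u, c⟫_ℝ = 0 := by
    rcases hu with h | ⟨h1, h2, h3⟩
    · exact Or.inl h
    · right
      simp only [hc, hq, hq', orbitPos, real_inner_smul_right, inner_add_right, inner_sub_right,
        h1, h2, h3]
      ring
  have hum : ∀ y : V, ⟪u, y + c⟫_ℝ ^ m = ⟪u, y⟫_ℝ ^ m := by
    intro y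
    rcases huc with h | h
    · subst h; simp
    · rw [inner_add_right, h, add_zero]
  have hGc : ContDiff ℝ ∞ (fun y => G (y + c)) := hG.comp (contDiff_id.add contDiff_const)
  have hDc : ∀ i ≤ r + 2, ∀ x, ‖iteratedFDeriv ℝ i (fun y => G (y + c)) x‖ ≤ D i := by
    intro i hi x
    rw [iteratedFDeriv_comp_add_right]
    exact hD i hi _
  have hF := h₁ _ hGc hDc w
  set K := ∫ y, Complex.exp (Complex.I * (⟪w, y⟫_ℝ : ℝ)) * (gaussianMoment u m y * G (y + c)) with hK
  have hint : ∫ x, Complex.exp (R * Complex.exp (t * Complex.I) * cform e a x) *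
      (starRingEnd ℂ) (Complex.exp (R * Complex.exp (t' * Complex.I) * cform e a' x)) *
      (((⟪u, x⟫_ℝ ^ m : ℝ) : ℂ) * ((Real.exp (-‖x‖ ^ 2) : ℝ) : ℂ) * G x)
      = (((Real.exp (R ^ 2) * Real.exp (-(R ^ 2 / 4 * ‖q - q'‖ ^ 2)) : ℝ) : ℂ)
      * Complex.exp (Complex.I * (⟪w, c⟫_ℝ : ℝ))) * K := by
    rw [← integral_add_right_eq_self _ c, hK, ← integral_const_mul]
    refine integral_congr_ae (Filter.Eventually.of_forall fun y => ?_)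
    have h := coherent_mul_conj he ha ha' hea hea' R t t' y
    simp only at h
    simp only
    rw [hum, gaussianMoment_apply]
    linear_combination (((⟪u, y⟫_ℝ ^ m : ℝ) : ℂ) * G (y + c)) * h
  rw [hint, norm_mul, norm_mul, Complex.norm_real, mul_comm Complex.I,
    Complex.norm_exp_ofReal_mul_I, mul_one, Real.norm_of_nonneg (by positivity)]
  set s := R * ‖q - q'‖ with hs
  set ww := R * ‖ξ - ξ'‖ with hww
  have hwn : ‖w‖ = ww := by rw [hw, norm_smul, Real.norm_of_nonneg hR]
  have hs0 : 0 ≤ s := by positivity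
  have hw0 : 0 ≤ ww := by positivity
  -- either the positions or the momenta are apart; the Gaussian factor handles the former, the
  -- Fourier decay the latter
  have hmax : ∀ d : ℝ, 0 ≤ d → d ^ 2 ≤ ‖q - q'‖ ^ 2 + ‖ξ - ξ'‖ ^ 2 →
      1 + R * d ≤ (1 + s) * (1 + ww) := by
    intro d hd hd2
    have hle : d ≤ ‖q - q'‖ + ‖ξ - ξ'‖ := by
      refine abs_le_of_sq_le_sq' ?_ (by positivity) |>.2
      nlinarith [norm_nonneg (q - q'), norm_nonneg (ξ - ξ'),
        mul_nonneg (norm_nonneg (q - q')) (norm_nonneg (ξ - ξ'))]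
    have : R * d ≤ s + ww := by rw [hs, hww, ← mul_add]; gcongr
    nlinarith [mul_nonneg hs0 hw0]
  have hA := hmax _ (norm_nonneg _) (norm_sub_sq_le_orbit he ha ha' hea hea' t t')
  have hB := hmax _ (norm_nonneg _) (norm_exp_sub_sq_le_orbit he ha ha' hea hea' t t')
  have hgauss : Real.exp (-(R ^ 2 / 4 * ‖q - q'‖ ^ 2)) * (1 + s) ^ (r + 2) ≤ 2 ^ (r + 2) * C₂ := by
    have h3 := h₂ (s / 2) (by positivity)
    have e1 : -(R ^ 2 / 4 * ‖q - q'‖ ^ 2) = -(s / 2) ^ 2 := by rw [hs]; ring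
    rw [e1]
    calc Real.exp (-(s / 2) ^ 2) * (1 + s) ^ (r + 2)
        ≤ Real.exp (-(s / 2) ^ 2) * (2 * (1 + s / 2)) ^ (r + 2) := by gcongr; linarith
      _ = 2 ^ (r + 2) * ((1 + s / 2) ^ (r + 2) * Real.exp (-(s / 2) ^ 2)) := by
        rw [mul_pow]; ring
      _ ≤ _ := by gcongr
  rw [hwn] at hF
  calc _ ≤ Real.exp (R ^ 2) * Real.exp (-(R ^ 2 / 4 * ‖q - q'‖ ^ 2)) * ‖K‖
        * (((1 + s) * (1 + ww)) ^ r * ((1 + s) * (1 + ww)) ^ 2) := by gcongr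
    _ = (Real.exp (-(R ^ 2 / 4 * ‖q - q'‖ ^ 2)) * (1 + s) ^ (r + 2))
        * (‖K‖ * (1 + ww) ^ (r + 2)) * Real.exp (R ^ 2) := by
        rw [← pow_add, mul_pow]; ring
    _ ≤ (2 ^ (r + 2) * C₂) * C₁ * Real.exp (R ^ 2) := by gcongr

end WavePackets

/-! ### Cross terms against a Gaussian density -/

section Angular

theorem le_norm_exp_mul_I_sub_one {s : ℝ} (hs : |s| ≤ Real.pi) :
    2 / Real.pi * |s| ≤ ‖Complex.exp (s * Complex.I) - 1‖ := by
  rw [mul_comm (s : ℂ), Complex.norm_exp_I_mul_ofReal_sub_one, norm_mul, Real.norm_eq_abs,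
    Real.norm_eq_abs, abs_two]
  have h := Real.mul_abs_le_abs_sin (x := s / 2) (by rw [abs_div, abs_two]; linarith)
  rw [abs_div, abs_two] at h
  linarith

theorem norm_exp_mul_I_sub (t t' : ℝ) :
    ‖Complex.exp (t * Complex.I) - Complex.exp (t' * Complex.I)‖
      = ‖Complex.exp ((t' - t : ℝ) * Complex.I) - 1‖ := by
  have e : Complex.exp (t * Complex.I) - Complex.exp (t' * Complex.I)
      = -(Complex.exp (t * Complex.I) * (Complex.exp ((t' - t : ℝ) * Complex.I) - 1)) := by
    rw [mul_sub, ← Complex.exp_add, mul_one, neg_sub]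
    congr 2
    push_cast; ring
  rw [e, norm_neg, norm_mul, Complex.norm_exp_ofReal_mul_I, one_mul]

/-- Integrating over the times gains a factor `R⁻¹`, the time that the two orbits spend close to
each other. -/
theorem integral_angular_kernel_le {R : ℝ} (hR : 0 < R) (t : ℝ) :
    ∫ t' in (0 : ℝ)..(2 * Real.pi),
      ((1 + R * ‖Complex.exp (t * Complex.I) - Complex.exp (t' * Complex.I)‖) ^ 2)⁻¹
      ≤ Real.pi ^ 2 / (2 * R) := by
  set g : ℝ → ℝ := fun s => ((1 + R * ‖Complex.exp ((s : ℝ) * Complex.I) - 1‖) ^ 2)⁻¹ with hg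
  have hgc : Continuous g := by
    refine Continuous.inv₀ (by fun_prop) fun s => ?_
    positivity
  have hper : Function.Periodic g (2 * Real.pi) := by
    intro s
    simp only [hg]
    have h := Complex.exp_mul_I_periodic (s : ℂ)
    simp only at h
    push_cast
    rw [h]
  have e : ∀ t' : ℝ, ((1 + R * ‖Complex.exp (t * Complex.I) - Complex.exp (t' * Complex.I)‖) ^ 2)⁻¹
      = g (t' - t) := fun t' => by rw [norm_exp_mul_I_sub]
  simp_rw [e]
  rw [intervalIntegral.integral_comp_sub_right]
  have h2 : ∫ x in (0 - t)..(2 * Real.pi - t), g x = ∫ x in (-Real.pi)..Real.pi, g x := by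
    have := hper.intervalIntegral_add_eq (0 - t) (-Real.pi)
    rw [show (0 - t) + 2 * Real.pi = 2 * Real.pi - t by ring,
      show -Real.pi + 2 * Real.pi = Real.pi by ring] at this
    exact this
  rw [h2]
  set c := 2 * R / Real.pi with hc
  have hpi := Real.pi_pos
  have hc0 : 0 < c := by positivity
  have hint : Integrable (fun s : ℝ => (1 + (c * s) ^ 2)⁻¹) :=
    integrable_inv_one_add_sq.comp_mul_left' hc0.ne'
  calc ∫ x in (-Real.pi)..Real.pi, g x ≤ ∫ s in (-Real.pi)..Real.pi, (1 + (c * s) ^ 2)⁻¹ := by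
        refine intervalIntegral.integral_mono_on (by linarith) (hgc.intervalIntegrable _ _)
          hint.intervalIntegrable fun s hs => ?_
        have hs' : |s| ≤ Real.pi := abs_le.mpr hs
        have h3 := le_norm_exp_mul_I_sub_one hs'
        apply inv_anti₀ (by positivity)
        set X := ‖Complex.exp ((s : ℝ) * Complex.I) - 1‖
        have h4 : c * |s| ≤ R * X := by
          calc c * |s| = R * (2 / Real.pi * |s|) := by rw [hc]; ring
            _ ≤ _ := by gcongr
        have h5 : (c * s) ^ 2 ≤ (R * X) ^ 2 := by
          rw [mul_pow, ← sq_abs s, ← mul_pow]; gcongr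
        have h6 : 0 ≤ R * X := by positivity
        nlinarith
    _ ≤ ∫ s : ℝ, (1 + (c * s) ^ 2)⁻¹ := by
        rw [intervalIntegral.integral_of_le (by linarith)]
        exact setIntegral_le_integral hint (Filter.Eventually.of_forall fun s => by positivity)
    _ = Real.pi ^ 2 / (2 * R) := by
        rw [Measure.integral_comp_mul_left (fun s => (1 + s ^ 2)⁻¹) c, integral_univ_inv_one_add_sq,
          abs_of_pos (by positivity), hc, smul_eq_mul]
        field_simp

end Angular

section EuclideanCrossTerms

variable {V : Type*} [NormedAddCommGroup V] [InnerProductSpace ℝ V]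

theorem continuous_cform (e a : V) : Continuous (cform e a) := by
  unfold cform; fun_prop

variable [FiniteDimensional ℝ V]
  [MeasurableSpace V] [BorelSpace V]

theorem integrable_inner_pow_mul_exp (u : V) (m : ℕ) (c : ℝ) :
    Integrable (fun x : V => Real.exp (c * ‖x‖) * (|⟪u, x⟫_ℝ| ^ m * Real.exp (-‖x‖ ^ 2))) := by
  have h1 : Integrable (fun x : V => ‖gaussianMoment u m x‖) :=
    (gaussianMoment u m).integrable.norm
  have h2 := (h1.comp_smul (R := (Real.sqrt 2)⁻¹) (by positivity)).const_mul
    (Real.exp (c ^ 2 / 2) * Real.sqrt 2 ^ m)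
  refine h2.mono' ?_ ?_
  · exact Continuous.aestronglyMeasurable (by fun_prop)
  · refine Filter.Eventually.of_forall fun x => ?_
    have h2' : Real.sqrt 2 ^ 2 = 2 := Real.sq_sqrt (by norm_num)
    have h2p : 0 < Real.sqrt 2 := by positivity
    rw [Real.norm_of_nonneg (by positivity), gaussianMoment_apply, norm_mul, Complex.norm_real,
      Complex.norm_real, Real.norm_of_nonneg (Real.exp_pos _).le,
      inner_smul_right, norm_smul, norm_pow, norm_mul, Real.norm_of_nonneg (by positivity),
      Real.norm_eq_abs, mul_pow, mul_pow, inv_pow, inv_pow, h2']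
    have e : Real.exp (c ^ 2 / 2) * Real.sqrt 2 ^ m *
        ((Real.sqrt 2 ^ m)⁻¹ * |⟪u, x⟫_ℝ| ^ m * Real.exp (-(2⁻¹ * ‖x‖ ^ 2)))
        = |⟪u, x⟫_ℝ| ^ m * Real.exp (c ^ 2 / 2 + -(2⁻¹ * ‖x‖ ^ 2)) := by
      rw [Real.exp_add]; field_simp
    rw [e, mul_left_comm, ← Real.exp_add]
    refine mul_le_mul_of_nonneg_left (Real.exp_le_exp.mpr ?_) (by positivity)
    nlinarith [sq_nonneg (c - ‖x‖)]

/-- The cross terms of two isotropic powers against a Gaussian density decay rapidly in the distance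
of the two great circles, measured in units of the width of the beams. -/
theorem exists_gaussian_cross_term_bound (u : V) (m r : ℕ) (D : ℕ → ℝ) : ∃ C : ℝ, 0 ≤ C ∧
    ∀ e a a' : V, ‖e‖ = 1 → ‖a‖ = 1 → ‖a'‖ = 1 → ⟪e, a⟫_ℝ = 0 → ⟪e, a'⟫_ℝ = 0 →
    (m = 0 ∨ (⟪u, e⟫_ℝ = 0 ∧ ⟪u, a⟫_ℝ = 0 ∧ ⟪u, a'⟫_ℝ = 0)) →
    ∀ J : ℕ,
    ∀ G : V → ℂ, ContDiff ℝ ∞ G → (∀ i ≤ r + 2, ∀ x, ‖iteratedFDeriv ℝ i G x‖ ≤ D i) →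
    ‖∫ x, cform e a x ^ J * (starRingEnd ℂ) (cform e a' x ^ J) *
      (((⟪u, x⟫_ℝ ^ m : ℝ) : ℂ) * ((Real.exp (-‖x‖ ^ 2) : ℝ) : ℂ) * G x)‖
      * (1 + Real.sqrt (J + 1) * ‖a - a'‖) ^ r ≤ C * J.factorial := by
  obtain ⟨C, hC, hmain⟩ := exists_coherent_inner_decay u m r D
  refine ⟨C * Real.exp 1, by positivity, ?_⟩
  intro e a a' he ha ha' hea hea' hu J G hG hD
  -- the radius for which Cauchy's estimate is optimal
  set R := Real.sqrt (J + 1) with hRdef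
  have hR : 0 < R := by positivity
  have hR2 : R ^ 2 = J + 1 := Real.sq_sqrt (by positivity)
  set κ : ℝ := J.factorial / (2 * Real.pi * R ^ J) with hκ
  have hpi := Real.pi_pos
  have hκ0 : 0 < κ := by positivity
  set I := Set.Ioc (0 : ℝ) (2 * Real.pi) with hI
  set μ : Measure ℝ := volume.restrict I with hμ
  have hfin : IsFiniteMeasure μ := by
    rw [hμ, hI]; infer_instance
  set W : V → ℂ := fun x => ((⟪u, x⟫_ℝ ^ m : ℝ) : ℂ) * ((Real.exp (-‖x‖ ^ 2) : ℝ) : ℂ) * G x with hW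
  have hWc : Continuous W := by
    have := hG.continuous
    rw [hW]; fun_prop
  set F : V → V → ℝ → V → ℂ := fun e a t x =>
    Complex.exp (R * Complex.exp (t * Complex.I) * cform e a x) with hF
  set P : ℝ → ℂ := fun t => Complex.exp (-(J * t * Complex.I)) with hP
  have hPn : ∀ t, ‖P t‖ = 1 := by
    intro t
    simp only [hP]
    rw [show -((J : ℂ) * t * Complex.I) = ((-(J * t) : ℝ) : ℂ) * Complex.I by push_cast; ring,
      Complex.norm_exp_ofReal_mul_I]
  have hFn : ∀ a, ‖a‖ = 1 → ⟪e, a⟫_ℝ = 0 → ∀ t x, ‖F e a t x‖ ≤ Real.exp (R * ‖x‖) := by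
    intro a ha hea t x
    simp only [hF]
    rw [mul_assoc, exp_mul_cform, Complex.norm_exp]
    apply Real.exp_le_exp.mpr
    simp only [Complex.mul_re, Complex.add_re, Complex.ofReal_re, Complex.ofReal_im, Complex.I_re,
      Complex.I_im]
    have h := real_inner_le_norm (orbitPos e a t) x
    rw [norm_orbitPos he ha hea, one_mul] at h
    nlinarith
  set H : (ℝ × ℝ) → V → ℂ := fun p x =>
    (P p.1 * F e a p.1 x) * (starRingEnd ℂ) (P p.2 * F e a' p.2 x) * W x with hH
  have hcf := continuous_cform e a
  have hcf' := continuous_cform e a'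
  have hHc : Continuous (Function.uncurry H) := by
    simp only [hH, hF, hP, Function.uncurry_def]
    have h1 : Continuous fun p : (ℝ × ℝ) × V => cform e a p.2 := hcf.comp continuous_snd
    have h2 : Continuous fun p : (ℝ × ℝ) × V => cform e a' p.2 := hcf'.comp continuous_snd
    have h3 : Continuous fun p : (ℝ × ℝ) × V => W p.2 := hWc.comp continuous_snd
    refine Continuous.mul (Continuous.mul ?_ (Complex.continuous_conj.comp ?_)) h3
    · fun_prop
    · fun_prop
  have hD0 : ∀ x, ‖G x‖ ≤ D 0 := fun x => by simpa using hD 0 (Nat.zero_le _) x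
  have hHint : Integrable (Function.uncurry H) ((μ.prod μ).prod volume) := by
    have hdom := ((integrable_inner_pow_mul_exp u m (2 * R)).mul_const (D 0)).comp_snd (μ.prod μ)
    refine hdom.mono' hHc.aestronglyMeasurable (Filter.Eventually.of_forall fun p => ?_)
    obtain ⟨p, x⟩ := p
    simp only [Function.uncurry_apply_pair, hH, norm_mul, RCLike.norm_conj, hPn, one_mul, hW,
      Complex.norm_real, norm_pow, Real.norm_eq_abs, Real.abs_exp]
    calc _ ≤ Real.exp (R * ‖x‖) * Real.exp (R * ‖x‖) *
          (|⟪u, x⟫_ℝ| ^ m * Real.exp (-‖x‖ ^ 2) * D 0) := by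
          gcongr
          · exact hFn a ha hea _ _
          · exact hFn a' ha' hea' _ _
          · exact hD0 x
      _ = _ := by
          rw [show 2 * R * ‖x‖ = R * ‖x‖ + R * ‖x‖ by ring, Real.exp_add]; ring
  have hrep : ∀ x, cform e a x ^ J * (starRingEnd ℂ) (cform e a' x ^ J) * W x
      = ((κ ^ 2 : ℝ) : ℂ) * ∫ p, H p x ∂(μ.prod μ) := by
    intro x
    have hrep1 : ∀ b, cform e b x ^ J = (κ : ℂ) * ∫ t, P t * F e b t x ∂μ := by
      intro b
      rw [pow_eq_integral_exp J hR, intervalIntegral.integral_of_le (by positivity)]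
    simp only [hH]
    rw [integral_mul_const, integral_prod_mul (fun t => P t * F e a t x)
      (fun t => (starRingEnd ℂ) (P t * F e a' t x)), integral_conj, hrep1 a, hrep1 a', map_mul,
      Complex.conj_ofReal]
    push_cast
    ring
  have hswap : ∫ x, cform e a x ^ J * (starRingEnd ℂ) (cform e a' x ^ J) * W x
      = ((κ ^ 2 : ℝ) : ℂ) * ∫ p, (∫ x, H p x) ∂(μ.prod μ) := by
    simp_rw [hrep]
    rw [integral_const_mul, integral_integral_swap hHint]
  set A := (1 + R * ‖a - a'‖) ^ r with hA
  have hA0 : 0 < A := by positivity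
  set B : ℝ × ℝ → ℝ := fun p =>
    (1 + R * ‖Complex.exp (p.1 * Complex.I) - Complex.exp (p.2 * Complex.I)‖) ^ 2 with hB
  have hB0 : ∀ p, 0 < B p := fun p => by simp only [hB]; positivity
  have hB1 : ∀ p, 1 ≤ B p := fun p => by
    simp only [hB]
    refine one_le_pow₀ ?_
    have : 0 ≤ R * ‖Complex.exp (p.1 * Complex.I) - Complex.exp (p.2 * Complex.I)‖ := by positivity
    linarith
  have hBc : Continuous fun p => (B p)⁻¹ :=
    Continuous.inv₀ (by simp only [hB]; fun_prop) fun p => (hB0 p).ne'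
  have hBint : Integrable (fun p => (B p)⁻¹) (μ.prod μ) := by
    refine (integrable_const (1 : ℝ)).mono' hBc.aestronglyMeasurable
      (Filter.Eventually.of_forall fun p => ?_)
    rw [Real.norm_of_nonneg (inv_nonneg.mpr (hB0 p).le)]
    exact inv_le_one_of_one_le₀ (hB1 p)
  have hpoint : ∀ p, ‖∫ x, H p x‖ ≤ C * Real.exp (R ^ 2) / A * (B p)⁻¹ := by
    intro p
    have h := hmain e a a' he ha ha' hea hea' hu R hR.le G hG hD p.1 p.2
    have e1 : ∫ x, H p x = (P p.1 * (starRingEnd ℂ) (P p.2)) *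
        ∫ x, F e a p.1 x * (starRingEnd ℂ) (F e a' p.2 x) * W x := by
      rw [← integral_const_mul]
      refine integral_congr_ae (Filter.Eventually.of_forall fun x => ?_)
      simp only [hH, map_mul]; ring
    rw [e1, norm_mul, norm_mul, RCLike.norm_conj, hPn, hPn, one_mul, one_mul,
      ← div_eq_mul_inv, div_div, le_div_iff₀ (mul_pos hA0 (hB0 p))]
    exact h
  have hBI : ∫ p, (B p)⁻¹ ∂(μ.prod μ) ≤ 2 * Real.pi * (Real.pi ^ 2 / (2 * R)) := by
    rw [integral_prod _ hBint]
    calc ∫ t, ∫ t', (B (t, t'))⁻¹ ∂μ ∂μ ≤ ∫ t, Real.pi ^ 2 / (2 * R) ∂μ := by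
          refine integral_mono hBint.integral_prod_left (integrable_const _) fun t => ?_
          have h := integral_angular_kernel_le hR t
          rw [intervalIntegral.integral_of_le (by positivity)] at h
          exact h
      _ = _ := by
          rw [integral_const, hμ, hI]
          simp [Real.volume_real_Ioc_of_le (by positivity : (0 : ℝ) ≤ 2 * Real.pi)]
  have hnorm : ‖∫ p, (∫ x, H p x) ∂(μ.prod μ)‖ ≤
      C * Real.exp (R ^ 2) / A * (2 * Real.pi * (Real.pi ^ 2 / (2 * R))) := by
    refine (norm_integral_le_of_norm_le (hBint.const_mul _)
      (Filter.Eventually.of_forall hpoint)).trans ?_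
    rw [integral_const_mul]
    gcongr
  have hst := factorial_mul_exp_le J
  rw [hswap, norm_mul, Complex.norm_real, Real.norm_of_nonneg (by positivity)]
  calc _ ≤ κ ^ 2 * (C * Real.exp (R ^ 2) / A * (2 * Real.pi * (Real.pi ^ 2 / (2 * R)))) * A := by
        gcongr
    _ = (C * J.factorial * Real.pi / 4 / (R * (R ^ 2) ^ J)) *
          (J.factorial * Real.exp (R ^ 2)) := by
        rw [hκ, ← pow_mul, mul_comm 2 J, pow_mul]
        field_simp
        ring
    _ ≤ (C * J.factorial * Real.pi / 4 / (R * (R ^ 2) ^ J)) *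
          (Real.exp 1 * R * (R ^ 2) ^ J) := by
        rw [hR2]
        gcongr
    _ = C * J.factorial * Real.pi / 4 * Real.exp 1 := by field_simp
    _ ≤ C * J.factorial * 4 / 4 * Real.exp 1 := by gcongr; exact Real.pi_le_four
    _ = _ := by ring

end EuclideanCrossTerms

/-! ### Gaussian norm of one beam and polar coordinates -/

section Diagonal

variable {V : Type*} [NormedAddCommGroup V] [InnerProductSpace ℝ V]

theorem hasFDerivAt_cform (e a x : V) : HasFDerivAt (cform e a)
    (Complex.I • (Complex.ofRealCLM.comp (innerSL ℝ e)) +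
      Complex.ofRealCLM.comp (innerSL ℝ a)) x := by
  have h1 : HasFDerivAt (fun x : V => ((⟪e, x⟫_ℝ : ℝ) : ℂ))
      (Complex.ofRealCLM.comp (innerSL ℝ e)) x :=
    (Complex.ofRealCLM.comp (innerSL ℝ e)).hasFDerivAt
  have h2 : HasFDerivAt (fun x : V => ((⟪a, x⟫_ℝ : ℝ) : ℂ))
      (Complex.ofRealCLM.comp (innerSL ℝ a)) x :=
    (Complex.ofRealCLM.comp (innerSL ℝ a)).hasFDerivAt
  exact (h1.const_mul Complex.I).add h2

theorem norm_cform_le {e a : V} (he : ‖e‖ = 1) (ha : ‖a‖ = 1) (x : V) :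
    ‖cform e a x‖ ≤ 2 * ‖x‖ := by
  have h1 := abs_real_inner_le_norm e x
  have h2 := abs_real_inner_le_norm a x
  rw [he, one_mul] at h1
  rw [ha, one_mul] at h2
  unfold cform
  refine (norm_add_le _ _).trans ?_
  rw [norm_mul, Complex.norm_I, one_mul, Complex.norm_real, Complex.norm_real, Real.norm_eq_abs,
    Real.norm_eq_abs]
  linarith

variable [FiniteDimensional ℝ V] [MeasurableSpace V] [BorelSpace V]

theorem integrable_cform_pow_mul_exp {e a : V} (he : ‖e‖ = 1) (ha : ‖a‖ = 1) (p q m : ℕ)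
    (u : V) :
    Integrable (fun x => cform e a x ^ p * (starRingEnd ℂ) (cform e a x) ^ q *
      (((⟪u, x⟫_ℝ ^ m : ℝ) : ℂ) * ((Real.exp (-‖x‖ ^ 2) : ℝ) : ℂ))) := by
  have h := ((gaussianSchwartz V).integrable_pow_mul volume (p + q + m)).const_mul
    (2 ^ (p + q) * ‖u‖ ^ m)
  have hc := continuous_cform e a
  refine h.mono' (Continuous.aestronglyMeasurable ?_) (Filter.Eventually.of_forall fun x => ?_)
  · refine Continuous.mul (Continuous.mul (hc.pow p) ((Complex.continuous_conj.comp hc).pow q)) ?_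
    fun_prop
  · have h1 := norm_cform_le he ha x
    have e1 : ‖gaussianSchwartz V x‖ = Real.exp (-‖x‖ ^ 2) := by
      change ‖((Real.exp (-‖x‖ ^ 2) : ℝ) : ℂ)‖ = _
      rw [Complex.norm_real, Real.norm_of_nonneg (Real.exp_pos _).le]
    rw [e1, norm_mul, norm_mul, norm_mul, norm_pow, norm_pow, RCLike.norm_conj, Complex.norm_real,
      Complex.norm_real, norm_pow, Real.norm_of_nonneg (Real.exp_pos (-‖x‖ ^ 2)).le]
    have h2 : ‖⟪u, x⟫_ℝ‖ ≤ ‖u‖ * ‖x‖ := norm_inner_le_norm u x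
    calc _ ≤ (2 * ‖x‖) ^ p * (2 * ‖x‖) ^ q * ((‖u‖ * ‖x‖) ^ m * Real.exp (-‖x‖ ^ 2)) := by
          gcongr
      _ = _ := by ring

/-- Integration by parts in the direction annihilated by the conjugate linear form. -/
theorem integral_cform_pow_succ {e a : V} (he : ‖e‖ = 1) (ha : ‖a‖ = 1) (hea : ⟪e, a⟫_ℝ = 0)
    (J : ℕ) :
    ∫ x, cform e a x ^ (J + 1) * (starRingEnd ℂ) (cform e a x) ^ (J + 1)
        * ((Real.exp (-‖x‖ ^ 2) : ℝ) : ℂ)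
      = (J + 1) * ∫ x, cform e a x ^ J * (starRingEnd ℂ) (cform e a x) ^ J
        * ((Real.exp (-‖x‖ ^ 2) : ℝ) : ℂ) := by
  set φ := cform e a with hφ
  set g : V → ℂ := fun x => ((Real.exp (-‖x‖ ^ 2) : ℝ) : ℂ) with hg
  set f : V → ℂ := fun x => φ x ^ (J + 1) * (starRingEnd ℂ) (φ x) ^ J with hf
  have hint : ∀ p q, Integrable (fun x => φ x ^ p * (starRingEnd ℂ) (φ x) ^ q * g x) := by
    intro p q
    have h := integrable_cform_pow_mul_exp he ha p q 0 (0 : V)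
    simp only [pow_zero, Complex.ofReal_one, one_mul] at h
    exact h
  have hint1 : ∀ p q u, Integrable (fun x => φ x ^ p * (starRingEnd ℂ) (φ x) ^ q *
      ((⟪u, x⟫_ℝ : ℝ) * g x)) := by
    intro p q u
    have h := integrable_cform_pow_mul_exp he ha p q 1 u
    simp only [pow_one] at h
    exact h
  have hgd : ∀ x, HasFDerivAt g (Complex.ofRealCLM.comp
      (Real.exp (-‖x‖ ^ 2) • ((-2 : ℝ) • innerSL ℝ x))) x := by
    intro x
    have h1 : HasFDerivAt (fun x : V => Real.exp (-‖x‖ ^ 2))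
        (Real.exp (-‖x‖ ^ 2) • ((-2 : ℝ) • innerSL ℝ x)) x := by
      rw [← fderiv_exp_neg_norm_sq]
      exact (contDiff_exp_neg_norm_sq.differentiable (by simp)).differentiableAt.hasFDerivAt
    exact Complex.ofRealCLM.hasFDerivAt.comp x h1
  have hgv : ∀ x v, fderiv ℝ g x v = -2 * ((⟪v, x⟫_ℝ : ℝ) * g x) := by
    intro x v
    rw [(hgd x).fderiv]
    simp only [ContinuousLinearMap.comp_apply, smul_apply, innerSL_apply_apply,
      Complex.ofRealCLM_apply, smul_eq_mul, hg]
    rw [real_inner_comm]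
    push_cast; ring
  have hφd : ∀ x, HasFDerivAt φ
      (Complex.I • (Complex.ofRealCLM.comp (innerSL ℝ e)) +
        Complex.ofRealCLM.comp (innerSL ℝ a)) x :=
    hasFDerivAt_cform e a
  have hfv : ∀ x, HasFDerivAt f _ x := fun x =>
    ((hφd x).pow (J + 1)).mul ((((Complex.conjCLE : ℂ →L[ℝ] ℂ).hasFDerivAt.comp x (hφd x))).pow J)
  have hfderiv : ∀ x v, fderiv ℝ f x v =
      (J + 1) * φ v * (φ x ^ J * (starRingEnd ℂ) (φ x) ^ J) +
        J * (starRingEnd ℂ) (φ v) * (φ x ^ (J + 1) * (starRingEnd ℂ) (φ x) ^ (J - 1)) := by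
    intro x v
    rw [(hfv x).fderiv]
    have hv : Complex.I * (⟪e, v⟫_ℝ : ℝ) + (⟪a, v⟫_ℝ : ℝ) = φ v := rfl
    simp only [add_apply, smul_apply,
      ContinuousLinearMap.comp_apply, innerSL_apply_apply, Complex.ofRealCLM_apply, smul_eq_mul,
      Function.comp_apply, ContinuousLinearEquiv.coe_coe, Complex.conjCLE_apply, hv,
      Nat.add_sub_cancel, nsmul_eq_mul]
    push_cast
    ring
  have hparts : ∀ v : V, ∫ x, f x * (-2 * ((⟪v, x⟫_ℝ : ℝ) * g x))
      = - ∫ x, ((J + 1) * φ v * (φ x ^ J * (starRingEnd ℂ) (φ x) ^ J) +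
        J * (starRingEnd ℂ) (φ v) * (φ x ^ (J + 1) * (starRingEnd ℂ) (φ x) ^ (J - 1))) * g x := by
    intro v
    have h := integral_mul_fderiv_eq_neg_fderiv_mul_of_integrable (μ := (volume : Measure V))
      (f := f) (g := g) (v := v) ?_ ?_ ?_ (fun x _ => (hfv x).differentiableAt)
      (fun x _ => (hgd x).differentiableAt)
    · simp_rw [hgv, hfderiv] at h
      exact h
    · simp_rw [hfderiv]
      refine (((hint J J).const_mul ((J + 1) * φ v)).add
        ((hint (J + 1) (J - 1)).const_mul (J * (starRingEnd ℂ) (φ v)))).congr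
        (Filter.Eventually.of_forall fun x => ?_)
      simp only [Pi.add_apply]; ring
    · simp_rw [hgv]
      have := (hint1 (J + 1) J v).const_mul (-2)
      refine this.congr (Filter.Eventually.of_forall fun x => ?_)
      simp only [hf]; ring
    · exact hint (J + 1) J
  have hφa : φ a = 1 := by
    simp [hφ, cform, hea, ha]
  have hφe : φ e = Complex.I := by
    have : ⟪a, e⟫_ℝ = 0 := by rw [real_inner_comm]; exact hea
    simp [hφ, cform, this, he]
  have ha1 := hparts a
  have he1 := hparts e
  rw [hφa, map_one] at ha1
  rw [hφe, Complex.conj_I] at he1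
  -- the combination of the two directions that annihilates the conjugate linear form
  have hl : ∫ x, φ x ^ (J + 1) * (starRingEnd ℂ) (φ x) ^ (J + 1) * g x
      = (-1 / 2 : ℂ) * ((∫ x, f x * (-2 * ((⟪a, x⟫_ℝ : ℝ) * g x)))
        - Complex.I * ∫ x, f x * (-2 * ((⟪e, x⟫_ℝ : ℝ) * g x))) := by
    have i1 : ∀ v, Integrable (fun x => f x * (-2 * ((⟪v, x⟫_ℝ : ℝ) * g x))) := by
      intro v
      refine ((hint1 (J + 1) J v).const_mul (-2)).congr (Filter.Eventually.of_forall fun x => ?_)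
      simp only [hf]; ring
    rw [← integral_const_mul, ← integral_sub (i1 a) ((i1 e).const_mul _), ← integral_const_mul]
    refine integral_congr_ae (Filter.Eventually.of_forall fun x => ?_)
    have hcx : (starRingEnd ℂ) (φ x) = (⟪a, x⟫_ℝ : ℝ) - Complex.I * (⟪e, x⟫_ℝ : ℝ) := by
      simp only [hφ, cform, map_add, map_mul, Complex.conj_I, Complex.conj_ofReal]; ring
    simp only [hf]
    rw [pow_succ ((starRingEnd ℂ) (φ x)), hcx]
    ring
  have i2 : ∀ c d : ℂ, ∫ x, (((J : ℂ) + 1) * c * (φ x ^ J * (starRingEnd ℂ) (φ x) ^ J) +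
        J * d * (φ x ^ (J + 1) * (starRingEnd ℂ) (φ x) ^ (J - 1))) * g x
      = (J + 1) * c * (∫ x, φ x ^ J * (starRingEnd ℂ) (φ x) ^ J * g x)
        + J * d * ∫ x, φ x ^ (J + 1) * (starRingEnd ℂ) (φ x) ^ (J - 1) * g x := by
    intro c d
    rw [← integral_const_mul, ← integral_const_mul,
      ← integral_add ((hint J J).const_mul _) ((hint (J + 1) (J - 1)).const_mul _)]
    refine integral_congr_ae (Filter.Eventually.of_forall fun x => ?_)
    simp only; ring
  rw [hl, ha1, he1, i2, i2]
  linear_combination (-(1 / 2 : ℂ) * (((J : ℂ) + 1) *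
      (∫ x, φ x ^ J * (starRingEnd ℂ) (φ x) ^ J * g x)
    - J * (∫ x, φ x ^ (J + 1) * (starRingEnd ℂ) (φ x) ^ (J - 1) * g x))) * Complex.I_sq

/-- The Gaussian moments of the modulus of an isotropic linear form. -/
theorem integral_norm_cform_pow {e a : V} (he : ‖e‖ = 1) (ha : ‖a‖ = 1) (hea : ⟪e, a⟫_ℝ = 0)
    (J : ℕ) :
    ∫ x, cform e a x ^ J * (starRingEnd ℂ) (cform e a x) ^ J * ((Real.exp (-‖x‖ ^ 2) : ℝ) : ℂ)
      = J.factorial * ((∫ x : V, Real.exp (-‖x‖ ^ 2) : ℝ) : ℂ) := by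
  induction J with
  | zero => simp [← integral_complex_ofReal]
  | succ J ih =>
    rw [integral_cform_pow_succ he ha hea, ih, Nat.factorial_succ]
    push_cast; ring

theorem integral_exp_neg_norm_sq_pos : 0 < ∫ x : V, Real.exp (-‖x‖ ^ 2) := by
  have hint : Integrable (fun x : V => Real.exp (-‖x‖ ^ 2)) := by
    have h := (gaussianSchwartz V).integrable (μ := volume) |>.norm
    refine h.congr (Filter.Eventually.of_forall fun x => ?_)
    change ‖((Real.exp (-‖x‖ ^ 2) : ℝ) : ℂ)‖ = _
    rw [Complex.norm_real, Real.norm_of_nonneg (Real.exp_pos _).le]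
  exact integral_exp_pos hint

end Diagonal

section Polar

/-- Polar coordinates for a function that separates into a radial and an angular factor. No
integrability is needed, since every step is an identity between possibly undefined integrals
with the default value `0`. -/
theorem integral_eq_sphere_mul_radial {n : ℕ} (F : EuclideanSpace ℝ (Fin (n + 1)) → ℂ)
    (g : UnitSphere n → ℂ) (ρ : ℝ → ℝ)
    (h : ∀ (r : ℝ) (p : UnitSphere n), 0 < r → F (r • p.1) = (ρ r : ℂ) * g p) :
    ∫ x, F x = (∫ p, g p ∂(surfaceMeasure n)) *
      ((∫ r in Set.Ioi (0 : ℝ), r ^ n * ρ r : ℝ) : ℂ) := by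
  let E := EuclideanSpace ℝ (Fin (n + 1))
  have hdim : Module.finrank ℝ E - 1 = n := by simp [E]
  calc ∫ x, F x = ∫ x : ({(0)}ᶜ : Set E), F x ∂((volume : Measure E).comap (↑)) := by
        rw [integral_subtype_comap (measurableSet_singleton _).compl F,
          restrict_compl_singleton]
    _ = ∫ x, g x.1 * (ρ x.2 : ℂ) ∂(volume : Measure E).toSphere.prod
          (.volumeIoiPow (Module.finrank ℝ E - 1)) := by
        rw [← (volume : Measure E).measurePreserving_homeomorphUnitSphereProd.integral_comp
          (Homeomorph.measurableEmbedding _)]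
        refine integral_congr_ae (Filter.Eventually.of_forall fun x => ?_)
        set p := homeomorphUnitSphereProd (EuclideanSpace ℝ (Fin (n + 1))) x with hp
        have hx : x.1 = (p.2 : ℝ) • p.1.1 := by
          have := homeomorphUnitSphereProd_symm_apply_coe (EuclideanSpace ℝ (Fin (n + 1))) p
          rw [hp, Homeomorph.symm_apply_apply] at this
          exact this
        simp only
        rw [hx, h _ _ p.2.2, mul_comm]
    _ = (∫ p, g p ∂(surfaceMeasure n)) *
        ∫ r : Set.Ioi (0 : ℝ), (ρ r : ℂ) ∂(.volumeIoiPow (Module.finrank ℝ E - 1)) :=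
      integral_prod_mul g fun r : Set.Ioi (0 : ℝ) => (ρ r : ℂ)
    _ = _ := by
        congr 1
        rw [hdim, integral_complex_ofReal]
        congr 1
        simp only [Measure.volumeIoiPow, ENNReal.ofReal]
        rw [integral_withDensity_eq_integral_smul,
          integral_subtype_comap measurableSet_Ioi fun a ↦ Real.toNNReal (a ^ n) • ρ a]
        · refine setIntegral_congr_fun measurableSet_Ioi fun x hx => ?_
          rw [NNReal.smul_def, Real.coe_toNNReal _ (pow_nonneg (le_of_lt hx) _), smul_eq_mul]
        · exact (measurable_subtype_coe.pow_const _).real_toNNReal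

end Polar

/-! ### Extension of admissible amplitudes -/

section RadialExtension

variable {n : ℕ}

theorem radialExt_smul (f : UnitSphere n → ℂ) {s : ℝ} (hs : 0 < s)
    (y : EuclideanSpace ℝ (Fin (n + 1))) : radialExt f (s • y) = radialExt f y := by
  by_cases hy : y = 0
  · simp [hy]
  · have hsy : s • y ≠ 0 := smul_ne_zero hs.ne' hy
    rw [radialExt, radialExt, dif_neg hy, dif_neg hsy]
    congr 2
    rw [norm_smul, Real.norm_of_nonneg hs.le, smul_smul, mul_inv]
    congr 1
    field_simp

theorem radialExt_coe (f : UnitSphere n → ℂ) (x : UnitSphere n) : radialExt f x.1 = f x := by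
  have hx : ‖x.1‖ = 1 := by simp
  have hx0 : x.1 ≠ 0 := by intro h; rw [h] at hx; simp at hx
  rw [radialExt, dif_neg hx0]
  congr 1
  apply Subtype.ext
  simp

/-- Smoothness on the sphere as a manifold gives smoothness of the extension that is constant along
rays. -/
theorem contDiffAt_radialExt {f : UnitSphere n → ℂ} (hf : ContMDiff (𝓡 n) 𝓘(ℝ, ℂ) ∞ f)
    {x : EuclideanSpace ℝ (Fin (n + 1))} (hx : x ≠ 0) : ContDiffAt ℝ ∞ (radialExt f) x := by
  have := Fact.mk (@finrank_euclideanSpace_fin ℝ _ (n + 1))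
  have hxn : 0 < ‖x‖ := norm_pos_iff.mpr hx
  let b : ContDiffBump x := ⟨‖x‖ / 4, ‖x‖ / 2, by positivity, by linarith⟩
  -- a globally smooth map without zeros that is the identity near `x`
  let ψ : EuclideanSpace ℝ (Fin (n + 1)) → EuclideanSpace ℝ (Fin (n + 1)) :=
    fun y => x + b y • (y - x)
  have hψc : ContDiff ℝ ∞ ψ := contDiff_const.add (b.contDiff.smul (contDiff_id.sub contDiff_const))
  have hψ0 : ∀ y, ψ y ≠ 0 := by
    intro y h
    have h1 : ‖x‖ = ‖b y • (y - x)‖ := by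
      have h2 := congrArg norm (eq_neg_of_add_eq_zero_left h)
      rwa [norm_neg] at h2
    rw [norm_smul, Real.norm_of_nonneg b.nonneg] at h1
    by_cases hy : dist y x < ‖x‖ / 2
    · rw [dist_eq_norm] at hy
      have := mul_le_of_le_one_left (norm_nonneg (y - x)) (b.le_one (x := y))
      linarith
    · have : b y = 0 := b.zero_of_le_dist (not_lt.mp hy)
      rw [this, zero_mul] at h1
      linarith
  have hN : ContDiff ℝ ∞ (fun y => ‖ψ y‖⁻¹ • ψ y) :=
    ((hψc.norm ℝ hψ0).inv fun y => norm_ne_zero_iff.mpr (hψ0 y)).smul hψc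
  have hmem : ∀ y, ‖ψ y‖⁻¹ • ψ y ∈ sphere (0 : EuclideanSpace ℝ (Fin (n + 1))) 1 := by
    intro y
    rw [mem_sphere_zero_iff_norm, norm_smul, norm_inv, norm_norm,
      inv_mul_cancel₀ (norm_ne_zero_iff.mpr (hψ0 y))]
  have hS := ContMDiff.codRestrict_sphere (n := n) hN.contMDiff hmem
  have hcomp := (hf.comp hS).contDiff
  refine hcomp.contDiffAt.congr_of_eventuallyEq ?_
  filter_upwards [b.eventuallyEq_one, isOpen_ne.mem_nhds hx] with y hy hy0
  have hψy : ψ y = y := by simp [ψ, hy]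
  have hy0 : y ≠ 0 := hy0
  rw [radialExt, dif_neg hy0]
  simp only [Function.comp_apply]
  congr 1
  apply Subtype.ext
  simp [hψy]

theorem contDiffOn_radialExt {f : UnitSphere n → ℂ} (hf : ContMDiff (𝓡 n) 𝓘(ℝ, ℂ) ∞ f) :
    ContDiffOn ℝ ∞ (radialExt f) {0}ᶜ :=
  fun _ hx => (contDiffAt_radialExt hf hx).contDiffWithinAt

/-- A smooth radial cutoff that vanishes for `18 ‖x‖² ≤ 1` and equals `1` for `9 ‖x‖² ≥ 1`. At the
scale `√(J + 1)` it removes only radii well below those where `r ^ (2 * J) * exp (-r ^ 2)`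
concentrates. -/
noncomputable def cutoff {V : Type*} [NormedAddCommGroup V] (x : V) : ℝ :=
  Real.smoothTransition (18 * ‖x‖ ^ 2 - 1)

theorem contDiff_cutoff {V : Type*} [NormedAddCommGroup V] [InnerProductSpace ℝ V] :
    ContDiff ℝ ∞ (cutoff : V → ℝ) :=
  Real.smoothTransition.contDiff.comp
    ((contDiff_const.mul (contDiff_norm_sq ℝ)).sub contDiff_const)

theorem contDiff_cutoff_smul {V : Type*} [NormedAddCommGroup V] [InnerProductSpace ℝ V] (s : ℝ) :
    ContDiff ℝ ∞ fun x : V => cutoff (s • x) :=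
  contDiff_cutoff.comp (contDiff_const_smul s)

theorem cutoff_eq_zero {V : Type*} [NormedAddCommGroup V] {x : V} (h : 18 * ‖x‖ ^ 2 ≤ 1) :
    cutoff x = 0 := Real.smoothTransition.zero_of_nonpos (by linarith)

theorem cutoff_eq_one {V : Type*} [NormedAddCommGroup V] {x : V} (h : 1 ≤ 9 * ‖x‖ ^ 2) :
    cutoff x = 1 := Real.smoothTransition.one_of_one_le (by linarith)

theorem exists_norm_iteratedFDeriv_cutoff_le {V : Type*} [NormedAddCommGroup V]
    [InnerProductSpace ℝ V] [FiniteDimensional ℝ V] (i : ℕ) :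
    ∃ C : ℝ, 0 ≤ C ∧ ∀ x : V, ‖iteratedFDeriv ℝ i (cutoff : V → ℝ) x‖ ≤ C := by
  have hsupp : HasCompactSupport (fun x : V => cutoff x - 1) := by
    refine HasCompactSupport.intro (isCompact_closedBall (0 : V) 1) fun x hx => ?_
    rw [mem_closedBall_zero_iff, not_le] at hx
    rw [cutoff_eq_one (by nlinarith), sub_self]
  have hc : ContDiff ℝ ∞ (fun x : V => cutoff x - 1) := contDiff_cutoff.sub contDiff_const
  obtain ⟨C, hC⟩ := (hc.continuous_iteratedFDeriv (m := i)
    (by exact_mod_cast le_top)).bounded_above_of_compact_support (hsupp.iteratedFDeriv i)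
  rcases i with _ | i
  · refine ⟨1, zero_le_one, fun x => ?_⟩
    rw [norm_iteratedFDeriv_zero, cutoff,
      Real.norm_of_nonneg (Real.smoothTransition.nonneg _)]
    exact Real.smoothTransition.le_one _
  · refine ⟨|C|, abs_nonneg _, fun x => ?_⟩
    have e : iteratedFDeriv ℝ (i + 1) (fun x : V => cutoff x - 1) x
        = iteratedFDeriv ℝ (i + 1) (cutoff : V → ℝ) x := by
      have e1 : fderiv ℝ (fun x : V => cutoff x - 1) = fderiv ℝ (cutoff : V → ℝ) := by
        funext y; exact fderiv_sub_const _
      rw [iteratedFDeriv_succ_eq_comp_right, iteratedFDeriv_succ_eq_comp_right, e1]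
    rw [← e]
    exact (hC x).trans (le_abs_self _)

/-- Derivatives of order `i` of the extension are homogeneous of degree `-i`. -/
theorem norm_iteratedFDeriv_radialExt_smul {f : UnitSphere n → ℂ}
    (hf : ContMDiff (𝓡 n) 𝓘(ℝ, ℂ) ∞ f) (i : ℕ) {s : ℝ} (hs : 0 < s) (p : UnitSphere n) :
    ‖iteratedFDeriv ℝ i (radialExt f) (s • p.1)‖
      = (s⁻¹) ^ i * ‖iteratedFDeriv ℝ i (radialExt f) p.1‖ := by
  have hp : ‖p.1‖ = 1 := by simp
  have hp0 : p.1 ≠ 0 := by intro h; rw [h] at hp; simp at hp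
  -- a global smooth function that agrees with the extension near `p`
  set g : EuclideanSpace ℝ (Fin (n + 1)) → ℂ := fun y => (cutoff y : ℂ) * radialExt f y with hg
  have hgc : ContDiff ℝ ∞ g := by
    rw [contDiff_iff_contDiffAt]
    intro y
    by_cases hy : y = 0
    · subst hy
      refine (contDiffAt_const (c := (0 : ℂ))).congr_of_eventuallyEq ?_
      have : ∀ᶠ y : EuclideanSpace ℝ (Fin (n + 1)) in nhds 0, 18 * ‖y‖ ^ 2 < 1 := by
        have hc : Continuous fun y : EuclideanSpace ℝ (Fin (n + 1)) => 18 * ‖y‖ ^ 2 := by fun_prop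
        exact hc.continuousAt.eventually_lt continuousAt_const (by simp)
      filter_upwards [this] with y hy
      simp [hg, cutoff_eq_zero hy.le]
    · exact (Complex.ofRealCLM.contDiff.comp contDiff_cutoff).contDiffAt.mul
        (contDiffAt_radialExt hf hy)
  have hev : ∀ᶠ y in nhds p.1, cutoff y = 1 := by
    have hc : Continuous fun y : EuclideanSpace ℝ (Fin (n + 1)) => 9 * ‖y‖ ^ 2 := by fun_prop
    have : ∀ᶠ y in nhds p.1, 1 < 9 * ‖y‖ ^ 2 :=
      continuousAt_const.eventually_lt hc.continuousAt (by rw [hp]; norm_num)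
    filter_upwards [this] with y hy
    exact cutoff_eq_one hy.le
  have h1 : radialExt f =ᶠ[nhds p.1] g := by
    filter_upwards [hev] with y hy
    simp [hg, hy]
  have h2 : radialExt f =ᶠ[nhds (s • p.1)] fun y => g (s⁻¹ • y) := by
    have ht : Filter.Tendsto (fun y : EuclideanSpace ℝ (Fin (n + 1)) => s⁻¹ • y)
        (nhds (s • p.1)) (nhds p.1) := by
      have hc : Continuous fun y : EuclideanSpace ℝ (Fin (n + 1)) => s⁻¹ • y := by fun_prop
      have := hc.tendsto (s • p.1)
      rwa [inv_smul_smul₀ hs.ne'] at this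
    filter_upwards [ht.eventually h1] with y hy
    rw [← hy, radialExt_smul f (inv_pos.mpr hs)]
  rw [(h2.iteratedFDeriv ℝ i).eq_of_nhds, (h1.iteratedFDeriv ℝ i).eq_of_nhds,
    iteratedFDeriv_comp_const_smul s⁻¹ (hgc.of_le (by exact_mod_cast le_top))]
  simp only
  rw [inv_smul_smul₀ hs.ne', norm_smul, norm_pow, Real.norm_of_nonneg (inv_nonneg.mpr hs.le)]

/-- The extension of an amplitude on the sphere that is constant along rays, cut off near the
origin at scale `R`. -/
noncomputable def amplitudeExt (R : ℝ) (f : UnitSphere n → ℂ)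
    (x : EuclideanSpace ℝ (Fin (n + 1))) : ℂ :=
  (cutoff (R⁻¹ • x) : ℂ) * radialExt f x

theorem amplitudeExt_eventuallyEq_zero {R : ℝ} (hR : 0 < R) (f : UnitSphere n → ℂ)
    {x : EuclideanSpace ℝ (Fin (n + 1))} (hx : 18 * ‖x‖ ^ 2 < R ^ 2) :
    amplitudeExt R f =ᶠ[nhds x] fun _ => 0 := by
  have hc : Continuous fun y : EuclideanSpace ℝ (Fin (n + 1)) => 18 * ‖y‖ ^ 2 := by fun_prop
  have : ∀ᶠ y in nhds x, 18 * ‖y‖ ^ 2 < R ^ 2 :=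
    hc.continuousAt.eventually_lt continuousAt_const hx
  filter_upwards [this] with y hy
  rw [amplitudeExt, cutoff_eq_zero]
  · simp
  · rw [norm_smul, norm_inv, Real.norm_of_nonneg hR.le, mul_pow, inv_pow]
    have h2 : 0 < R ^ 2 := by positivity
    field_simp
    linarith

theorem contDiff_amplitudeExt {R : ℝ} (hR : 0 < R) {f : UnitSphere n → ℂ}
    (hf : ContMDiff (𝓡 n) 𝓘(ℝ, ℂ) ∞ f) : ContDiff ℝ ∞ (amplitudeExt R f) := by
  rw [contDiff_iff_contDiffAt]
  intro x
  by_cases hx : x = 0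
  · subst hx
    exact contDiffAt_const.congr_of_eventuallyEq
      (amplitudeExt_eventuallyEq_zero hR f (by simpa using pow_pos hR 2))
  · refine ContDiffAt.mul ?_ (contDiffAt_radialExt hf hx)
    exact (Complex.ofRealCLM.contDiff.comp (contDiff_cutoff_smul R⁻¹)).contDiffAt

/-- At the scale `R`, comparable with `h ^ (-1/2)`, admissible amplitudes have derivatives bounded
by constants. -/
theorem exists_norm_iteratedFDeriv_amplitudeExt_le (n : ℕ) (A : ℕ → ℝ) (κ : ℝ) :
    ∃ D : ℕ → ℝ, (∀ i, 0 ≤ D i) ∧ ∀ (h c R : ℝ) (f : UnitSphere n → ℂ), 0 < h → 1 ≤ R →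
      h⁻¹ ≤ κ * R ^ 2 → AdmissibleWeight h c A f → ∀ i x,
        ‖iteratedFDeriv ℝ i (amplitudeExt R f) x‖ ≤ D i := by
  choose B hB0 hB using fun i => exists_norm_iteratedFDeriv_cutoff_le
    (V := EuclideanSpace ℝ (Fin (n + 1))) i
  refine ⟨fun i => ∑ m ∈ Finset.range (i + 1), (i.choose m : ℝ) * B m *
    (|A (i - m)| * Real.sqrt (18 * κ) ^ (i - m)), fun i => ?_, ?_⟩
  · refine Finset.sum_nonneg fun m _ => ?_
    have := hB0 m
    positivity
  intro h c R f hh hR hκ hf i x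
  have hR0 : 0 < R := by linarith
  by_cases hx : 18 * ‖x‖ ^ 2 < R ^ 2
  · rw [((amplitudeExt_eventuallyEq_zero hR0 f hx).iteratedFDeriv ℝ i).eq_of_nhds]
    have : iteratedFDeriv ℝ i (fun _ : EuclideanSpace ℝ (Fin (n + 1)) => (0 : ℂ)) x = 0 := by
      rw [iteratedFDeriv_fun_zero]; rfl
    rw [this, norm_zero]
    refine Finset.sum_nonneg fun m _ => ?_
    have := hB0 m
    positivity
  · have hx' : R ^ 2 ≤ 18 * ‖x‖ ^ 2 := not_lt.mp hx
    have hx0 : x ≠ 0 := by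
      intro h0
      rw [h0] at hx'
      simp at hx'
      linarith
    have hxn : 0 < ‖x‖ := norm_pos_iff.mpr hx0
    have hopen : IsOpen ({0}ᶜ : Set (EuclideanSpace ℝ (Fin (n + 1)))) := isOpen_compl_singleton
    set χ : EuclideanSpace ℝ (Fin (n + 1)) → ℂ := fun x => (cutoff (R⁻¹ • x) : ℂ) with hχ
    have hcs : ContDiff ℝ ∞ fun x : EuclideanSpace ℝ (Fin (n + 1)) => cutoff (R⁻¹ • x) :=
      contDiff_cutoff_smul R⁻¹
    have hχc : ContDiff ℝ ∞ χ := Complex.ofRealCLM.contDiff.comp hcs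
    have hχb : ∀ m, ‖iteratedFDeriv ℝ m χ x‖ ≤ B m := by
      intro m
      have e1 : ‖iteratedFDeriv ℝ m χ x‖ = ‖iteratedFDeriv ℝ m
          (fun x : EuclideanSpace ℝ (Fin (n + 1)) => cutoff (R⁻¹ • x)) x‖ :=
        Complex.ofRealLI.norm_iteratedFDeriv_comp_left hcs.contDiffAt (by exact_mod_cast le_top)
      rw [e1, iteratedFDeriv_comp_const_smul R⁻¹ (contDiff_cutoff.of_le (by exact_mod_cast le_top))]
      simp only
      rw [norm_smul, norm_pow, norm_inv, Real.norm_of_nonneg hR0.le]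
      refine (mul_le_of_le_one_left (norm_nonneg _) ?_).trans (hB m _)
      exact pow_le_one₀ (by positivity) (inv_le_one_of_one_le₀ hR)
    have hfb : ∀ m, ‖iteratedFDeriv ℝ m (radialExt f) x‖ ≤ |A m| * Real.sqrt (18 * κ) ^ m := by
      intro m
      set p : UnitSphere n := ⟨‖x‖⁻¹ • x, by
        rw [mem_sphere_zero_iff_norm, norm_smul, norm_inv, norm_norm,
          inv_mul_cancel₀ hxn.ne']⟩ with hp
      have hxp : x = ‖x‖ • p.1 := by
        rw [hp]; simp only; rw [smul_inv_smul₀ hxn.ne']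
      have e1 := norm_iteratedFDeriv_radialExt_smul hf.smooth m hxn p
      rw [← hxp] at e1
      rw [e1]
      have h1 := hf.deriv_le m p
      have hhp : h ^ (-((m : ℝ) / 2)) = Real.sqrt h⁻¹ ^ m := by
        rw [Real.sqrt_eq_rpow, ← Real.rpow_natCast, ← Real.rpow_mul (by positivity),
          Real.inv_rpow hh.le, ← Real.rpow_neg hh.le]
        congr 1; ring
      rw [hhp] at h1
      have h2 : ‖x‖⁻¹ * Real.sqrt h⁻¹ ≤ Real.sqrt (18 * κ) := by
        rw [inv_mul_le_iff₀ hxn]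
        apply Real.sqrt_le_iff.mpr
        refine ⟨by positivity, ?_⟩
        have hκ0 : 0 ≤ κ := by
          by_contra hneg
          have : 0 < h⁻¹ := inv_pos.mpr hh
          nlinarith [sq_nonneg R]
        rw [mul_pow, Real.sq_sqrt (by positivity)]
        nlinarith
      calc (‖x‖⁻¹) ^ m * ‖iteratedFDeriv ℝ m (radialExt f) p.1‖
          ≤ (‖x‖⁻¹) ^ m * (|A m| * Real.sqrt h⁻¹ ^ m) := by
            gcongr
            refine h1.trans ?_
            gcongr
            exact le_abs_self _
        _ = |A m| * (‖x‖⁻¹ * Real.sqrt h⁻¹) ^ m := by rw [mul_pow]; ring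
        _ ≤ _ := by gcongr
    have hmem : x ∈ ({0}ᶜ : Set (EuclideanSpace ℝ (Fin (n + 1)))) := hx0
    have hle := norm_iteratedFDerivWithin_mul_le (𝕜 := ℝ) (hχc.contDiffOn)
      (contDiffOn_radialExt hf.smooth) hopen.uniqueDiffOn hmem (n := i) (by exact_mod_cast le_top)
    simp only [iteratedFDerivWithin_of_isOpen _ hopen hmem] at hle
    refine hle.trans (Finset.sum_le_sum fun m _ => ?_)
    have := hB0 m
    gcongr
    · exact hχb m
    · exact hfb _

end RadialExtension

/-! ### Cross terms and norms of beams on the sphere -/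

section SphereCrossTerms

variable {n : ℕ}

theorem beamForm_eq_cform (a x : EuclideanSpace ℝ (Fin (n + 1))) :
    beamForm a x = cform (EuclideanSpace.single 0 1) a x := by
  rw [beamForm, cform, EuclideanSpace.inner_single_left]
  simp

theorem norm_single_zero_one :
    ‖(EuclideanSpace.single 0 1 : EuclideanSpace ℝ (Fin (n + 1)))‖ = 1 := by
  simp

/-- The order of the radial moment that polar coordinates produce, written as a half-integer shift
of `J + 1`. -/
theorem Gamma_half_shift (hn : 1 ≤ n) (J m : ℕ) :
    Real.Gamma ((((n + 2 * J + m : ℕ) : ℝ) + 1) / 2)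
      = Real.Gamma (((J : ℝ) + 1) + ((n - 1 + m : ℕ) : ℝ) / 2) := by
  congr 1
  push_cast [Nat.cast_sub hn]
  ring

/-- The cross terms of two beams on the sphere with admissible amplitudes decay rapidly in the
distance of the two great circles, measured in units of the width of the beams. -/
theorem exists_sphere_cross_term_bound (hn : 1 ≤ n) (u : EuclideanSpace ℝ (Fin (n + 1)))
    (m r : ℕ) (A : ℕ → ℝ) (κ : ℝ) : ∃ C : ℝ, 0 ≤ C ∧
    ∀ a a' : EuclideanSpace ℝ (Fin (n + 1)), ‖a‖ = 1 → ‖a'‖ = 1 → a 0 = 0 → a' 0 = 0 →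
    (m = 0 ∨ (u 0 = 0 ∧ ⟪u, a⟫_ℝ = 0 ∧ ⟪u, a'⟫_ℝ = 0)) →
    ∀ (J : ℕ) (h c : ℝ) (f f' : UnitSphere n → ℂ), 0 < h → h⁻¹ ≤ κ * (J + 1) →
    AdmissibleWeight h c A f → AdmissibleWeight h c A f' →
    ‖∫ p, beamForm a p.1 ^ J * (starRingEnd ℂ) (beamForm a' p.1 ^ J) *
        (((⟪u, p.1⟫_ℝ ^ m : ℝ) : ℂ) * (f p * (starRingEnd ℂ) (f' p))) ∂(surfaceMeasure n)‖
      * (1 + Real.sqrt (J + 1) * ‖a - a'‖) ^ r * Real.sqrt (J + 1) ^ (n - 1 + m) ≤ C := by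
  obtain ⟨D, hD0, hD⟩ := exists_norm_iteratedFDeriv_amplitudeExt_le n A κ
  obtain ⟨C, hC, hmain⟩ := exists_gaussian_cross_term_bound u m r
    (fun i => ∑ l ∈ Finset.range (i + 1), (i.choose l : ℝ) * D l * D (i - l))
  obtain ⟨c₁, _, hc₁, _, hGam⟩ := exists_Gamma_add_nat_half_bounds (n - 1 + m)
  refine ⟨4 * C / c₁, by positivity, ?_⟩
  intro a a' ha ha' ha0 ha0' hu J h c f f' hh hκ hf hf'
  set e : EuclideanSpace ℝ (Fin (n + 1)) := EuclideanSpace.single 0 1 with he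
  have hen : ‖e‖ = 1 := norm_single_zero_one
  have hein : ∀ x : EuclideanSpace ℝ (Fin (n + 1)), ⟪e, x⟫_ℝ = x 0 := by
    intro x; rw [he, EuclideanSpace.inner_single_left]; simp
  set R := Real.sqrt (J + 1) with hRdef
  have hR2 : R ^ 2 = J + 1 := Real.sq_sqrt (by positivity)
  have hR1 : 1 ≤ R := Real.one_le_sqrt.mpr (by linarith [(Nat.cast_nonneg J : (0 : ℝ) ≤ J)])
  have hR0 : 0 < R := by linarith
  rw [← hR2] at hκ
  set G : EuclideanSpace ℝ (Fin (n + 1)) → ℂ :=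
    fun x => amplitudeExt R f x * (starRingEnd ℂ) (amplitudeExt R f' x) with hG
  have hGf := contDiff_amplitudeExt hR0 hf.smooth
  have hGf' := contDiff_amplitudeExt hR0 hf'.smooth
  have hGfc : ContDiff ℝ ∞ fun x => (starRingEnd ℂ) (amplitudeExt R f' x) :=
    (Complex.conjCLE : ℂ →L[ℝ] ℂ).contDiff.comp hGf'
  have hGc : ContDiff ℝ ∞ G := hGf.mul hGfc
  have hGb : ∀ i ≤ r + 2, ∀ x, ‖iteratedFDeriv ℝ i G x‖ ≤
      ∑ l ∈ Finset.range (i + 1), (i.choose l : ℝ) * D l * D (i - l) := by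
    intro i _ x
    refine (norm_iteratedFDeriv_mul_le hGf hGfc x (n := i) (by exact_mod_cast le_top)).trans ?_
    refine Finset.sum_le_sum fun l _ => ?_
    have h1 := hD h c R f hh hR1 hκ hf l x
    have h2 := hD h c R f' hh hR1 hκ hf' (i - l) x
    have h3 : ‖iteratedFDeriv ℝ (i - l) (fun x => (starRingEnd ℂ) (amplitudeExt R f' x)) x‖
        = ‖iteratedFDeriv ℝ (i - l) (amplitudeExt R f') x‖ :=
      Complex.conjLIE.norm_iteratedFDeriv_comp_left (amplitudeExt R f') x (i - l)
    rw [h3]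
    have := hD0 l
    gcongr
  have hu' : m = 0 ∨ (⟪u, e⟫_ℝ = 0 ∧ ⟪u, a⟫_ℝ = 0 ∧ ⟪u, a'⟫_ℝ = 0) := by
    rcases hu with h | ⟨h1, h2, h3⟩
    · exact Or.inl h
    · refine Or.inr ⟨?_, h2, h3⟩
      rw [real_inner_comm, hein, h1]
  have hbound := hmain e a a' hen ha ha' (by rw [hein, ha0]) (by rw [hein, ha0']) hu' J G hGc hGb
  set F : EuclideanSpace ℝ (Fin (n + 1)) → ℂ := fun x =>
    cform e a x ^ J * (starRingEnd ℂ) (cform e a' x ^ J) *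
      (((⟪u, x⟫_ℝ ^ m : ℝ) : ℂ) * ((Real.exp (-‖x‖ ^ 2) : ℝ) : ℂ) * G x) with hF
  set g : UnitSphere n → ℂ := fun p =>
    beamForm a p.1 ^ J * (starRingEnd ℂ) (beamForm a' p.1 ^ J) *
        (((⟪u, p.1⟫_ℝ ^ m : ℝ) : ℂ) * (f p * (starRingEnd ℂ) (f' p))) with hg
  set ψ : ℝ → ℝ := fun s => Real.smoothTransition (18 * (R⁻¹ * s) ^ 2 - 1) ^ 2 with hψ
  have hpolar := integral_eq_sphere_mul_radial F g
    (fun s => s ^ (2 * J + m) * Real.exp (-s ^ 2) * ψ s) (by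
      intro s p hs
      have hp : ‖p.1‖ = 1 := by simp
      have hns : ‖s • p.1‖ = s := by rw [norm_smul, hp, mul_one, Real.norm_of_nonneg hs.le]
      have hcut : cutoff (R⁻¹ • s • p.1) = Real.smoothTransition (18 * (R⁻¹ * s) ^ 2 - 1) := by
        rw [cutoff, norm_smul, hns, norm_inv, Real.norm_of_nonneg hR0.le]
      simp only [hF, hg, hG, amplitudeExt, hcut, radialExt_smul _ hs, radialExt_coe,
        ← beamForm_eq_cform, he, beamForm_smul, hns, inner_smul_right, hψ, map_mul, map_pow,
        Complex.conj_ofReal]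
      push_cast
      ring)
  have hψm : Measurable ψ := by
    have : Continuous ψ := by
      have h1 := Real.smoothTransition.continuous
      rw [hψ]; fun_prop
    exact this.measurable
  have hrad := le_integral_pow_mul_exp_neg_sq_mul (n + 2 * J + m) (b := R / 3) (by positivity)
    (by
      rw [div_pow, hR2]
      have : (1 : ℝ) ≤ n := by exact_mod_cast hn
      push_cast
      have : (0 : ℝ) ≤ m := by positivity
      have : (0 : ℝ) ≤ J := by positivity
      linarith) hψm (fun s => by simp only [hψ]; positivity)
    (fun s => pow_le_one₀ (Real.smoothTransition.nonneg _) (Real.smoothTransition.le_one _))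
    (fun s hs => by
      simp only [hψ]
      rw [Real.smoothTransition.one_of_one_le, one_pow]
      have h1 : 1 / 3 ≤ R⁻¹ * s := by
        rw [inv_mul_eq_div, le_div_iff₀ hR0]; linarith
      nlinarith)
  set ν := ∫ s in Set.Ioi (0 : ℝ), s ^ n * (s ^ (2 * J + m) * Real.exp (-s ^ 2) * ψ s) with hν
  have hνeq : ∫ s in Set.Ioi (0 : ℝ), s ^ (n + 2 * J + m) * Real.exp (-s ^ 2) * ψ s = ν := by
    rw [hν]
    congr 1
    funext s
    rw [show n + 2 * J + m = n + (2 * J + m) by ring, pow_add]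
    ring
  rw [hνeq, Gamma_half_shift hn] at hrad
  have hG1 := (hGam ((J : ℝ) + 1) (by linarith [(Nat.cast_nonneg J : (0 : ℝ) ≤ J)])).1
  rw [Real.Gamma_nat_eq_factorial, ← hRdef] at hG1
  have hνge : c₁ / 4 * R ^ (n - 1 + m) * J.factorial ≤ ν := by linarith
  have hν0 : 0 ≤ ν := le_trans (by positivity) hνge
  have hf0 : (0 : ℝ) < J.factorial := by exact_mod_cast J.factorial_pos
  rw [hpolar, norm_mul, Complex.norm_real, Real.norm_of_nonneg hν0] at hbound
  set X := ‖∫ p, g p ∂(surfaceMeasure n)‖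
  set Y := (1 + R * ‖a - a'‖) ^ r
  have hX : 0 ≤ X := norm_nonneg _
  have hY : 0 ≤ Y := by positivity
  rw [le_div_iff₀ hc₁]
  have h1 : X * (c₁ / 4 * R ^ (n - 1 + m) * J.factorial) * Y ≤ C * J.factorial :=
    le_trans (by gcongr) hbound
  have h2 : (X * (c₁ / 4 * R ^ (n - 1 + m)) * Y) * J.factorial ≤ C * J.factorial := by
    calc _ = _ := by ring
      _ ≤ _ := h1
  have h3 := le_of_mul_le_mul_right h2 hf0
  linarith

/-- The mass of a single beam is at least of the order of the cross section of its tube. -/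
theorem exists_le_integral_norm_beamForm_pow (hn : 1 ≤ n) : ∃ c : ℝ, 0 < c ∧
    ∀ a : EuclideanSpace ℝ (Fin (n + 1)), ‖a‖ = 1 → a 0 = 0 → ∀ J : ℕ,
      c ≤ (∫ p, ‖beamForm a p.1 ^ J‖ ^ 2 ∂(surfaceMeasure n)) * Real.sqrt (J + 1) ^ (n - 1) := by
  obtain ⟨_, C₁, _, hC₁, hGam⟩ := exists_Gamma_add_nat_half_bounds (n - 1)
  have hT := integral_exp_neg_norm_sq_pos (V := EuclideanSpace ℝ (Fin (n + 1)))
  set T := ∫ x : EuclideanSpace ℝ (Fin (n + 1)), Real.exp (-‖x‖ ^ 2) with hTdef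
  refine ⟨2 * T / C₁, by positivity, ?_⟩
  intro a ha ha0 J
  set e : EuclideanSpace ℝ (Fin (n + 1)) := EuclideanSpace.single 0 1 with he
  have hen : ‖e‖ = 1 := norm_single_zero_one
  have hea : ⟪e, a⟫_ℝ = 0 := by rw [he, EuclideanSpace.inner_single_left, ha0]; simp
  have hdiag := integral_norm_cform_pow hen ha hea J
  rw [integral_eq_sphere_mul_radial _
    (fun p : UnitSphere n => ((‖beamForm a p.1 ^ J‖ ^ 2 : ℝ) : ℂ))
    (fun s => s ^ (2 * J) * Real.exp (-s ^ 2)) (by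
      intro s p hs
      have hp : ‖p.1‖ = 1 := by simp
      have hns : ‖s • p.1‖ = s := by rw [norm_smul, hp, mul_one, Real.norm_of_nonneg hs.le]
      rw [← beamForm_eq_cform, beamForm_smul, hns, ← Complex.normSq_eq_norm_sq,
        Complex.normSq_eq_conj_mul_self]
      simp only [map_mul, map_pow, Complex.conj_ofReal]
      push_cast
      ring), integral_complex_ofReal] at hdiag
  set X := ∫ p, ‖beamForm a p.1 ^ J‖ ^ 2 ∂(surfaceMeasure n) with hX
  have hX0 : 0 ≤ X := integral_nonneg fun p => by positivity
  have hν : ∫ s in Set.Ioi (0 : ℝ), s ^ n * (s ^ (2 * J) * Real.exp (-s ^ 2))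
      = 1 / 2 * Real.Gamma (((J : ℝ) + 1) + ((n - 1 : ℕ) : ℝ) / 2) := by
    have h1 := Gamma_half_shift hn J 0
    rw [add_zero, add_zero] at h1
    rw [← h1, ← integral_pow_mul_exp_neg_sq]
    congr 1
    funext s
    rw [pow_add]; ring
  rw [hν] at hdiag
  have hd : X * (1 / 2 * Real.Gamma (((J : ℝ) + 1) + ((n - 1 : ℕ) : ℝ) / 2)) = J.factorial * T := by
    exact_mod_cast hdiag
  have hG1 := (hGam ((J : ℝ) + 1) (by linarith [(Nat.cast_nonneg J : (0 : ℝ) ≤ J)])).2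
  rw [Real.Gamma_nat_eq_factorial] at hG1
  have hf0 : (0 : ℝ) < J.factorial := by exact_mod_cast J.factorial_pos
  have h2 : J.factorial * T ≤ J.factorial * (X * (1 / 2 * (C₁ * Real.sqrt (J + 1) ^ (n - 1)))) := by
    rw [← hd]
    calc _ ≤ X * (1 / 2 * (C₁ * Real.sqrt (J + 1) ^ (n - 1) * J.factorial)) := by gcongr
      _ = _ := by ring
  have h3 := le_of_mul_le_mul_left h2 hf0
  rw [div_le_iff₀ hC₁]
  linarith

end SphereCrossTerms

/-! ### Lattices of directions -/

section Directions

theorem summable_inv_one_add_abs_sq : Summable fun z : ℤ => ((1 + |(z : ℝ)|) ^ 2)⁻¹ := by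
  have h : Summable fun m : ℕ => (((m : ℝ) + 1) ^ 2)⁻¹ := by
    have := (summable_nat_add_iff 1).mpr (Real.summable_nat_pow_inv.mpr one_lt_two)
    simpa using this
  refine Summable.of_nat_of_neg ?_ ?_
  · refine h.congr fun m => ?_
    simp [add_comm]
  · refine h.congr fun m => ?_
    simp [add_comm]

/-- A box of lattice points, seen from one of them, has bounded total weight `∏ (1 + |Δᵢ|)⁻²`,
uniformly in the size of the box. -/
theorem sum_prod_inv_le (d Q : ℕ) (c : Fin d → Fin Q) :
    ∑ g : Fin d → Fin Q, ∏ i, ((1 + |((c i : ℕ) : ℝ) - ((g i : ℕ) : ℝ)|) ^ 2)⁻¹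
      ≤ (∑' z : ℤ, ((1 + |(z : ℝ)|) ^ 2)⁻¹) ^ d := by
  have h1 : ∑ g : Fin d → Fin Q, ∏ i, ((1 + |((c i : ℕ) : ℝ) - ((g i : ℕ) : ℝ)|) ^ 2)⁻¹
      = ∏ i, ∑ s : Fin Q, ((1 + |((c i : ℕ) : ℝ) - ((s : ℕ) : ℝ)|) ^ 2)⁻¹ := by
    rw [Finset.prod_univ_sum]
    simp
  rw [h1]
  have h2 : ∀ i, ∑ s : Fin Q, ((1 + |((c i : ℕ) : ℝ) - ((s : ℕ) : ℝ)|) ^ 2)⁻¹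
      ≤ ∑' z : ℤ, ((1 + |(z : ℝ)|) ^ 2)⁻¹ := by
    intro i
    have hinj : Function.Injective fun s : Fin Q => ((c i : ℕ) : ℤ) - ((s : ℕ) : ℤ) := by
      intro s s' h
      simp only [sub_right_inj, Nat.cast_inj] at h
      exact Fin.ext h
    calc _ = ∑ z ∈ Finset.univ.map ⟨_, hinj⟩, ((1 + |(z : ℝ)|) ^ 2)⁻¹ := by
          rw [Finset.sum_map]
          simp
      _ ≤ _ := summable_inv_one_add_abs_sq.sum_le_tsum _ fun z _ => by positivity
  calc _ ≤ ∏ _i : Fin d, ∑' z : ℤ, ((1 + |(z : ℝ)|) ^ 2)⁻¹ :=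
        Finset.prod_le_prod (fun i _ => Finset.sum_nonneg fun s _ => by positivity) fun i _ => h2 i
    _ = _ := by simp

/-- Unit vectors close to the first basis vector, with lattice coordinates of spacing `σ` in the
remaining directions, so that sums of rapidly decaying functions of their distances are small when
`σ` is large compared with the scale `ρ⁻¹` of decay. -/
theorem exists_separated_directions (k : ℕ) (hk : 1 ≤ k) {σ τ : ℝ} (hσ : 0 < σ) (hτ : 0 ≤ τ)
    (hτ1 : k * τ ^ 2 ≤ 1) (N : ℕ) (hN : N ≤ (⌊τ / σ⌋₊ + 1) ^ (k - 1)) :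
    ∃ a : Fin N → Fin k → ℝ, (∀ l, ∑ m, a l m ^ 2 = 1) ∧
      (∀ l m, (m.val = 0 → |1 - a l m| ≤ k * τ ^ 2) ∧ (m.val ≠ 0 → |a l m| ≤ τ)) ∧
      ∀ (ρ M : ℝ) (d : Fin N → Fin N → ℝ), 0 ≤ ρ → 1 ≤ M → M ≤ ρ * σ →
        (∀ l l' i, |a l i - a l' i| ≤ d l l') → ∀ l,
        ∑ l' ∈ Finset.univ.erase l, ((1 + ρ * d l l') ^ (2 * (k - 1) + 1))⁻¹
          ≤ M⁻¹ * (∑' z : ℤ, ((1 + |(z : ℝ)|) ^ 2)⁻¹) ^ (k - 1) := by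
  obtain ⟨k, rfl⟩ : ∃ k', k = k' + 1 := ⟨k - 1, by omega⟩
  simp only [Nat.add_sub_cancel] at hN ⊢
  set Q := ⌊τ / σ⌋₊ + 1 with hQ
  obtain ⟨g⟩ : Nonempty (Fin N ↪ (Fin k → Fin Q)) := by
    apply Function.Embedding.nonempty_of_card_le
    simpa using hN
  set b : Fin N → Fin k → ℝ := fun l i => σ * ((g l i : ℕ) : ℝ) with hb
  have hb0 : ∀ l i, 0 ≤ b l i := fun l i => by simp only [hb]; positivity
  have hbτ : ∀ l i, b l i ≤ τ := by
    intro l i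
    have h1 : ((g l i : ℕ) : ℝ) ≤ τ / σ := by
      have h2 : (g l i : ℕ) ≤ ⌊τ / σ⌋₊ := by have := (g l i).isLt; omega
      exact (Nat.cast_le.mpr h2).trans (Nat.floor_le (by positivity))
    rw [le_div_iff₀ hσ] at h1
    simp only [hb]; linarith
  set S : Fin N → ℝ := fun l => ∑ i, b l i ^ 2 with hS
  have hS0 : ∀ l, 0 ≤ S l := fun l => Finset.sum_nonneg fun i _ => sq_nonneg _
  have hSτ : ∀ l, S l ≤ ((k + 1 : ℕ) : ℝ) * τ ^ 2 := by
    intro l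
    calc S l ≤ ∑ _i : Fin k, τ ^ 2 := Finset.sum_le_sum fun i _ => by
          have := hb0 l i
          have := hbτ l i
          gcongr
      _ = k * τ ^ 2 := by simp
      _ ≤ _ := by
        gcongr
        omega
  have hS1 : ∀ l, S l ≤ 1 := fun l => (hSτ l).trans hτ1
  refine ⟨fun l => Fin.cons (Real.sqrt (1 - S l)) (b l), ?_, ?_, ?_⟩
  · intro l
    rw [Fin.sum_univ_succ]
    simp only [Fin.cons_zero, Fin.cons_succ]
    rw [Real.sq_sqrt (by linarith [hS1 l])]
    change 1 - S l + S l = 1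
    ring
  · intro l m
    refine ⟨fun hm => ?_, fun hm => ?_⟩
    · have : m = 0 := Fin.ext hm
      subst this
      simp only [Fin.cons_zero]
      have h1 : Real.sqrt (1 - S l) ≤ 1 := Real.sqrt_le_one.mpr (by linarith [hS0 l])
      have h2 : 1 - S l ≤ Real.sqrt (1 - S l) := by
        apply Real.le_sqrt_of_sq_le
        nlinarith [hS0 l, hS1 l]
      rw [abs_of_nonneg (by linarith)]
      linarith [hSτ l]
    · obtain ⟨i, rfl⟩ := Fin.exists_succ_eq.mpr (fun h : m = 0 => hm (by rw [h]; rfl))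
      simp only [Fin.cons_succ]
      rw [abs_of_nonneg (hb0 l i)]
      exact hbτ l i
  · intro ρ M d hρ hM hMρ hd l
    have hM0 : 0 < M := by linarith
    have hterm : ∀ l' ∈ Finset.univ.erase l, ((1 + ρ * d l l') ^ (2 * k + 1))⁻¹
        ≤ M⁻¹ * ∏ i, ((1 + |((g l i : ℕ) : ℝ) - ((g l' i : ℕ) : ℝ)|) ^ 2)⁻¹ := by
      intro l' hl'
      have hne : l' ≠ l := Finset.ne_of_mem_erase hl'
      have hΔ : ∀ i, M * |((g l i : ℕ) : ℝ) - ((g l' i : ℕ) : ℝ)| ≤ ρ * d l l' := by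
        intro i
        have h1 := hd l l' i.succ
        simp only [Fin.cons_succ, hb] at h1
        rw [← mul_sub, abs_mul, abs_of_pos hσ] at h1
        calc M * |((g l i : ℕ) : ℝ) - ((g l' i : ℕ) : ℝ)|
            ≤ ρ * σ * |((g l i : ℕ) : ℝ) - ((g l' i : ℕ) : ℝ)| := by gcongr
          _ = ρ * (σ * |((g l i : ℕ) : ℝ) - ((g l' i : ℕ) : ℝ)|) := by ring
          _ ≤ _ := by gcongr
      have hgne : g l ≠ g l' := fun h => hne (g.injective h).symm
      obtain ⟨i₀, hi₀⟩ := Function.ne_iff.mp hgne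
      have hint : (1 : ℝ) ≤ |((g l i₀ : ℕ) : ℝ) - ((g l' i₀ : ℕ) : ℝ)| := by
        have h1 : ((g l i₀ : ℕ) : ℤ) - ((g l' i₀ : ℕ) : ℤ) ≠ 0 := by
          intro h
          apply hi₀
          apply Fin.ext
          omega
        have h2 := Int.one_le_abs h1
        exact_mod_cast h2
      have hMx : M ≤ 1 + ρ * d l l' := by
        have := hΔ i₀
        nlinarith
      have hfac : ∀ i, (1 + |((g l i : ℕ) : ℝ) - ((g l' i : ℕ) : ℝ)|) ≤ 1 + ρ * d l l' := by
        intro i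
        have := hΔ i
        nlinarith [abs_nonneg (((g l i : ℕ) : ℝ) - ((g l' i : ℕ) : ℝ))]
      have hprod : ∏ i, (1 + |((g l i : ℕ) : ℝ) - ((g l' i : ℕ) : ℝ)|) ^ 2
          ≤ (1 + ρ * d l l') ^ (2 * k) := by
        calc _ ≤ ∏ _i : Fin k, (1 + ρ * d l l') ^ 2 :=
              Finset.prod_le_prod (fun i _ => by positivity) fun i _ => by
                have := hfac i
                gcongr
          _ = _ := by simp [pow_mul]
      rw [Finset.prod_inv_distrib, ← mul_inv]
      apply inv_anti₀
      · exact mul_pos hM0 (Finset.prod_pos fun i _ => by positivity)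
      · rw [pow_succ, mul_comm]
        have : 0 ≤ ∏ i, (1 + |((g l i : ℕ) : ℝ) - ((g l' i : ℕ) : ℝ)|) ^ 2 :=
          Finset.prod_nonneg fun i _ => by positivity
        exact mul_le_mul hprod hMx hM0.le (this.trans hprod)
    refine (Finset.sum_le_sum hterm).trans ?_
    rw [← Finset.mul_sum]
    gcongr
    refine le_trans ?_ (sum_prod_inv_le k Q (g l))
    calc _ ≤ ∑ l', ∏ i, ((1 + |((g l i : ℕ) : ℝ) - ((g l' i : ℕ) : ℝ)|) ^ 2)⁻¹ :=
          Finset.sum_le_sum_of_subset_of_nonneg (Finset.erase_subset _ _) fun _ _ _ =>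
            Finset.prod_nonneg fun i _ => by positivity
      _ = ∑ q ∈ Finset.univ.map g, ∏ i, ((1 + |((g l i : ℕ) : ℝ) - ((q i : ℕ) : ℝ)|) ^ 2)⁻¹ := by
          rw [Finset.sum_map]
      _ ≤ _ := Finset.sum_le_sum_of_subset_of_nonneg (Finset.subset_univ _) fun _ _ _ =>
            Finset.prod_nonneg fun i _ => by positivity

end Directions

/-! ### Almost orthogonality and polynomial weights -/

section QuadraticForm

variable {n : ℕ}

theorem continuous_beamForm (a : EuclideanSpace ℝ (Fin (n + 1))) : Continuous (beamForm a) :=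
  (contDiff_beamForm a).continuous

theorem integrable_sphere_of_continuous {E : Type*} [NormedAddCommGroup E] {g : UnitSphere n → E}
    (hg : Continuous g) : Integrable g (surfaceMeasure n) := by
  have : IsFiniteMeasure (surfaceMeasure n) := by unfold surfaceMeasure; infer_instance
  have : CompactSpace (UnitSphere n) := Metric.sphere.compactSpace 0 1
  exact hg.integrable_of_hasCompactSupport (HasCompactSupport.of_compactSpace g)

theorem integral_mul_norm_sum_sq {N : ℕ} (q : UnitSphere n → ℝ) (w : Fin N → UnitSphere n → ℂ)
    (hq : Continuous q) (hw : ∀ l, Continuous (w l)) :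
    ((∫ p, q p * ‖∑ l, w l p‖ ^ 2 ∂(surfaceMeasure n) : ℝ) : ℂ)
      = ∑ l, ∑ l', ∫ p, w l p * (starRingEnd ℂ) (w l' p) * (q p : ℂ) ∂(surfaceMeasure n) := by
  rw [← integral_complex_ofReal]
  have hint : ∀ l l', Integrable (fun p => w l p * (starRingEnd ℂ) (w l' p) * (q p : ℂ))
      (surfaceMeasure n) := fun l l' => integrable_sphere_of_continuous
        (((hw l).mul (Complex.continuous_conj.comp (hw l'))).mul
          (Complex.continuous_ofReal.comp hq))
  have h1 : ∀ l, ∑ l', ∫ p, w l p * (starRingEnd ℂ) (w l' p) * (q p : ℂ) ∂(surfaceMeasure n)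
      = ∫ p, ∑ l', w l p * (starRingEnd ℂ) (w l' p) * (q p : ℂ) ∂(surfaceMeasure n) :=
    fun l => (integral_finsetSum _ fun l' _ => hint l l').symm
  simp_rw [h1]
  rw [← integral_finsetSum _ fun l _ => integrable_finsetSum _ fun l' _ => hint l l']
  refine integral_congr_ae (Filter.Eventually.of_forall fun p => ?_)
  simp only
  rw [← Complex.normSq_eq_norm_sq]
  push_cast
  rw [← Complex.mul_conj, map_sum, Finset.sum_mul_sum, Finset.mul_sum]
  refine Finset.sum_congr rfl fun l _ => ?_
  rw [Finset.mul_sum]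
  exact Finset.sum_congr rfl fun l' _ => by ring

/-- Almost orthogonality, upper bound: the squared norm of a sum of beams, possibly weighted with a
monomial that vanishes on all the great circles, is at most of the order of the number of beams
times the squared norm of one of them. -/
theorem exists_integral_norm_sum_beams_le (hn : 1 ≤ n) (u : EuclideanSpace ℝ (Fin (n + 1)))
    (m r : ℕ) (A : ℕ → ℝ) (κ : ℝ) : ∃ C : ℝ, 0 ≤ C ∧
    ∀ (N : ℕ) (a : Fin N → EuclideanSpace ℝ (Fin (n + 1))), (∀ l, ‖a l‖ = 1) → (∀ l, a l 0 = 0) →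
    (m = 0 ∨ (u 0 = 0 ∧ ∀ l, ⟪u, a l⟫_ℝ = 0)) →
    ∀ (J : ℕ) (h c : ℝ) (f : Fin N → UnitSphere n → ℂ), 0 < h → h⁻¹ ≤ κ * (J + 1) →
    (∀ l, AdmissibleWeight h c A (f l)) →
    ∀ η : ℝ, (∀ l, ∑ l' ∈ Finset.univ.erase l,
      ((1 + Real.sqrt (J + 1) * ‖a l - a l'‖) ^ r)⁻¹ ≤ η) →
    (∫ p, ⟪u, p.1⟫_ℝ ^ m * ‖∑ l, beamForm (a l) p.1 ^ J * f l p‖ ^ 2 ∂(surfaceMeasure n))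
      * Real.sqrt (J + 1) ^ (n - 1 + m) ≤ C * N * (1 + η) := by
  obtain ⟨C, hC, hmain⟩ := exists_sphere_cross_term_bound hn u m r A κ
  refine ⟨C, hC, ?_⟩
  intro N a ha ha0 hu J h c f hh hκ hf η hη
  set R := Real.sqrt (J + 1) with hR
  have hR0 : 0 < R := by positivity
  have hcont : ∀ l, Continuous fun p : UnitSphere n => beamForm (a l) p.1 ^ J * f l p := fun l =>
    (((continuous_beamForm (a l)).comp continuous_subtype_val).pow J).mul (hf l).smooth.continuous
  have hexp := integral_mul_norm_sum_sq (n := n) (fun p => ⟪u, p.1⟫_ℝ ^ m) _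
    ((continuous_const.inner continuous_subtype_val).pow m) hcont
  set T : Fin N → Fin N → ℂ := fun l l' => ∫ p, beamForm (a l) p.1 ^ J * f l p *
    (starRingEnd ℂ) (beamForm (a l') p.1 ^ J * f l' p) * ((⟪u, p.1⟫_ℝ ^ m : ℝ) : ℂ)
      ∂(surfaceMeasure n) with hT
  have hTb : ∀ l l', ‖T l l'‖ * R ^ (n - 1 + m) ≤ C * ((1 + R * ‖a l - a l'‖) ^ r)⁻¹ := by
    intro l l'
    have h1 := hmain (a l) (a l') (ha l) (ha l') (ha0 l) (ha0 l')
      (hu.imp id fun h => ⟨h.1, h.2 l, h.2 l'⟩) J h c (f l) (f l') hh hκ (hf l) (hf l')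
    have h2 : T l l' = ∫ p, beamForm (a l) p.1 ^ J * (starRingEnd ℂ) (beamForm (a l') p.1 ^ J) *
        (((⟪u, p.1⟫_ℝ ^ m : ℝ) : ℂ) * (f l p * (starRingEnd ℂ) (f l' p))) ∂(surfaceMeasure n) := by
      refine integral_congr_ae (Filter.Eventually.of_forall fun p => ?_)
      simp only [map_mul]; ring
    rw [h2, ← div_eq_mul_inv, le_div_iff₀ (by positivity)]
    calc _ = _ := by ring
      _ ≤ _ := h1
  set Q := ∫ p, ⟪u, p.1⟫_ℝ ^ m * ‖∑ l, beamForm (a l) p.1 ^ J * f l p‖ ^ 2 ∂(surfaceMeasure n)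
  have hQ : Q ≤ ∑ l, ∑ l', ‖T l l'‖ := by
    calc Q ≤ ‖(Q : ℂ)‖ := by rw [Complex.norm_real]; exact le_abs_self _
      _ = ‖∑ l, ∑ l', T l l'‖ := by rw [hexp]
      _ ≤ ∑ l, ∑ l', ‖T l l'‖ := (norm_sum_le _ _).trans
          (Finset.sum_le_sum fun l _ => norm_sum_le _ _)
  calc Q * R ^ (n - 1 + m) ≤ (∑ l, ∑ l', ‖T l l'‖) * R ^ (n - 1 + m) := by gcongr
    _ = ∑ l, ∑ l', ‖T l l'‖ * R ^ (n - 1 + m) := by simp_rw [Finset.sum_mul]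
    _ ≤ ∑ l, ∑ l', C * ((1 + R * ‖a l - a l'‖) ^ r)⁻¹ :=
        Finset.sum_le_sum fun l _ => Finset.sum_le_sum fun l' _ => hTb l l'
    _ ≤ ∑ _l : Fin N, C * (1 + η) := by
        refine Finset.sum_le_sum fun l _ => ?_
        rw [← Finset.mul_sum, ← Finset.add_sum_erase _ _ (Finset.mem_univ l)]
        gcongr
        · simp
        · exact hη l
    _ = C * N * (1 + η) := by simp; ring

/-- Almost orthogonality, lower bound: if the beams are well separated, the squared norm of their
sum is at least of the order of the number of beams times the squared norm of one of them. -/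
theorem exists_le_integral_norm_sum_beams (hn : 1 ≤ n) (r : ℕ) (A : ℕ → ℝ) (κ : ℝ) {c : ℝ}
    (hc : 0 < c) : ∃ c₀ C : ℝ, 0 < c₀ ∧ 0 ≤ C ∧
    ∀ (N : ℕ) (a : Fin N → EuclideanSpace ℝ (Fin (n + 1))), (∀ l, ‖a l‖ = 1) → (∀ l, a l 0 = 0) →
    ∀ (J : ℕ) (h : ℝ) (f : Fin N → UnitSphere n → ℂ), 0 < h → h⁻¹ ≤ κ * (J + 1) →
    (∀ l, AdmissibleWeight h c A (f l)) →
    ∀ η : ℝ, (∀ l, ∑ l' ∈ Finset.univ.erase l,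
      ((1 + Real.sqrt (J + 1) * ‖a l - a l'‖) ^ r)⁻¹ ≤ η) →
    N * (c₀ - C * η) ≤ (∫ p, ‖∑ l, beamForm (a l) p.1 ^ J * f l p‖ ^ 2 ∂(surfaceMeasure n))
      * Real.sqrt (J + 1) ^ (n - 1) := by
  obtain ⟨C, hC, hmain⟩ := exists_sphere_cross_term_bound hn (0 : EuclideanSpace ℝ (Fin (n + 1)))
    0 r A κ
  obtain ⟨c₁, hc₁, hdiag⟩ := exists_le_integral_norm_beamForm_pow hn
  refine ⟨c ^ 2 * c₁, C, by positivity, hC, ?_⟩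
  intro N a ha ha0 J h f hh hκ hf η hη
  set R := Real.sqrt (J + 1) with hR
  have hR0 : 0 < R := by positivity
  have hbc : ∀ l, Continuous fun p : UnitSphere n => beamForm (a l) p.1 ^ J := fun l =>
    ((continuous_beamForm (a l)).comp continuous_subtype_val).pow J
  have hcont : ∀ l, Continuous fun p : UnitSphere n => beamForm (a l) p.1 ^ J * f l p := fun l =>
    (hbc l).mul (hf l).smooth.continuous
  have hexp := integral_mul_norm_sum_sq (n := n) (fun _ => 1) _ continuous_const hcont
  set T : Fin N → Fin N → ℂ := fun l l' => ∫ p, beamForm (a l) p.1 ^ J * f l p *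
    (starRingEnd ℂ) (beamForm (a l') p.1 ^ J * f l' p) * ((1 : ℝ) : ℂ)
      ∂(surfaceMeasure n) with hT
  have hTb : ∀ l l', ‖T l l'‖ * R ^ (n - 1) ≤ C * ((1 + R * ‖a l - a l'‖) ^ r)⁻¹ := by
    intro l l'
    have h1 := hmain (a l) (a l') (ha l) (ha l') (ha0 l) (ha0 l')
      (Or.inl rfl) J h c (f l) (f l') hh hκ (hf l) (hf l')
    have h2 : T l l' = ∫ p, beamForm (a l) p.1 ^ J * (starRingEnd ℂ) (beamForm (a l') p.1 ^ J) *
        (((⟪(0 : EuclideanSpace ℝ (Fin (n + 1))), p.1⟫_ℝ ^ 0 : ℝ) : ℂ) *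
          (f l p * (starRingEnd ℂ) (f l' p))) ∂(surfaceMeasure n) := by
      refine integral_congr_ae (Filter.Eventually.of_forall fun p => ?_)
      simp only [map_mul, pow_zero]; ring
    rw [h2, ← div_eq_mul_inv, le_div_iff₀ (by positivity)]
    calc _ = _ := by ring
      _ ≤ _ := h1
  have hTd : ∀ l, c ^ 2 * c₁ ≤ (T l l).re * R ^ (n - 1) := by
    intro l
    have e1 : T l l = ((∫ p, ‖beamForm (a l) p.1 ^ J * f l p‖ ^ 2 ∂(surfaceMeasure n) : ℝ) : ℂ) := by
      rw [← integral_complex_ofReal]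
      refine integral_congr_ae (Filter.Eventually.of_forall fun p => ?_)
      simp only
      rw [← Complex.normSq_eq_norm_sq, Complex.mul_conj]
      simp
    rw [e1, Complex.ofReal_re]
    have h1 := hdiag (a l) (ha l) (ha0 l) J
    have h2 : c ^ 2 * ∫ p, ‖beamForm (a l) p.1 ^ J‖ ^ 2 ∂(surfaceMeasure n)
        ≤ ∫ p, ‖beamForm (a l) p.1 ^ J * f l p‖ ^ 2 ∂(surfaceMeasure n) := by
      rw [← integral_const_mul]
      refine integral_mono
        (integrable_sphere_of_continuous (continuous_const.mul ((hbc l).norm.pow 2)))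
        (integrable_sphere_of_continuous ((hcont l).norm.pow 2)) fun p => ?_
      simp only
      rw [norm_mul, mul_pow, mul_comm]
      have := ((hf l).lower p).le
      gcongr
    calc c ^ 2 * c₁ ≤ c ^ 2 * ((∫ p, ‖beamForm (a l) p.1 ^ J‖ ^ 2 ∂(surfaceMeasure n))
          * R ^ (n - 1)) := by gcongr
      _ = (c ^ 2 * ∫ p, ‖beamForm (a l) p.1 ^ J‖ ^ 2 ∂(surfaceMeasure n)) * R ^ (n - 1) := by ring
      _ ≤ _ := by gcongr
  simp only [one_mul] at hexp
  set Q := ∫ p, ‖∑ l, beamForm (a l) p.1 ^ J * f l p‖ ^ 2 ∂(surfaceMeasure n)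
  have hQ : Q = ∑ l, ∑ l', (T l l').re := by
    have h1 := congrArg Complex.re hexp
    rw [Complex.ofReal_re] at h1
    rw [h1]
    simp only [Complex.re_sum]
    rfl
  rw [hQ, Finset.sum_mul]
  have hrow : ∀ l, c ^ 2 * c₁ - C * η ≤ (∑ l', (T l l').re) * R ^ (n - 1) := by
    intro l
    rw [← Finset.add_sum_erase _ _ (Finset.mem_univ l), add_mul, Finset.sum_mul]
    have h1 := hTd l
    have h2 : -(C * η) ≤ ∑ l' ∈ Finset.univ.erase l, (T l l').re * R ^ (n - 1) := by
      have h3 : ∑ l' ∈ Finset.univ.erase l, -(C * ((1 + R * ‖a l - a l'‖) ^ r)⁻¹)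
          ≤ ∑ l' ∈ Finset.univ.erase l, (T l l').re * R ^ (n - 1) := by
        refine Finset.sum_le_sum fun l' _ => ?_
        have h4 := hTb l l'
        have h5 := (abs_le.mp (Complex.abs_re_le_norm (T l l'))).1
        have h6 : -‖T l l'‖ * R ^ (n - 1) ≤ (T l l').re * R ^ (n - 1) := by gcongr
        linarith
      rw [Finset.sum_neg_distrib, ← Finset.mul_sum] at h3
      have h7 : C * ∑ l' ∈ Finset.univ.erase l, ((1 + R * ‖a l - a l'‖) ^ r)⁻¹ ≤ C * η := by
        gcongr
        exact hη l
      linarith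
    linarith
  calc (N : ℝ) * (c ^ 2 * c₁ - C * η) = ∑ _l : Fin N, (c ^ 2 * c₁ - C * η) := by
        rw [Finset.sum_const, Finset.card_univ, Fintype.card_fin, nsmul_eq_mul]
    _ ≤ _ := Finset.sum_le_sum fun l _ => hrow l

end QuadraticForm

section Norms

variable {n : ℕ}

theorem sphereL2Norm_eq_ofReal_sqrt {v : UnitSphere n → ℂ} (hv : Continuous v) :
    sphereL2Norm v = ENNReal.ofReal (Real.sqrt (∫ p, ‖v p‖ ^ 2 ∂(surfaceMeasure n))) := by
  have : IsFiniteMeasure (surfaceMeasure n) := by unfold surfaceMeasure; infer_instance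
  have : CompactSpace (UnitSphere n) := Metric.sphere.compactSpace 0 1
  have hm : MemLp v 2 (surfaceMeasure n) :=
    hv.memLp_of_hasCompactSupport (HasCompactSupport.of_compactSpace v)
  rw [sphereL2Norm, hm.eLpNorm_eq_integral_rpow_norm (by norm_num) (by norm_num)]
  congr 1
  rw [Real.sqrt_eq_rpow]
  norm_num

theorem one_add_sum_pow_le {ι : Type*} (s : Finset ι) (y : ι → ℝ) (hy : ∀ i ∈ s, 0 ≤ y i) (m : ℕ) :
    (1 + ∑ i ∈ s, y i) ^ m ≤ ((s.card : ℝ) + 1) ^ m * (1 + ∑ i ∈ s, y i ^ m) := by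
  have hs0 : 0 ≤ ∑ i ∈ s, y i := Finset.sum_nonneg hy
  have hsm : 0 ≤ ∑ i ∈ s, y i ^ m := Finset.sum_nonneg fun i hi => pow_nonneg (hy i hi) m
  by_cases h : ∀ i ∈ s, y i ≤ 1
  · have h1 : ∑ i ∈ s, y i ≤ s.card := by
      simpa using Finset.sum_le_card_nsmul s y 1 h
    calc (1 + ∑ i ∈ s, y i) ^ m ≤ ((s.card : ℝ) + 1) ^ m * 1 := by
          rw [mul_one]
          exact pow_le_pow_left₀ (by linarith) (by linarith) m
      _ ≤ _ := by gcongr; linarith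
  · push Not at h
    obtain ⟨i₁, hi₁, hy₁⟩ := h
    obtain ⟨i₀, hi₀, hmax⟩ := Finset.exists_max_image s y ⟨i₁, hi₁⟩
    have h1 : 1 ≤ y i₀ := hy₁.le.trans (hmax i₁ hi₁)
    have h2 : ∑ i ∈ s, y i ≤ s.card * y i₀ := by
      simpa using Finset.sum_le_card_nsmul s y (y i₀) hmax
    calc (1 + ∑ i ∈ s, y i) ^ m ≤ (((s.card : ℝ) + 1) * y i₀) ^ m :=
          pow_le_pow_left₀ (by linarith) (by linarith) m
      _ = ((s.card : ℝ) + 1) ^ m * y i₀ ^ m := mul_pow _ _ _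
      _ ≤ _ := by
        gcongr
        have := Finset.single_le_sum (f := fun i => y i ^ m)
          (fun i hi => pow_nonneg (hy i hi) m) hi₀
        linarith

theorem one_le_polyWeight_base (k : ℕ) {t : ℝ} (ht : 0 ≤ t) (p : UnitSphere n) :
    1 ≤ 1 + t * ∑ i : Fin (n + 1) with k < i.val, p.1 i ^ 2 := by
  have : 0 ≤ t * ∑ i : Fin (n + 1) with k < i.val, p.1 i ^ 2 :=
    mul_nonneg ht (Finset.sum_nonneg fun i _ => sq_nonneg _)
  linarith

theorem continuous_polyWeight (k : ℕ) {t : ℝ} (ht : 0 ≤ t) (β : ℝ) :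
    Continuous fun p : UnitSphere n => polyWeight k t β p := by
  unfold polyWeight
  refine Continuous.rpow_const ?_ fun p => Or.inl ?_
  · have : ∀ i, Continuous fun p : UnitSphere n => p.1 i := fun i => by fun_prop
    fun_prop
  · linarith [one_le_polyWeight_base k ht p]

theorem polyWeight_mul_polyWeight_neg (k : ℕ) {t : ℝ} (ht : 0 ≤ t) (β : ℝ) (p : UnitSphere n) :
    polyWeight k t β p * polyWeight k t (-β) p = 1 := by
  have h := one_le_polyWeight_base k ht p
  rw [polyWeight, polyWeight, ← Real.rpow_add (by linarith)]
  simp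

theorem polyWeight_sq_le (k : ℕ) {t s : ℝ} (ht : 0 ≤ t) (hts : t ≤ s) {β : ℝ} {B : ℕ} (hβ : β ≤ B)
    (p : UnitSphere n) : polyWeight k t β p ^ 2 ≤ ((n : ℝ) + 2) ^ (2 * B) *
      (1 + ∑ i : Fin (n + 1) with k < i.val, s ^ (2 * B) * p.1 i ^ (4 * B)) := by
  have h := one_le_polyWeight_base k ht p
  have hs0 : 0 ≤ s := ht.trans hts
  have h1 : polyWeight k t β p ≤ (1 + ∑ i : Fin (n + 1) with k < i.val, s * p.1 i ^ 2) ^ B := by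
    rw [polyWeight, ← Real.rpow_natCast _ B]
    refine (Real.rpow_le_rpow_of_exponent_le h hβ).trans ?_
    refine Real.rpow_le_rpow (by linarith) ?_ (by positivity)
    rw [← Finset.mul_sum]
    gcongr
  have h0 : 0 ≤ polyWeight k t β p := Real.rpow_nonneg (by linarith) _
  calc polyWeight k t β p ^ 2
      ≤ ((1 + ∑ i : Fin (n + 1) with k < i.val, s * p.1 i ^ 2) ^ B) ^ 2 := by gcongr
    _ = (1 + ∑ i : Fin (n + 1) with k < i.val, s * p.1 i ^ 2) ^ (2 * B) := by
        rw [← pow_mul, mul_comm]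
    _ ≤ _ := one_add_sum_pow_le _ _ (fun i _ => by positivity) _
    _ ≤ _ := by
        have hcard : ((Finset.univ.filter fun i : Fin (n + 1) => k < i.val).card : ℝ) ≤ n + 1 := by
          have := Finset.card_le_univ (Finset.univ.filter fun i : Fin (n + 1) => k < i.val)
          rw [Fintype.card_fin] at this
          exact_mod_cast this
        have he : ∀ i, (s * p.1 i ^ 2) ^ (2 * B) = s ^ (2 * B) * p.1 i ^ (4 * B) := fun i => by
          rw [mul_pow, ← pow_mul]
          congr 2
          ring
        simp_rw [he]
        have hpos : 0 ≤ 1 + ∑ i : Fin (n + 1) with k < i.val, s ^ (2 * B) * p.1 i ^ (4 * B) := by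
          have : 0 ≤ ∑ i : Fin (n + 1) with k < i.val, s ^ (2 * B) * p.1 i ^ (4 * B) :=
            Finset.sum_nonneg fun i _ => mul_nonneg (by positivity)
              (Even.pow_nonneg ⟨2 * B, by ring⟩ _)
          linarith
        exact mul_le_mul_of_nonneg_right
          (pow_le_pow_left₀ (by positivity) (by linarith) _) hpos

end Norms

/-! ### Two-sided bounds for the normalized sums -/

section Scales

variable {n j : ℕ}

theorem semiclassicalH_inv (n j : ℕ) :
    (semiclassicalH n j)⁻¹ = Real.sqrt ((j : ℝ) * ((j : ℝ) + (n : ℝ) - 1)) := by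
  rw [semiclassicalH, inv_inv]

theorem le_semiclassicalH_inv (hn : 1 ≤ n) : (j : ℝ) ≤ (semiclassicalH n j)⁻¹ := by
  have h1 : (1 : ℝ) ≤ n := by exact_mod_cast hn
  have h2 : (0 : ℝ) ≤ j := Nat.cast_nonneg j
  rw [semiclassicalH_inv]
  apply Real.le_sqrt_of_sq_le
  nlinarith

theorem semiclassicalH_inv_le (hn : 1 ≤ n) (hj : 1 ≤ j) :
    (semiclassicalH n j)⁻¹ ≤ n * j := by
  have h1 : (1 : ℝ) ≤ n := by exact_mod_cast hn
  have h2 : (1 : ℝ) ≤ j := by exact_mod_cast hj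
  rw [semiclassicalH_inv]
  apply Real.sqrt_le_iff.mpr ⟨by positivity, ?_⟩
  have h3 : (j : ℝ) + n - 1 ≤ n * j := by nlinarith
  have h4 : (j : ℝ) ≤ n * j := by nlinarith
  calc (j : ℝ) * (j + n - 1) ≤ (n * j) * (n * j) := by
        apply mul_le_mul h4 h3 <;> nlinarith
    _ = _ := by ring

theorem semiclassicalH_pos (hn : 1 ≤ n) (hj : 1 ≤ j) : 0 < semiclassicalH n j := by
  have h2 : (1 : ℝ) ≤ j := by exact_mod_cast hj
  exact inv_pos.mp (by linarith [le_semiclassicalH_inv (j := j) hn])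

theorem semiclassicalH_le_one (hn : 1 ≤ n) (hj : 1 ≤ j) : semiclassicalH n j ≤ 1 := by
  have h2 : (1 : ℝ) ≤ j := by exact_mod_cast hj
  exact (one_le_inv₀ (semiclassicalH_pos hn hj)).mp (h2.trans (le_semiclassicalH_inv hn))

/-- The powers `J` allowed in the sums are comparable to `h⁻¹`. -/
theorem semiclassicalH_inv_comparable (hn : 1 ≤ n) (hj : 1 ≤ j) {J : ℕ} {K : ℝ}
    (hJ : |(J : ℝ) - j| ≤ K) :
    (semiclassicalH n j)⁻¹ ≤ n * (|K| + 2) * (J + 1) ∧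
      (J : ℝ) + 1 ≤ n * (|K| + 2) * (semiclassicalH n j)⁻¹ := by
  have h1 : (1 : ℝ) ≤ n := by exact_mod_cast hn
  have h2 : (1 : ℝ) ≤ j := by exact_mod_cast hj
  have h3 : (0 : ℝ) ≤ J := Nat.cast_nonneg J
  have hK := hJ.trans (le_abs_self K)
  have hK0 := abs_nonneg K
  obtain ⟨h4, h5⟩ := abs_le.mp hK
  have h6 := le_semiclassicalH_inv (j := j) hn
  constructor
  · calc (semiclassicalH n j)⁻¹ ≤ n * j := semiclassicalH_inv_le hn hj
      _ ≤ n * ((|K| + 2) * (J + 1)) := by gcongr; nlinarith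
      _ = _ := by ring
  · calc (J : ℝ) + 1 ≤ 1 * (|K| + 2) * j := by nlinarith
      _ ≤ _ := by gcongr

/-- The square of the normalizing factor of the sums, with the reciprocal of the number of beams
singled out. -/
theorem norm_sq_harmonicSum {k : ℕ} (hk : k ≤ n) (hn : 1 ≤ n) (hj : 1 ≤ j) (α : ℝ) {N : ℕ}
    (a : Fin N → Fin k → ℝ) (J : ℕ) (f : Fin N → UnitSphere n → ℂ) (x : UnitSphere n) :
    ‖harmonicSum hk α j a J f x‖ ^ 2 = Real.sqrt (semiclassicalH n j)⁻¹ ^ (n - 1) *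
      (semiclassicalH n j ^ ((α - 1 / 2) * ((k : ℝ) - 1)))⁻¹ *
        ‖∑ l, beamForm (coeffVec hk (a l)) x.1 ^ J * f l x‖ ^ 2 := by
  have hh := semiclassicalH_pos hn hj
  rw [harmonicSum_eq, norm_mul, mul_pow, Complex.norm_real, Real.norm_of_nonneg (by positivity)]
  congr 1
  rw [← Real.rpow_natCast _ 2, ← Real.rpow_mul hh.le, ← Real.rpow_natCast _ (n - 1),
    Real.sqrt_eq_rpow, ← Real.rpow_mul (by positivity), Real.inv_rpow hh.le, ← Real.rpow_neg hh.le,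
    ← Real.rpow_neg hh.le, ← Real.rpow_add hh]
  congr 1
  push_cast [Nat.cast_sub hn]
  ring

end Scales

section TwoSidedBounds

variable {n k : ℕ}

theorem continuous_harmonicSum (hk : k ≤ n) (α : ℝ) (j : ℕ) {N : ℕ} (a : Fin N → Fin k → ℝ) (J : ℕ)
    {f : Fin N → UnitSphere n → ℂ} (hf : ∀ l, Continuous (f l)) :
    Continuous (harmonicSum hk α j a J f) := by
  have h : harmonicSum hk α j a J f = fun x => _ := funext fun x => harmonicSum_eq hk α j a J f x
  rw [h]
  refine continuous_const.mul (continuous_finsetSum _ fun l _ => ?_)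
  exact (((continuous_beamForm _).comp continuous_subtype_val).pow J).mul (hf l)

/-- Upper bound for the weighted norms. The weight with a nonnegative exponent is dominated by even
powers of the coordinates that vanish on all the great circles, each of which is of size `h ^ (1/2)`
on the beams. -/
theorem exists_integral_polyWeight_mul_harmonicSum_le (hk1 : 1 ≤ k) (hk : k ≤ n) (α : ℝ)
    {δ : ℝ} (hδ : 0 ≤ δ) (K c : ℝ) (A : ℕ → ℝ) (r : ℕ) {η : ℝ} (hη0 : 0 ≤ η) (B : ℕ) :
    ∃ U : ℝ, 0 < U ∧ ∀ (j : ℕ), 1 ≤ j → ∀ (N : ℕ),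
    (N : ℝ) ≤ (δ + 1) * semiclassicalH n j ^ ((α - 1 / 2) * ((k : ℝ) - 1)) →
    ∀ a : Fin N → Fin k → ℝ, (∀ l, ∑ m, a l m ^ 2 = 1) →
    ∀ J : ℕ, |(J : ℝ) - j| ≤ K →
    (∀ l, ∑ l' ∈ Finset.univ.erase l,
      ((1 + Real.sqrt (J + 1) * ‖coeffVec hk (a l) - coeffVec hk (a l')‖) ^ r)⁻¹ ≤ η) →
    ∀ f : Fin N → UnitSphere n → ℂ, (∀ l, AdmissibleWeight (semiclassicalH n j) c A (f l)) →
    ∀ t : ℝ, 0 ≤ t → t ≤ (semiclassicalH n j)⁻¹ → ∀ β : ℝ, β ≤ B →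
    ∫ p, polyWeight k t β p ^ 2 * ‖harmonicSum hk α j a J f p‖ ^ 2 ∂(surfaceMeasure n) ≤ U := by
  have hn : 1 ≤ n := hk1.trans hk
  set κ : ℝ := n * (|K| + 2) with hκ
  obtain ⟨C, hC, hmain⟩ := exists_integral_norm_sum_beams_le hn
    (0 : EuclideanSpace ℝ (Fin (n + 1))) 0 r A κ
  choose C' hC' hmain' using fun i : Fin (n + 1) => exists_integral_norm_sum_beams_le hn
    (EuclideanSpace.single i (1 : ℝ)) (4 * B) r A κ
  set s := Real.sqrt κ with hs
  have hs0 : 0 ≤ s := Real.sqrt_nonneg _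
  have hC'0 : 0 ≤ ∑ i : Fin (n + 1) with k < i.val, s ^ (n - 1 + 4 * B) * C' i :=
    Finset.sum_nonneg fun i _ => mul_nonneg (by positivity) (hC' i)
  refine ⟨((n : ℝ) + 2) ^ (2 * B) * ((s ^ (n - 1) * C +
    ∑ i : Fin (n + 1) with k < i.val, s ^ (n - 1 + 4 * B) * C' i) * ((δ + 1) * (1 + η))) + 1,
    by positivity, ?_⟩
  intro j hj N hN a ha J hJ hη f hf t ht hts β hβ
  set h := semiclassicalH n j with hh_def
  have hh : 0 < h := semiclassicalH_pos hn hj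
  obtain ⟨hκ1, -⟩ := semiclassicalH_inv_comparable hn hj hJ
  set X := h ^ ((α - 1 / 2) * ((k : ℝ) - 1)) with hX_def
  have hX : 0 < X := Real.rpow_pos_of_pos hh _
  set R := Real.sqrt (J + 1) with hR
  have hR0 : 0 < R := by positivity
  set y := Real.sqrt h⁻¹ with hy
  have hy0 : 0 < y := Real.sqrt_pos.mpr (inv_pos.mpr hh)
  have hysq : y ^ 2 = h⁻¹ := Real.sq_sqrt (inv_pos.mpr hh).le
  have hysR : y ≤ s * R := by
    rw [hy, hs, hR, ← Real.sqrt_mul (by positivity)]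
    exact Real.sqrt_le_sqrt hκ1
  set b : Fin N → EuclideanSpace ℝ (Fin (n + 1)) := fun l => coeffVec hk (a l) with hb
  have hb1 : ∀ l, ‖b l‖ = 1 := fun l => by
    have := norm_sq_coeffVec hk (a l)
    rw [ha l] at this
    exact (pow_eq_one_iff_of_nonneg (norm_nonneg _) two_ne_zero).mp this
  have hb0 : ∀ l, b l 0 = 0 := fun l => coeffVec_apply_zero hk (a l)
  set S : UnitSphere n → ℂ := fun p => ∑ l, beamForm (b l) p.1 ^ J * f l p with hS
  have hSc : Continuous S := continuous_finsetSum _ fun l _ =>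
    (((continuous_beamForm _).comp continuous_subtype_val).pow J).mul (hf l).smooth.continuous
  have hpc : ∀ i : Fin (n + 1), Continuous fun p : UnitSphere n => p.1 i := fun i => by fun_prop
  have hvc := continuous_harmonicSum hk α j a J fun l => (hf l).smooth.continuous
  have hI0 : y ^ (n - 1) * ∫ p, ‖S p‖ ^ 2 ∂(surfaceMeasure n)
      ≤ s ^ (n - 1) * C * (N * (1 + η)) := by
    have h1 := hmain N b hb1 hb0 (Or.inl rfl) J h c f hh hκ1 hf η hη
    simp only [pow_zero, one_mul, add_zero] at h1
    have h0 : 0 ≤ ∫ p, ‖S p‖ ^ 2 ∂(surfaceMeasure n) := integral_nonneg fun p => sq_nonneg _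
    calc y ^ (n - 1) * ∫ p, ‖S p‖ ^ 2 ∂(surfaceMeasure n)
        ≤ (s * R) ^ (n - 1) * ∫ p, ‖S p‖ ^ 2 ∂(surfaceMeasure n) := by gcongr
      _ = s ^ (n - 1) * ((∫ p, ‖S p‖ ^ 2 ∂(surfaceMeasure n)) * R ^ (n - 1)) := by
          rw [mul_pow]; ring
      _ ≤ s ^ (n - 1) * (C * N * (1 + η)) := by gcongr
      _ = _ := by ring
  have hI : ∀ i : Fin (n + 1), k < i.val →
      y ^ (n - 1) * ∫ p, (h⁻¹ ^ (2 * B) * p.1 i ^ (4 * B)) * ‖S p‖ ^ 2 ∂(surfaceMeasure n)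
      ≤ s ^ (n - 1 + 4 * B) * C' i * (N * (1 + η)) := by
    intro i hi
    have h1 := hmain' i N b hb1 hb0 (Or.inr ⟨?_, fun l => ?_⟩) J h c f hh hκ1 hf η hη
    · simp only [EuclideanSpace.inner_single_left, map_one, one_mul] at h1
      have h0 : 0 ≤ ∫ p, p.1 i ^ (4 * B) * ‖S p‖ ^ 2 ∂(surfaceMeasure n) :=
        integral_nonneg fun p => mul_nonneg (Even.pow_nonneg ⟨2 * B, by ring⟩ _) (sq_nonneg _)
      simp_rw [mul_assoc (h⁻¹ ^ (2 * B))]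
      rw [integral_const_mul, ← hysq, ← pow_mul, ← mul_assoc, ← pow_add,
        show n - 1 + 2 * (2 * B) = n - 1 + 4 * B by ring]
      calc y ^ (n - 1 + 4 * B) * ∫ p, p.1 i ^ (4 * B) * ‖S p‖ ^ 2 ∂(surfaceMeasure n)
          ≤ (s * R) ^ (n - 1 + 4 * B) *
              ∫ p, p.1 i ^ (4 * B) * ‖S p‖ ^ 2 ∂(surfaceMeasure n) := by gcongr
        _ = s ^ (n - 1 + 4 * B) * ((∫ p, p.1 i ^ (4 * B) * ‖S p‖ ^ 2 ∂(surfaceMeasure n))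
              * R ^ (n - 1 + 4 * B)) := by rw [mul_pow]; ring
        _ ≤ s ^ (n - 1 + 4 * B) * (C' i * N * (1 + η)) := by gcongr
        _ = _ := by ring
    · have : (0 : Fin (n + 1)) ≠ i := fun h0 => by simp [← h0] at hi
      simp [this]
    · simp [EuclideanSpace.inner_single_left, hb, coeffVec_apply_of_lt hk (a l) hi]
  have hint : ∀ i : Fin (n + 1), Integrable
      (fun p => (h⁻¹ ^ (2 * B) * p.1 i ^ (4 * B)) * ‖S p‖ ^ 2) (surfaceMeasure n) := fun i =>
    integrable_sphere_of_continuous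
      ((continuous_const.mul ((hpc i).pow _)).mul (hSc.norm.pow 2))
  have hint0 : Integrable (fun p => ‖S p‖ ^ 2) (surfaceMeasure n) :=
    integrable_sphere_of_continuous (hSc.norm.pow 2)
  set W := ((n : ℝ) + 2) ^ (2 * B) with hW
  have hW0 : 0 ≤ W := by positivity
  have hle : ∫ p, polyWeight k t β p ^ 2 * ‖harmonicSum hk α j a J f p‖ ^ 2 ∂(surfaceMeasure n)
      ≤ ∫ p, (W * (y ^ (n - 1) * X⁻¹)) * (‖S p‖ ^ 2 + ∑ i : Fin (n + 1) with k < i.val,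
          (h⁻¹ ^ (2 * B) * p.1 i ^ (4 * B)) * ‖S p‖ ^ 2) ∂(surfaceMeasure n) := by
    refine integral_mono (integrable_sphere_of_continuous
      (((continuous_polyWeight k ht β).pow 2).mul (hvc.norm.pow 2)))
      ((hint0.add (integrable_finsetSum _ fun i _ => hint i)).const_mul _) fun p => ?_
    have h1 := polyWeight_sq_le k ht hts hβ p
    have h2 := norm_sq_harmonicSum hk hn hj α a J f p
    simp only
    rw [h2, ← Finset.sum_mul]
    calc _ ≤ W * (1 + ∑ i : Fin (n + 1) with k < i.val, h⁻¹ ^ (2 * B) * p.1 i ^ (4 * B)) *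
            (y ^ (n - 1) * X⁻¹ * ‖S p‖ ^ 2) := by gcongr
      _ = _ := by ring
  refine hle.trans ?_
  rw [integral_const_mul, integral_add hint0 (integrable_finsetSum _ fun i _ => hint i),
    integral_finsetSum _ fun i _ => hint i]
  have hsum : y ^ (n - 1) * (∫ p, ‖S p‖ ^ 2 ∂(surfaceMeasure n)
      + ∑ i : Fin (n + 1) with k < i.val,
        ∫ p, (h⁻¹ ^ (2 * B) * p.1 i ^ (4 * B)) * ‖S p‖ ^ 2 ∂(surfaceMeasure n))
      ≤ (s ^ (n - 1) * C + ∑ i : Fin (n + 1) with k < i.val, s ^ (n - 1 + 4 * B) * C' i) *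
        (N * (1 + η)) := by
    rw [mul_add, Finset.mul_sum, add_mul, Finset.sum_mul]
    exact add_le_add hI0 (Finset.sum_le_sum fun i hi => hI i (Finset.mem_filter.mp hi).2)
  have hNX : X⁻¹ * (N * (1 + η)) ≤ (δ + 1) * (1 + η) := by
    rw [inv_mul_le_iff₀ hX]
    calc (N : ℝ) * (1 + η) ≤ ((δ + 1) * X) * (1 + η) := by gcongr
      _ = _ := by ring
  calc _ = W * (X⁻¹ * (y ^ (n - 1) * (∫ p, ‖S p‖ ^ 2 ∂(surfaceMeasure n)
        + ∑ i : Fin (n + 1) with k < i.val,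
          ∫ p, (h⁻¹ ^ (2 * B) * p.1 i ^ (4 * B)) * ‖S p‖ ^ 2 ∂(surfaceMeasure n)))) := by ring
    _ ≤ W * (X⁻¹ * ((s ^ (n - 1) * C +
        ∑ i : Fin (n + 1) with k < i.val, s ^ (n - 1 + 4 * B) * C' i) * (N * (1 + η)))) := by
        gcongr
    _ = W * ((s ^ (n - 1) * C + ∑ i : Fin (n + 1) with k < i.val, s ^ (n - 1 + 4 * B) * C' i) *
        (X⁻¹ * (N * (1 + η)))) := by ring
    _ ≤ W * ((s ^ (n - 1) * C + ∑ i : Fin (n + 1) with k < i.val, s ^ (n - 1 + 4 * B) * C' i) *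
        ((δ + 1) * (1 + η))) := by gcongr
    _ ≤ _ := by linarith

/-- Lower bound for the unweighted norm, when the beams are so well separated that the sum of all
the cross terms in one row is at most `η`. -/
theorem exists_le_integral_norm_harmonicSum (hk1 : 1 ≤ k) (hk : k ≤ n) (α K : ℝ) {c : ℝ}
    (hc : 0 < c) (A : ℕ → ℝ) (r : ℕ) :
    ∃ c₀ C : ℝ, 0 < c₀ ∧ 0 ≤ C ∧ ∀ (η : ℝ), C * η ≤ c₀ → ∀ (δ : ℝ) (j : ℕ), 1 ≤ j → ∀ (N : ℕ),
    δ * semiclassicalH n j ^ ((α - 1 / 2) * ((k : ℝ) - 1)) ≤ N →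
    ∀ a : Fin N → Fin k → ℝ, (∀ l, ∑ m, a l m ^ 2 = 1) →
    ∀ J : ℕ, |(J : ℝ) - j| ≤ K →
    (∀ l, ∑ l' ∈ Finset.univ.erase l,
      ((1 + Real.sqrt (J + 1) * ‖coeffVec hk (a l) - coeffVec hk (a l')‖) ^ r)⁻¹ ≤ η) →
    ∀ f : Fin N → UnitSphere n → ℂ, (∀ l, AdmissibleWeight (semiclassicalH n j) c A (f l)) →
    δ * c₀ ≤ ∫ p, ‖harmonicSum hk α j a J f p‖ ^ 2 ∂(surfaceMeasure n) := by
  have hn : 1 ≤ n := hk1.trans hk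
  have hn' : (1 : ℝ) ≤ n := by exact_mod_cast hn
  set κ : ℝ := n * (|K| + 2) with hκ
  have hκ0 : 0 < κ := by positivity
  obtain ⟨c₀, C, hc₀, hC, hmain⟩ := exists_le_integral_norm_sum_beams hn r A κ hc
  set s := Real.sqrt κ with hs
  have hs0 : 0 < s := Real.sqrt_pos.mpr hκ0
  refine ⟨c₀ / 2 / s ^ (n - 1), C / s ^ (n - 1), by positivity, by positivity, ?_⟩
  intro η hCη δ j hj N hN a ha J hJ hη f hf
  have hCη' : C * η ≤ c₀ / 2 := by
    rw [div_mul_eq_mul_div] at hCη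
    exact (div_le_div_iff_of_pos_right (by positivity)).mp hCη
  set h := semiclassicalH n j with hh_def
  have hh : 0 < h := semiclassicalH_pos hn hj
  obtain ⟨hκ1, hκ2⟩ := semiclassicalH_inv_comparable hn hj hJ
  set X := h ^ ((α - 1 / 2) * ((k : ℝ) - 1)) with hX_def
  have hX : 0 < X := Real.rpow_pos_of_pos hh _
  set R := Real.sqrt (J + 1) with hR
  have hR0 : 0 < R := by positivity
  set y := Real.sqrt h⁻¹ with hy
  have hRsy : R ≤ s * y := by
    rw [hy, hs, hR, ← Real.sqrt_mul hκ0.le]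
    exact Real.sqrt_le_sqrt hκ2
  have hb1 : ∀ l, ‖coeffVec hk (a l)‖ = 1 := fun l => by
    have := norm_sq_coeffVec hk (a l)
    rw [ha l] at this
    exact (pow_eq_one_iff_of_nonneg (norm_nonneg _) two_ne_zero).mp this
  have h1 := hmain N _ hb1 (fun l => coeffVec_apply_zero hk (a l)) J h f hh hκ1 hf η hη
  simp_rw [norm_sq_harmonicSum hk hn hj α a J f]
  rw [integral_const_mul]
  set Q := ∫ p, ‖∑ l, beamForm (coeffVec hk (a l)) p.1 ^ J * f l p‖ ^ 2 ∂(surfaceMeasure n)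
  have hQ : 0 ≤ Q := integral_nonneg fun p => sq_nonneg _
  have h2 : N * (c₀ / 2) ≤ Q * (s * y) ^ (n - 1) := by
    calc N * (c₀ / 2) ≤ N * (c₀ - C * η) := by gcongr; linarith
      _ ≤ Q * R ^ (n - 1) := h1
      _ ≤ _ := by gcongr
  have h3 : δ * X * (c₀ / 2) ≤ Q * (s * y) ^ (n - 1) :=
    (mul_le_mul_of_nonneg_right hN (by positivity)).trans h2
  rw [mul_pow] at h3
  calc δ * (c₀ / 2 / s ^ (n - 1)) = (δ * X * (c₀ / 2)) * (X⁻¹ / s ^ (n - 1)) := by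
        field_simp
    _ ≤ (Q * (s ^ (n - 1) * y ^ (n - 1))) * (X⁻¹ / s ^ (n - 1)) := by gcongr
    _ = y ^ (n - 1) * X⁻¹ * Q := by field_simp

/-- A lower bound for the unweighted norm and upper bounds for the weights with exponents `β` and
`-β` give a lower bound for the weighted norm, by the arithmetic-geometric mean inequality. -/
theorem sq_div_le_integral_polyWeight_mul {t : ℝ} (ht : 0 ≤ t) (β : ℝ) {v : UnitSphere n → ℂ}
    (hv : Continuous v) {L U : ℝ} (hL : 0 < L) (hU : 0 < U)
    (hLv : L ≤ ∫ p, ‖v p‖ ^ 2 ∂(surfaceMeasure n))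
    (hUv : ∫ p, polyWeight k t (-β) p ^ 2 * ‖v p‖ ^ 2 ∂(surfaceMeasure n) ≤ U) :
    L ^ 2 / U ≤ ∫ p, polyWeight k t β p ^ 2 * ‖v p‖ ^ 2 ∂(surfaceMeasure n) := by
  have hint : ∀ γ : ℝ, Integrable (fun p => polyWeight k t γ p ^ 2 * ‖v p‖ ^ 2)
      (surfaceMeasure n) := fun γ => integrable_sphere_of_continuous
    (((continuous_polyWeight k ht γ).pow 2).mul (hv.norm.pow 2))
  -- `2 ≤ λ w ^ 2 + λ⁻¹ w⁻²` with the balancing choice `λ = U / L`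
  have h1 : ∫ p, 2 * ‖v p‖ ^ 2 ∂(surfaceMeasure n)
      ≤ ∫ p, ((U / L) * (polyWeight k t β p ^ 2 * ‖v p‖ ^ 2)
        + (L / U) * (polyWeight k t (-β) p ^ 2 * ‖v p‖ ^ 2)) ∂(surfaceMeasure n) := by
    refine integral_mono (integrable_sphere_of_continuous
      (continuous_const.mul (hv.norm.pow 2)))
      (((hint β).const_mul _).add ((hint (-β)).const_mul _)) fun p => ?_
    simp only
    have hw := polyWeight_mul_polyWeight_neg k ht β p
    set w := polyWeight k t β p
    set w' := polyWeight k t (-β) p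
    have h2 : 2 ≤ (U / L) * w ^ 2 + (L / U) * w' ^ 2 := by
      have h3 : (U / L) * w ^ 2 + (L / U) * w' ^ 2 - 2 * (w * w')
          = (U * w - L * w') ^ 2 / (L * U) := by
        field_simp
        ring
      have h4 : 0 ≤ (U * w - L * w') ^ 2 / (L * U) := by positivity
      rw [hw] at h3
      linarith
    calc 2 * ‖v p‖ ^ 2 ≤ ((U / L) * w ^ 2 + (L / U) * w' ^ 2) * ‖v p‖ ^ 2 := by gcongr
      _ = _ := by ring
  rw [integral_const_mul, integral_add ((hint β).const_mul _) ((hint (-β)).const_mul _),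
    integral_const_mul, integral_const_mul] at h1
  have h5 : (L / U) * ∫ p, polyWeight k t (-β) p ^ 2 * ‖v p‖ ^ 2 ∂(surfaceMeasure n) ≤ L := by
    calc _ ≤ (L / U) * U := by gcongr
      _ = L := by field_simp
  set Q := ∫ p, polyWeight k t β p ^ 2 * ‖v p‖ ^ 2 ∂(surfaceMeasure n)
  have h6 : L ≤ (U / L) * Q := by linarith
  rw [div_le_iff₀ hU]
  have h7 : L * L ≤ L * ((U / L) * Q) := by gcongr
  have h8 : L * ((U / L) * Q) = Q * U := by field_simp
  nlinarith

end TwoSidedBounds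

/-! ### Choice of the coefficients -/

section Directions

variable {n k : ℕ}

/-- The coefficient vectors of the linear polynomials. For every `M ≥ 1` the directions are placed
on a grid with spacing a multiple of `M h ^ (1/2)` in a ball of radius a multiple of `h ^ α`, which
has room for the required number of directions; the cross terms in each row then add up to a
multiple of `M⁻¹`. -/
theorem exists_coefficients (hk1 : 1 ≤ k) (hk : k ≤ n) {α : ℝ} (hα0 : 0 ≤ α) {ε : ℝ}
    (hε : 0 < ε) (K : ℝ) {M : ℝ} (hM : 1 ≤ M) :
    ∃ δ : ℝ, 0 < δ ∧ δ ≤ ε ∧ ∀ j : ℕ, 1 ≤ j → ∃ a : Fin (termCount n k α δ j) → Fin k → ℝ,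
      (∀ l, ∑ m, a l m ^ 2 = 1) ∧
      (∀ l m, (m.val = 0 → |1 - a l m| ≤ ε * semiclassicalH n j ^ (2 * α)) ∧
        (m.val ≠ 0 → |a l m| ≤ ε * semiclassicalH n j ^ α)) ∧
      ∀ J : ℕ, |(J : ℝ) - j| ≤ K → ∀ l, ∑ l' ∈ Finset.univ.erase l,
        ((1 + Real.sqrt (J + 1) * ‖coeffVec hk (a l) - coeffVec hk (a l')‖) ^
          (2 * (k - 1) + 1))⁻¹ ≤ M⁻¹ * (∑' z : ℤ, ((1 + |(z : ℝ)|) ^ 2)⁻¹) ^ (k - 1) := by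
  have hn : 1 ≤ n := hk1.trans hk
  have hn' : (1 : ℝ) ≤ n := by exact_mod_cast hn
  have hk' : (1 : ℝ) ≤ k := by exact_mod_cast hk1
  set κ : ℝ := n * (|K| + 2) with hκ
  have hκ0 : 0 < κ := by positivity
  set s := Real.sqrt κ with hs
  have hs0 : 0 < s := Real.sqrt_pos.mpr hκ0
  -- small enough that the radius `τ = ε' h ^ α` meets both `k τ ^ 2 ≤ ε h ^ (2 α)` and
  -- `k τ ^ 2 ≤ 1`
  set ε' : ℝ := min ε 1 / k with hε'
  have hmin0 : 0 < min ε 1 := lt_min hε one_pos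
  have hε'0 : 0 < ε' := by positivity
  have hε'1 : ε' ≤ min ε 1 := div_le_self hmin0.le hk'
  have hkε : k * ε' = min ε 1 := by rw [hε']; field_simp
  have hε'sq : k * ε' ^ 2 ≤ min ε 1 := by
    calc k * ε' ^ 2 = (k * ε') * ε' := by ring
      _ ≤ min ε 1 * 1 := by rw [hkε]; gcongr; exact hε'1.trans (min_le_right _ _)
      _ = _ := mul_one _
  -- `τ / σ = q h ^ (α - 1/2)` is the number of grid points along one edge
  set q := ε' / (M * s) with hq
  have hq0 : 0 < q := by positivity
  refine ⟨min ε (q ^ (k - 1)), lt_min hε (by positivity), min_le_left _ _, fun j hj => ?_⟩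
  set δ := min ε (q ^ (k - 1)) with hδ
  set h := semiclassicalH n j with hh_def
  have hh : 0 < h := semiclassicalH_pos hn hj
  have hh1 : h ≤ 1 := semiclassicalH_le_one hn hj
  set τ := ε' * h ^ α with hτ
  set σ := M * s * Real.sqrt h with hσ
  have hσ0 : 0 < σ := by have := Real.sqrt_pos.mpr hh; positivity
  have hτ0 : 0 ≤ τ := by positivity
  have hhα : (h ^ α) ^ 2 = h ^ (2 * α) := by
    rw [← Real.rpow_natCast, ← Real.rpow_mul hh.le]; congr 1; push_cast; ring
  have hhα1 : h ^ (2 * α) ≤ 1 := Real.rpow_le_one hh.le hh1 (by positivity)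
  have hkτ : k * τ ^ 2 ≤ min ε 1 * h ^ (2 * α) := by
    calc k * τ ^ 2 = (k * ε' ^ 2) * h ^ (2 * α) := by rw [hτ, mul_pow, hhα]; ring
      _ ≤ _ := by gcongr
  have hkτ1 : k * τ ^ 2 ≤ 1 := hkτ.trans
    (mul_le_one₀ (min_le_right _ _) (by positivity) hhα1)
  have hcount : termCount n k α δ j ≤ (⌊τ / σ⌋₊ + 1) ^ (k - 1) := by
    rw [termCount, Nat.ceil_le]
    push_cast
    have h1 : τ / σ = q * h ^ (α - 1 / 2) := by
      rw [hτ, hσ, hq, Real.rpow_sub hh, Real.sqrt_eq_rpow]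
      field_simp
    have h2 : h ^ ((α - 1 / 2) * ((k : ℝ) - 1)) = (h ^ (α - 1 / 2)) ^ (k - 1) := by
      rw [← Real.rpow_natCast _ (k - 1), ← Real.rpow_mul hh.le]
      push_cast [Nat.cast_sub hk1]
      rfl
    calc δ * h ^ ((α - 1 / 2) * ((k : ℝ) - 1))
        ≤ q ^ (k - 1) * h ^ ((α - 1 / 2) * ((k : ℝ) - 1)) := by
          gcongr
          exact min_le_right _ _
      _ = (τ / σ) ^ (k - 1) := by rw [h1, h2, mul_pow]
      _ ≤ _ := by
        gcongr
        exact (Nat.lt_floor_add_one _).le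
  obtain ⟨a, ha1, ha2, ha3⟩ := exists_separated_directions k hk1 hσ0 hτ0 hkτ1 _ hcount
  refine ⟨a, ha1, fun l m => ⟨fun hm => ?_, fun hm => ?_⟩, fun J hJ => ?_⟩
  · refine ((ha2 l m).1 hm).trans (hkτ.trans ?_)
    gcongr
    exact min_le_left _ _
  · refine ((ha2 l m).2 hm).trans ?_
    rw [hτ]
    gcongr
    exact hε'1.trans (min_le_left _ _)
  · refine ha3 (Real.sqrt (J + 1)) M (fun l l' => ‖coeffVec hk (a l) - coeffVec hk (a l')‖)
      (Real.sqrt_nonneg _) hM ?_ fun l l' i => ?_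
    · obtain ⟨hκ1, -⟩ := semiclassicalH_inv_comparable hn hj hJ
      have h1 : 1 ≤ κ * (J + 1) * h := by
        rwa [inv_le_iff_one_le_mul₀ hh] at hκ1
      have h2 : 1 ≤ s * Real.sqrt (J + 1) * Real.sqrt h := by
        rw [hs, ← Real.sqrt_mul hκ0.le, ← Real.sqrt_mul (by positivity)]
        exact Real.one_le_sqrt.mpr h1
      calc M = M * 1 := (mul_one M).symm
        _ ≤ M * (s * Real.sqrt (J + 1) * Real.sqrt h) := by gcongr
        _ = _ := by rw [hσ]; ring
    · rw [← coeffVec_sub]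
      have h1 := PiLp.norm_apply_le (coeffVec hk (a l - a l')) (Fin.castLE hk i).succ
      rwa [coeffVec_apply_succ, Pi.sub_apply, Real.norm_eq_abs] at h1

end Directions

theorem mainTheorem1
    (n k : ℕ) (hk1 : 1 ≤ k) (hkn : k ≤ n)
    (α : ℝ) (hα0 : 0 ≤ α) (hα1 : α ≤ 1 / 2)
    (ε : ℝ) (hε : 0 < ε)
    (K c : ℝ) (hc : 0 < c) (A : ℕ → ℝ) :
    ∃ δ : ℝ, 0 < δ ∧ δ ≤ ε ∧
    ∃ a : (j : ℕ) → Fin (termCount n k α δ j) → Fin k → ℝ,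
      -- the coefficient bounds
      (∀ j : ℕ, 1 ≤ j → ∀ (l : Fin (termCount n k α δ j)) (m : Fin k),
        (m.val = 0 → |1 - a j l m| ≤ ε * semiclassicalH n j ^ (2 * α)) ∧
        (m.val ≠ 0 → |a j l m| ≤ ε * semiclassicalH n j ^ α)) ∧
      -- the unweighted sums are exact eigenfunctions
      (∀ j : ℕ, 1 ≤ j →
        ContMDiff (𝓡 n) 𝓘(ℝ, ℂ) ∞ (harmonicSum hkn α j (a j) j (fun _ _ => 1)) ∧
        ∀ x : UnitSphere n,
          sphereLaplacian (harmonicSum hkn α j (a j) j (fun _ _ => 1)) x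
            = (j : ℂ) * ((j : ℂ) + (n : ℂ) - 1)
                * harmonicSum hkn α j (a j) j (fun _ _ => 1) x) ∧
      -- the weighted two-sided bound for k < n
      (k < n → ∀ β : ℝ, ∃ c₁ c₂ : ℝ, 0 < c₁ ∧ 0 < c₂ ∧
        ∀ j : ℕ, 1 ≤ j → ∀ j' : ℕ, |(j' : ℝ) - (j : ℝ)| ≤ K →
        ∀ f : Fin (termCount n k α δ j) → UnitSphere n → ℂ,
          (∀ l, AdmissibleWeight (semiclassicalH n j) c A (f l)) →
          ∀ t : ℝ, (t = semiclassicalH n j ∨ t = (semiclassicalH n j)⁻¹) →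
            ENNReal.ofReal c₁ ≤ sphereL2Norm
                (fun x => (polyWeight k t β x : ℂ) * harmonicSum hkn α j (a j) j' f x) ∧
            sphereL2Norm
                (fun x => (polyWeight k t β x : ℂ) * harmonicSum hkn α j (a j) j' f x)
              ≤ ENNReal.ofReal c₂) ∧
      -- the two-sided bound for k = n
      (k = n → ∃ c₁ c₂ : ℝ, 0 < c₁ ∧ 0 < c₂ ∧
        ∀ j : ℕ, 1 ≤ j → ∀ j' : ℕ, |(j' : ℝ) - (j : ℝ)| ≤ K →
        ∀ f : Fin (termCount n k α δ j) → UnitSphere n → ℂ,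
          (∀ l, AdmissibleWeight (semiclassicalH n j) c A (f l)) →
            ENNReal.ofReal c₁ ≤ sphereL2Norm (harmonicSum hkn α j (a j) j' f) ∧
            sphereL2Norm (harmonicSum hkn α j (a j) j' f) ≤ ENNReal.ofReal c₂) := by
  have hn : 1 ≤ n := hk1.trans hkn
  set r := 2 * (k - 1) + 1 with hr
  set D := (∑' z : ℤ, ((1 + |(z : ℝ)|) ^ 2)⁻¹) ^ (k - 1) with hD
  have hD0 : 0 ≤ D := pow_nonneg (tsum_nonneg fun z => by positivity) _
  obtain ⟨c₀, C, hc₀, hC, hlow⟩ := exists_le_integral_norm_harmonicSum hk1 hkn α K hc A r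
  -- separation in units of `h ^ (1/2)` that makes the cross terms negligible
  set M := 1 + C * D / c₀ with hM
  have hM1 : 1 ≤ M := by
    have : 0 ≤ C * D / c₀ := by positivity
    linarith
  set η := M⁻¹ * D with hη
  have hη0 : 0 ≤ η := by positivity
  have hCη : C * η ≤ c₀ := by
    have h1 : C * D ≤ c₀ * M := by
      have : c₀ * M = c₀ + C * D := by rw [hM]; field_simp
      linarith
    calc C * η = M⁻¹ * (C * D) := by rw [hη]; ring
      _ ≤ M⁻¹ * (c₀ * M) := by gcongr
      _ = c₀ := by field_simp
  obtain ⟨δ, hδ0, hδε, hdir⟩ := exists_coefficients hk1 hkn hα0 hε K hM1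
  -- nothing is required of the coefficients for `j = 0`
  have hdir' : ∀ j : ℕ, ∃ a : Fin (termCount n k α δ j) → Fin k → ℝ, 1 ≤ j → _ := fun j =>
    (em (1 ≤ j)).elim (fun hj => (hdir j hj).imp fun _ ha _ => ha)
      fun hj => ⟨fun _ _ => 0, fun h => absurd h hj⟩
  choose a ha using hdir'
  have key : ∀ β : ℝ, ∃ c₁ c₂ : ℝ, 0 < c₁ ∧ 0 < c₂ ∧
      ∀ j : ℕ, 1 ≤ j → ∀ j' : ℕ, |(j' : ℝ) - (j : ℝ)| ≤ K →
      ∀ f : Fin (termCount n k α δ j) → UnitSphere n → ℂ,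
        (∀ l, AdmissibleWeight (semiclassicalH n j) c A (f l)) →
        ∀ t : ℝ, (t = semiclassicalH n j ∨ t = (semiclassicalH n j)⁻¹) →
          ENNReal.ofReal c₁ ≤ sphereL2Norm
              (fun x => (polyWeight k t β x : ℂ) * harmonicSum hkn α j (a j) j' f x) ∧
          sphereL2Norm
              (fun x => (polyWeight k t β x : ℂ) * harmonicSum hkn α j (a j) j' f x)
            ≤ ENNReal.ofReal c₂ := by
    intro β
    set B := ⌈|β|⌉₊ with hB
    have hβB : |β| ≤ B := Nat.le_ceil _
    obtain ⟨U, hU0, hU⟩ := exists_integral_polyWeight_mul_harmonicSum_le hk1 hkn α hδ0.le K c A r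
      hη0 B
    have hL0 : 0 < δ * c₀ := by positivity
    refine ⟨Real.sqrt ((δ * c₀) ^ 2 / U), Real.sqrt U, Real.sqrt_pos.mpr (by positivity),
      Real.sqrt_pos.mpr hU0, ?_⟩
    intro j hj j' hj' f hf t ht
    have hh := semiclassicalH_pos hn hj
    have hh1 := semiclassicalH_le_one hn hj
    have hhinv : semiclassicalH n j ≤ (semiclassicalH n j)⁻¹ := hh1.trans ((one_le_inv₀ hh).mpr hh1)
    have ht0 : 0 ≤ t := by rcases ht with rfl | rfl <;> positivity
    have hth : t ≤ (semiclassicalH n j)⁻¹ := by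
      rcases ht with rfl | rfl
      · exact hhinv
      · exact le_rfl
    obtain ⟨ha1, -, ha3⟩ := ha j hj
    have hX : 1 ≤ semiclassicalH n j ^ ((α - 1 / 2) * ((k : ℝ) - 1)) :=
      Real.one_le_rpow_of_pos_of_le_one_of_nonpos hh hh1
        (mul_nonpos_of_nonpos_of_nonneg (by linarith) (by
          have : (1 : ℝ) ≤ k := by exact_mod_cast hk1
          linarith))
    have hN1 : δ * semiclassicalH n j ^ ((α - 1 / 2) * ((k : ℝ) - 1)) ≤ termCount n k α δ j :=
      Nat.le_ceil _
    have hN2 : (termCount n k α δ j : ℝ)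
        ≤ (δ + 1) * semiclassicalH n j ^ ((α - 1 / 2) * ((k : ℝ) - 1)) := by
      have := Nat.ceil_lt_add_one
        (a := δ * semiclassicalH n j ^ ((α - 1 / 2) * ((k : ℝ) - 1))) (by positivity)
      rw [termCount]
      linarith
    have hvc := continuous_harmonicSum hkn α j (a j) j' fun l => (hf l).smooth.continuous
    have hup := hU j hj _ hN2 (a j) ha1 j' hj' (ha3 j' hj') f hf t ht0 hth
    have hlo := sq_div_le_integral_polyWeight_mul (k := k) ht0 β hvc hL0 hU0
      (hlow η hCη δ j hj _ hN1 (a j) ha1 j' hj' (ha3 j' hj') f hf)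
      (hup (-β) ((neg_le_abs β).trans hβB))
    have hwc : Continuous fun x =>
        (polyWeight k t β x : ℂ) * harmonicSum hkn α j (a j) j' f x :=
      (Complex.continuous_ofReal.comp (continuous_polyWeight k ht0 β)).mul hvc
    rw [sphereL2Norm_eq_ofReal_sqrt hwc]
    simp_rw [norm_mul, mul_pow (‖_‖), Complex.norm_real, Real.norm_eq_abs, sq_abs]
    exact ⟨ENNReal.ofReal_le_ofReal (Real.sqrt_le_sqrt hlo),
      ENNReal.ofReal_le_ofReal (Real.sqrt_le_sqrt (hup β ((le_abs_self β).trans hβB)))⟩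
  refine ⟨δ, hδ0, hδε, a, fun j hj => (ha j hj).2.1, fun j hj => ⟨?_, ?_⟩, fun _ => key,
    fun _ => ?_⟩
  · exact contMDiff_harmonicSum_one hkn α j (a j) j
  · exact sphereLaplacian_harmonicSum hkn α j (a j) (ha j hj).1
  · obtain ⟨c₁, c₂, h₁, h₂, hb⟩ := key 0
    refine ⟨c₁, c₂, h₁, h₂, fun j hj j' hj' f hf => ?_⟩
    simpa [polyWeight] using hb j hj j' hj' f hf _ (Or.inl rfl)
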